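/- **Setting.** Let $G$ be a second-countable, locally compact Hausdorff groupoid with unit space $G^{(0)}$, range and source maps $r(\gamma)=\gamma\gamma^{-1}$, $s(\gamma)=\gamma^{-1}\gamma$, and a left Haar system $\lambda=\{\lambda^u\}_{u\in G^{(0)}}$ ($\operatorname{supp}\lambda^u=r^{-1}(u)$); $\lambda_u$ is the image of $\lambda^u$ under inversion. Let $\omega:G^{(2)}\to\mathbb T$ be a continuous $2$-cocycle, normalized so that $\omega(r(\gamma),\gamma)=1=\omega(\gamma,s(\gamma))$. The extension $G^\omega$ is the groupoid $\mathbb T\times G$ with the product topology, multiplication $(s,\eta)(t,\gamma)=(st\,\omega(\eta,\gamma),\eta\gamma)$, inverse $(t,\gamma)^{-1}=(t^{-1}\omega(\gamma,\gamma^{-1})^{-1},\gamma^{-1})$, and Haar system $\{\tau\times\lambda^u\}$, where $\tau$ ($d\tau(t)=dt$) is normalized Haar measure on $\mathbb T$. For a second-countable, locally compact Hausdorff groupoid $E$ with Haar system $\beta$ and a continuous normalized $2$-cocycle $\sigma$, $C_c(E,\sigma)$ is the $*$-algebra $C_c(E)$ with $$f*g(\gamma)=\int f(\eta)g(\eta^{-1}\gamma)\sigma(\eta,\eta^{-1}\gamma)\,d\beta^{r(\gamma)}(\eta),\qquad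 f^*(\gamma)=\overline{f(\gamma^{-1})}\;\overline{\sigma(\gamma,\gamma^{-1})}.$$ $C^*(E,\sigma)$ is its completion in the norm $\|f\|=\sup\|\rho(f)\|$, the supremum over all Hilbert-space representations $\rho$ of $C_c(E,\sigma)$ that are continuous for the inductive limit topology and the weak operator topology. $C^*_r(E,\sigma)$ is its completion in the norm $\|f\|_r=\sup_{u\in E^{(0)}}\|\Pi^u(f)\|$, where $\Pi^u$ is the left-regular representation on $L^2(E,\beta_u)$, characterized by $$(\Pi^u(f)\xi\mid\zeta)=\int_E\int_E f(\gamma\eta)\,\xi(\eta^{-1})\,\overline{\zeta(\gamma)}\,\sigma(\gamma\eta,\eta^{-1})\,d\beta^u(\eta)\,d\beta_u(\gamma).$$ The canonical quotient map $C^*(E,\sigma)\to C^*_r(E,\sigma)$ is the $*$-homomorphism that is the identity on $C_c(E,\sigma)$. Write $C^*(G^\omega)=C^*(G^\omega,1)$, $C^*_r(G^\omega)=C^*_r(G^\omega,1)$, and let $q_{G^\omega}:C^*(G^\omega)\to C^*_r(G^\omega)$ and $q_{G,n}:C^*(G,\omega^n)\to C^*_r(G,\omega^n)$ be the canonical quotient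 maps. For $n\in\mathbb Z$ let $\Upsilon_n:C^*(G^\omega)\to C^*(G,\omega^n)$ be the $*$-homomorphism determined by $$\Upsilon_n(F)(\gamma)=\int_{\mathbb T}F(t,\gamma)\,t^n\,dt\qquad(F\in C_c(G^\omega)).$$ **Theorem 4.1.** The canonical maps $q_{G^\omega}$, $q_{G,n}$ and $\Upsilon_n$ exist and are unique. For every $n\in\mathbb Z$ there is a $*$-homomorphism $\Omega_n:C^*_r(G^\omega)\to C^*_r(G,\omega^n)$ such that $$\Omega_n\circ q_{G^\omega}=q_{G,n}\circ\Upsilon_n ;$$ on $C_c(G^\omega)$ it is given by $F\mapsto\Upsilon_n(F)$. Furthermore, $a\mapsto(\Omega_n(a))_{n\in\mathbb Z}$ is a $*$-isomorphism $\Omega$ of $C^*_r(G^\omega)$ onto the $C^*$-algebraic direct sum $\bigoplus_{n\in\mathbb Z}C^*_r(G,\omega^n)$ (families $(a_n)_n$ with $\|a_n\|\to0$ as $|n|\to\infty$, with the supremum norm). -/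

import Mathlib

open MeasureTheory Topology Filter Set
open scoped ENNReal NNReal CompactlySupported ComplexConjugate InnerProductSpace

universe u

noncomputable section

namespace TwistedGroupoid

/-- A topological groupoid, given by its space `G` of arrows. A pair `(γ, η)` is composable when
`s γ = r η`; `mul γ η` is only meaningful (and is only constrained) for composable pairs. -/
structure TopGroupoid (G : Type u) [TopologicalSpace G] where
  mul : G → G → G
  inv : G → G
  /-- the range map -/
  r : G → G
  /-- the source map -/
  s : G → G
  r_eq : ∀ γ, r γ = mul γ (inv γ)
  s_eq : ∀ γ, s γ = mul (inv γ) γ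
  inv_inv : ∀ γ, inv (inv γ) = γ
  r_mul : ∀ γ η, s γ = r η → r (mul γ η) = r γ
  s_mul : ∀ γ η, s γ = r η → s (mul γ η) = s η
  mul_assoc : ∀ γ η ζ, s γ = r η → s η = r ζ → mul (mul γ η) ζ = mul γ (mul η ζ)
  inv_mul_cancel : ∀ γ η, s γ = r η → mul (inv γ) (mul γ η) = η
  mul_inv_cancel : ∀ γ η, s γ = r η → mul (mul γ η) (inv η) = γ
  continuous_inv : Continuous inv
  continuousOn_mul : ContinuousOn (fun p : G × G => mul p.1 p.2) {p | s p.1 = r p.2}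

namespace TopGroupoid

variable {G : Type u} [TopologicalSpace G] (𝒢 : TopGroupoid G)

/-- The set `G⁽²⁾` of composable pairs. -/
def composable : Set (G × G) := {p | 𝒢.s p.1 = 𝒢.r p.2}

/-- The unit space `G⁽⁰⁾`. -/
def units : Set G := {x | 𝒢.r x = x}

lemma r_inv (γ : G) : 𝒢.r (𝒢.inv γ) = 𝒢.s γ := by rw [𝒢.r_eq, 𝒢.s_eq, 𝒢.inv_inv]
lemma s_inv (γ : G) : 𝒢.s (𝒢.inv γ) = 𝒢.r γ := by rw [𝒢.r_eq, 𝒢.s_eq, 𝒢.inv_inv]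
lemma r_r (γ : G) : 𝒢.r (𝒢.r γ) = 𝒢.r γ := by
  conv_lhs => rw [𝒢.r_eq γ]
  exact 𝒢.r_mul _ _ (𝒢.r_inv γ).symm
lemma s_r (γ : G) : 𝒢.s (𝒢.r γ) = 𝒢.r γ := by
  conv_lhs => rw [𝒢.r_eq γ]
  rw [𝒢.s_mul _ _ (𝒢.r_inv γ).symm, 𝒢.s_inv]
lemma r_s (γ : G) : 𝒢.r (𝒢.s γ) = 𝒢.s γ := by rw [← 𝒢.r_inv γ]; exact 𝒢.r_r _
lemma s_s (γ : G) : 𝒢.s (𝒢.s γ) = 𝒢.s γ := by rw [← 𝒢.r_inv γ]; exact 𝒢.s_r _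
lemma r_mul_self (γ : G) : 𝒢.mul (𝒢.r γ) γ = γ := by
  have := 𝒢.mul_inv_cancel γ (𝒢.inv γ) (𝒢.r_inv γ).symm
  rwa [𝒢.inv_inv, ← 𝒢.r_eq] at this
lemma mul_s_self (γ : G) : 𝒢.mul γ (𝒢.s γ) = γ := by
  have := 𝒢.inv_mul_cancel (𝒢.inv γ) γ (𝒢.s_inv γ)
  rwa [𝒢.inv_inv, ← 𝒢.s_eq] at this
lemma inv_mul (γ η : G) (h : 𝒢.s γ = 𝒢.r η) :
    𝒢.inv (𝒢.mul γ η) = 𝒢.mul (𝒢.inv η) (𝒢.inv γ) := by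
  have h1 : 𝒢.s (𝒢.inv η) = 𝒢.r (𝒢.inv γ) := by rw [s_inv, r_inv, h]
  have h2 : 𝒢.s (𝒢.mul (𝒢.inv η) (𝒢.inv γ)) = 𝒢.r (𝒢.mul γ η) := by
    rw [𝒢.s_mul _ _ h1, 𝒢.r_mul _ _ h, s_inv]
  have h3 : 𝒢.mul (𝒢.mul (𝒢.inv η) (𝒢.inv γ)) (𝒢.mul γ η) = 𝒢.s η := by
    rw [𝒢.mul_assoc _ _ _ h1 (by rw [s_inv, 𝒢.r_mul _ _ h]), 𝒢.inv_mul_cancel _ _ h, 𝒢.s_eq]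
  have h4 := 𝒢.mul_inv_cancel _ _ h2
  rw [h3, ← 𝒢.s_mul _ _ h, ← r_inv, r_mul_self] at h4
  exact h4
lemma continuous_r : Continuous 𝒢.r := by
  have h : Continuous fun γ => (γ, 𝒢.inv γ) := continuous_id.prodMk 𝒢.continuous_inv
  have := 𝒢.continuousOn_mul.comp_continuous h fun γ => (𝒢.r_inv γ).symm
  exact this.congr fun γ => (𝒢.r_eq γ).symm
lemma continuous_s : Continuous 𝒢.s :=
  (𝒢.continuous_r.comp 𝒢.continuous_inv).congr fun γ => 𝒢.r_inv γ

/-- Inversion as a homeomorphism. -/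
def invHomeo : G ≃ₜ G where
  toFun := 𝒢.inv
  invFun := 𝒢.inv
  left_inv := 𝒢.inv_inv
  right_inv := 𝒢.inv_inv
  continuous_toFun := 𝒢.continuous_inv
  continuous_invFun := 𝒢.continuous_inv

end TopGroupoid

/-- A continuous normalized `𝕋`-valued 2-cocycle on the composable pairs. The values off the
composable pairs are not constrained. -/
structure Cocycle {G : Type u} [TopologicalSpace G] (𝒢 : TopGroupoid G) where
  toFun : G → G → Circle
  continuousOn : ContinuousOn (fun p : G × G => toFun p.1 p.2) 𝒢.composable
  cocycle : ∀ γ η ξ, 𝒢.s γ = 𝒢.r η → 𝒢.s η = 𝒢.r ξ →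
    toFun γ η * toFun (𝒢.mul γ η) ξ = toFun η ξ * toFun γ (𝒢.mul η ξ)
  map_r : ∀ γ, toFun (𝒢.r γ) γ = 1
  map_s : ∀ γ, toFun γ (𝒢.s γ) = 1

namespace Cocycle

variable {G : Type u} [TopologicalSpace G] {𝒢 : TopGroupoid G}

/-- The trivial cocycle. -/
instance : One (Cocycle 𝒢) where
  one :=
    { toFun := fun _ _ => 1
      continuousOn := continuousOn_const
      cocycle := fun _ _ _ _ _ => rfl
      map_r := fun _ => rfl
      map_s := fun _ => rfl }

/-- The pointwise powers `ω ^ n`. -/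
instance : Pow (Cocycle 𝒢) ℤ where
  pow ω n :=
    { toFun := fun γ η => ω.toFun γ η ^ n
      continuousOn := (continuous_zpow n).comp_continuousOn ω.continuousOn
      cocycle := fun γ η ξ h1 h2 => by rw [← mul_zpow, ← mul_zpow, ω.cocycle γ η ξ h1 h2]
      map_r := fun γ => by rw [ω.map_r, one_zpow]
      map_s := fun γ => by rw [ω.map_s, one_zpow] }

lemma map_inv (ω : Cocycle 𝒢) (γ : G) : ω.toFun (𝒢.inv γ) γ = ω.toFun γ (𝒢.inv γ) := by
  have h := ω.cocycle γ (𝒢.inv γ) γ (𝒢.r_inv γ).symm (𝒢.s_inv γ)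
  rw [← 𝒢.r_eq, ← 𝒢.s_eq, ω.map_r, ω.map_s, mul_one, mul_one] at h
  exact h.symm

end Cocycle

/-- The extension `G^ω = 𝕋 ×_ω G` of `G` by `𝕋`, with the product topology. -/
def extension {G : Type u} [TopologicalSpace G] (𝒢 : TopGroupoid G) (ω : Cocycle 𝒢) :
    TopGroupoid (Circle × G) where
  mul x y := (x.1 * y.1 * ω.toFun x.2 y.2, 𝒢.mul x.2 y.2)
  inv x := (x.1⁻¹ * (ω.toFun x.2 (𝒢.inv x.2))⁻¹, 𝒢.inv x.2)
  r x := (1, 𝒢.r x.2)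
  s x := (1, 𝒢.s x.2)
  r_eq x := by
    ext1
    · simp only; rw [mul_assoc, mul_assoc, inv_mul_cancel, mul_one, mul_inv_cancel]
    · exact 𝒢.r_eq _
  s_eq x := by
    ext1
    · simp only; rw [ω.map_inv, mul_right_comm, mul_assoc, mul_right_comm]; simp
    · exact 𝒢.s_eq _
  inv_inv x := by
    ext1
    · simp only [𝒢.inv_inv]; rw [ω.map_inv, mul_inv, _root_.inv_inv, _root_.inv_inv]; simp
    · exact 𝒢.inv_inv _
  r_mul x y h := by
    ext1
    · rfl
    · exact 𝒢.r_mul _ _ (Prod.ext_iff.1 h).2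
  s_mul x y h := by
    ext1
    · rfl
    · exact 𝒢.s_mul _ _ (Prod.ext_iff.1 h).2
  mul_assoc x y z h1 h2 := by
    have h1' : 𝒢.s x.2 = 𝒢.r y.2 := (Prod.ext_iff.1 h1).2
    have h2' : 𝒢.s y.2 = 𝒢.r z.2 := (Prod.ext_iff.1 h2).2
    ext1
    · have := ω.cocycle _ _ _ h1' h2'
      simp only
      calc x.1 * y.1 * ω.toFun x.2 y.2 * z.1 * ω.toFun (𝒢.mul x.2 y.2) z.2
          = x.1 * y.1 * z.1 * (ω.toFun x.2 y.2 * ω.toFun (𝒢.mul x.2 y.2) z.2) := by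
            simp only [mul_assoc, mul_comm, mul_left_comm]
        _ = _ := by rw [this]; simp only [mul_assoc, mul_comm, mul_left_comm]
    · exact 𝒢.mul_assoc _ _ _ h1' h2'
  inv_mul_cancel x y h := by
    have h' : 𝒢.s x.2 = 𝒢.r y.2 := (Prod.ext_iff.1 h).2
    ext1
    · have := ω.cocycle (𝒢.inv x.2) x.2 y.2 (𝒢.s_inv _) h'
      rw [← 𝒢.s_eq, h', ω.map_r, mul_one, ω.map_inv] at this
      simp only
      rw [this]
      simp only [mul_inv]
      calc _ = (x.1⁻¹ * x.1) * y.1 * ((ω.toFun x.2 y.2)⁻¹ * ω.toFun x.2 y.2) *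
            ((ω.toFun (𝒢.inv x.2) (𝒢.mul x.2 y.2))⁻¹ *
              ω.toFun (𝒢.inv x.2) (𝒢.mul x.2 y.2)) := by
            simp only [mul_assoc, mul_comm, mul_left_comm]
        _ = y.1 := by simp
    · exact 𝒢.inv_mul_cancel _ _ h'
  mul_inv_cancel x y h := by
    have h' : 𝒢.s x.2 = 𝒢.r y.2 := (Prod.ext_iff.1 h).2
    ext1
    · have := ω.cocycle x.2 y.2 (𝒢.inv y.2) h' (𝒢.r_inv _).symm
      rw [← 𝒢.r_eq, ← h', ω.map_s, mul_one] at this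
      simp only
      rw [← this]
      simp only [mul_inv]
      calc _ = x.1 * (y.1 * y.1⁻¹) * ((ω.toFun x.2 y.2)⁻¹ * ω.toFun x.2 y.2) *
            ((ω.toFun (𝒢.mul x.2 y.2) (𝒢.inv y.2))⁻¹ *
              ω.toFun (𝒢.mul x.2 y.2) (𝒢.inv y.2)) := by
            simp only [mul_assoc, mul_comm, mul_left_comm]
        _ = x.1 := by simp
    · exact 𝒢.mul_inv_cancel _ _ h'
  continuous_inv := by
    have h : Continuous fun γ => ω.toFun γ (𝒢.inv γ) :=
      ω.continuousOn.comp_continuous (continuous_id.prodMk 𝒢.continuous_inv)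
        fun γ => (𝒢.r_inv γ).symm
    exact ((continuous_fst.inv).mul (h.comp continuous_snd).inv).prodMk
      (𝒢.continuous_inv.comp continuous_snd)
  continuousOn_mul := by
    have hc : Continuous fun p : (Circle × G) × (Circle × G) => (p.1.2, p.2.2) := by fun_prop
    have hm : MapsTo (fun p : (Circle × G) × (Circle × G) => (p.1.2, p.2.2))
        {p | ((1 : Circle), 𝒢.s p.1.2) = (1, 𝒢.r p.2.2)} 𝒢.composable :=
      fun p hp => (Prod.ext_iff.1 hp).2
    have h1 := ω.continuousOn.comp hc.continuousOn hm
    have h2 := 𝒢.continuousOn_mul.comp hc.continuousOn hm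
    have h3 : Continuous fun p : (Circle × G) × (Circle × G) => p.1.1 * p.2.1 := by fun_prop
    exact (h3.continuousOn.mul h1).prodMk h2

instance : MeasurableSpace Circle := borel Circle
instance : BorelSpace Circle := ⟨rfl⟩

/-- Normalized Haar measure on the circle. -/
def circleHaar : Measure Circle := Measure.haarMeasure ⊤

instance : IsProbabilityMeasure circleHaar := ⟨by
  have := Measure.haarMeasure_self (G := Circle) (K₀ := ⊤)
  simpa [circleHaar] using this⟩

instance : circleHaar.IsHaarMeasure := by unfold circleHaar; infer_instance

/-- A left Haar system: Radon measures `meas u` on `G`, for units `u`, with support exactly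
`r⁻¹(u)`, continuous in `u` and left invariant. The measures `meas u` for `u` not a unit are
irrelevant. -/
structure HaarSystem {G : Type u} [TopologicalSpace G] [MeasurableSpace G]
    (𝒢 : TopGroupoid G) where
  meas : G → Measure G
  lt_top : ∀ u ∈ 𝒢.units, ∀ K, IsCompact K → meas u K < ∞
  null : ∀ u ∈ 𝒢.units, meas u {γ | 𝒢.r γ ≠ u} = 0
  pos : ∀ u ∈ 𝒢.units, ∀ U, IsOpen U → (∃ γ ∈ U, 𝒢.r γ = u) → 0 < meas u U
  continuousOn : ∀ f : C_c(G, ℂ), ContinuousOn (fun u => ∫ γ, f γ ∂(meas u)) 𝒢.units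
  invariant : ∀ (γ : G) (f : C_c(G, ℂ)),
    ∫ η, f (𝒢.mul γ η) ∂(meas (𝒢.s γ)) = ∫ η, f η ∂(meas (𝒢.r γ))

lemma integrable_cc {X : Type*} [TopologicalSpace X] [MeasurableSpace X] [OpensMeasurableSpace X]
    (f : C_c(X, ℂ)) (ν : Measure X) [IsFiniteMeasureOnCompacts ν] : Integrable (fun x => f x) ν :=
  (map_continuous f).integrable_of_hasCompactSupport f.hasCompactSupport

lemma TopGroupoid.integrable_translate {G : Type u} [TopologicalSpace G]
    [SecondCountableTopology G] [T2Space G] [MeasurableSpace G] [BorelSpace G]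
    (𝒢 : TopGroupoid G) (x : G) (f : C_c(G, ℂ)) (ν : Measure G) [IsFiniteMeasureOnCompacts ν]
    (h : ∀ᵐ y ∂ν, 𝒢.s x = 𝒢.r y) : Integrable (fun y => f (𝒢.mul x y)) ν := by
  have hAc : IsClosed {y | 𝒢.s x = 𝒢.r y} := isClosed_eq continuous_const 𝒢.continuous_r
  have hgc : ContinuousOn (fun y => f (𝒢.mul x y)) {y | 𝒢.s x = 𝒢.r y} :=
    f.continuous.comp_continuousOn
      (𝒢.continuousOn_mul.comp (f := fun y => (x, y)) (by fun_prop) fun y hy => hy)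
  have hgm : AEStronglyMeasurable (fun y => f (𝒢.mul x y)) ν := by
    rw [← Measure.restrict_eq_self_of_ae_mem h]
    exact hgc.aestronglyMeasurable hAc.measurableSet
  obtain ⟨C, hC⟩ := f.hasCompactSupport.exists_bound_of_continuous f.continuous
  have hB : IsCompact ((fun z => 𝒢.mul (𝒢.inv x) z) '' (tsupport f ∩ {z | 𝒢.r x = 𝒢.r z})) := by
    refine (f.hasCompactSupport.isCompact.inter_right
      (isClosed_eq continuous_const 𝒢.continuous_r)).image_of_continuousOn ?_
    exact 𝒢.continuousOn_mul.comp (f := fun y => (𝒢.inv x, y)) (by fun_prop)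
      fun y hy => (𝒢.s_inv x).trans hy.2
  refine Integrable.mono' (g := indicator _ fun _ => C)
    ((integrable_indicator_iff hB.measurableSet).2 (integrableOn_const hB.measure_lt_top.ne))
    hgm (h.mono fun y hy => ?_)
  by_cases hy0 : f (𝒢.mul x y) = 0
  · rw [hy0, norm_zero]
    exact indicator_nonneg (fun _ _ => (norm_nonneg _).trans (hC x)) _
  · rw [indicator_of_mem]
    · exact hC _
    · exact ⟨𝒢.mul x y, ⟨subset_tsupport _ hy0, (𝒢.r_mul _ _ hy).symm⟩, 𝒢.inv_mul_cancel _ _ hy⟩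

/-- For `φ ∈ C(𝕋)` and `F ∈ C_c(𝕋 × G)`, the function `γ ↦ ∫ F(t, γ) φ(t) dt` in `C_c(G)`. -/
def circleIntegral {G : Type u} [TopologicalSpace G] [LocallyCompactSpace G]
    [SecondCountableTopology G] [T2Space G] (φ : C(Circle, ℂ)) (F : C_c(Circle × G, ℂ)) :
    C_c(G, ℂ) where
  toFun γ := ∫ t, F (t, γ) * φ t ∂circleHaar
  continuous_toFun := by
    have h : Continuous (Function.uncurry fun (γ : G) (t : Circle) => F (t, γ) * φ t) := by
      have := F.continuous
      simp only [Function.uncurry_def]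
      fun_prop
    simpa using continuous_parametric_integral_of_continuous (μ := circleHaar) h isCompact_univ
  hasCompactSupport' := by
    refine HasCompactSupport.intro (F.hasCompactSupport.isCompact.image continuous_snd) ?_
    intro γ hγ
    have : ∀ t, F (t, γ) = 0 := fun t => by
      by_contra h
      exact hγ ⟨(t, γ), subset_tsupport _ h, rfl⟩
    simp [this]

/-- `Υ_n(F)(γ) = ∫ F(t, γ) tⁿ dt`, as a map `C_c(G^ω) → C_c(G)`. -/
def upsilonFun {G : Type u} [TopologicalSpace G] [LocallyCompactSpace G]
    [SecondCountableTopology G] [T2Space G] (n : ℤ) (F : C_c(Circle × G, ℂ)) : C_c(G, ℂ) :=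
  circleIntegral ⟨fun t => ((t ^ n : Circle) : ℂ), continuous_subtype_val.comp (continuous_zpow n)⟩ F

section Haar

variable {G : Type u} [TopologicalSpace G] [MeasurableSpace G] {𝒢 : TopGroupoid G}

lemma HaarSystem.isFiniteMeasureOnCompacts (lam : HaarSystem 𝒢) {u : G} (hu : u ∈ 𝒢.units) :
    IsFiniteMeasureOnCompacts (lam.meas u) := ⟨fun K hK => lam.lt_top u hu K hK⟩

lemma HaarSystem.ae_r (lam : HaarSystem 𝒢) {u : G} (hu : u ∈ 𝒢.units) :
    ∀ᵐ γ ∂(lam.meas u), 𝒢.r γ = u := lam.null u hu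

variable [LocallyCompactSpace G] [SecondCountableTopology G] [T2Space G] [BorelSpace G]

/-- The Haar system `τ × λ^u` on the extension. -/
def HaarSystem.extension (lam : HaarSystem 𝒢) (ω : Cocycle 𝒢) :
    HaarSystem (TwistedGroupoid.extension 𝒢 ω) where
  meas x := circleHaar.prod (lam.meas x.2)
  lt_top x hx K hK := by
    have hu : x.2 ∈ 𝒢.units := (Prod.ext_iff.1 hx).2
    have := lam.isFiniteMeasureOnCompacts hu
    exact hK.measure_lt_top
  null x hx := by
    have hu : x.2 ∈ 𝒢.units := (Prod.ext_iff.1 hx).2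
    have h1 : (1 : Circle) = x.1 := (Prod.ext_iff.1 hx).1
    have := lam.isFiniteMeasureOnCompacts hu
    have h : {γ : Circle × G | (TwistedGroupoid.extension 𝒢 ω).r γ ≠ x} =
        univ ×ˢ {γ | 𝒢.r γ ≠ x.2} := by
      ext y
      simp [TwistedGroupoid.extension, Prod.ext_iff, h1]
    rw [h, Measure.prod_prod, lam.null _ hu, mul_zero]
  pos x hx U hU hxU := by
    have hu : x.2 ∈ 𝒢.units := (Prod.ext_iff.1 hx).2
    have := lam.isFiniteMeasureOnCompacts hu
    obtain ⟨γ, hγ, hr⟩ := hxU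
    obtain ⟨V, W, hV, hW, hγV, hγW, hVW⟩ := isOpen_prod_iff.1 hU γ.1 γ.2 hγ
    refine lt_of_lt_of_le ?_ (measure_mono hVW)
    rw [Measure.prod_prod]
    exact ENNReal.mul_pos (hV.measure_pos _ ⟨_, hγV⟩).ne'
      (lam.pos _ hu W hW ⟨_, hγW, (Prod.ext_iff.1 hr).2⟩).ne'
  continuousOn f := by
    have h := (lam.continuousOn (circleIntegral 1 f)).comp continuous_snd.continuousOn
      (fun (x : Circle × G) (hx : x ∈ (TwistedGroupoid.extension 𝒢 ω).units) =>
        ((Prod.ext_iff.1 hx).2 : 𝒢.r x.2 = x.2))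
    refine h.congr fun x hx => ?_
    have hu : x.2 ∈ 𝒢.units := (Prod.ext_iff.1 hx).2
    have := lam.isFiniteMeasureOnCompacts hu
    rw [integral_prod_symm _ (integrable_cc f _)]
    simp [circleIntegral]
  invariant x f := by
    have hs : 𝒢.s x.2 ∈ 𝒢.units := 𝒢.r_s _
    have hr : 𝒢.r x.2 ∈ 𝒢.units := 𝒢.r_r _
    have := lam.isFiniteMeasureOnCompacts hs
    have := lam.isFiniteMeasureOnCompacts hr
    change ∫ y, f (x.1 * y.1 * ω.toFun x.2 y.2, 𝒢.mul x.2 y.2)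
      ∂(circleHaar.prod (lam.meas (𝒢.s x.2))) = ∫ y, f y ∂(circleHaar.prod (lam.meas (𝒢.r x.2)))
    have hae : ∀ᵐ y ∂(circleHaar.prod (lam.meas (𝒢.s x.2))), 𝒢.r y.2 = 𝒢.s x.2 :=
      Measure.quasiMeasurePreserving_snd.ae (lam.ae_r hs)
    have hint := TopGroupoid.integrable_translate (TwistedGroupoid.extension 𝒢 ω) x f
      (circleHaar.prod (lam.meas (𝒢.s x.2)))
      (hae.mono fun y hy => by simp [TwistedGroupoid.extension, hy])
    have hint' : Integrable (fun y : Circle × G =>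
        f (x.1 * y.1 * ω.toFun x.2 y.2, 𝒢.mul x.2 y.2))
        (circleHaar.prod (lam.meas (𝒢.s x.2))) := hint
    rw [integral_prod_symm _ hint',
      integral_prod_symm _ (integrable_cc f _)]
    have key := lam.invariant x.2 (circleIntegral 1 f)
    simp only [circleIntegral, ContinuousMap.one_apply, mul_one,
      CompactlySupportedContinuousMap.coe_mk, ContinuousMap.coe_mk] at key
    rw [← key]
    refine integral_congr_ae (ae_of_all _ fun η => ?_)
    have := integral_mul_left_eq_self (μ := circleHaar)
      (fun t => f (t, 𝒢.mul x.2 η)) (x.1 * ω.toFun x.2 η)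
    simp only
    rw [← this]
    refine integral_congr_ae (ae_of_all _ fun t => ?_)
    simp only [mul_right_comm]

end Haar

section Algebra

variable {G : Type u} [TopologicalSpace G] [LocallyCompactSpace G] [SecondCountableTopology G]
  [T2Space G] [MeasurableSpace G] [BorelSpace G] {𝒢 : TopGroupoid G}

lemma continuous_fibreIntegral (lam : HaarSystem 𝒢) (F : G → G → ℂ) (K : Set G)
    (hK : IsCompact K)
    (hF : ContinuousOn (Function.uncurry F) {p : G × G | 𝒢.r p.1 = 𝒢.r p.2})
    (hFK : ∀ η γ, 𝒢.r η = 𝒢.r γ → η ∉ K → F η γ = 0) :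
    Continuous fun γ => ∫ η, F η γ ∂(lam.meas (𝒢.r γ)) := by
  obtain ⟨χ, hχ1, -, hχc, hχ01⟩ :=
    exists_continuous_one_zero_of_isCompact hK isClosed_empty (disjoint_empty K)
  have hS : IsClosed {p : G × G | 𝒢.r p.1 = 𝒢.r p.2} :=
    isClosed_eq (𝒢.continuous_r.comp continuous_fst) (𝒢.continuous_r.comp continuous_snd)
  obtain ⟨F', hF'⟩ := ContinuousMap.exists_restrict_eq hS ⟨_, hF.domRestrict⟩
  have hF'' : ∀ η γ, 𝒢.r η = 𝒢.r γ → F' (η, γ) = F η γ := fun η γ h =>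
    congrArg (fun f => f ⟨(η, γ), h⟩) hF'
  set H : G → G → ℂ := fun γ η => (χ η : ℂ) * F' (η, γ) with hH
  have hHc : Continuous (Function.uncurry H) := by
    simp only [hH, Function.uncurry_def]; fun_prop
  have hHF : ∀ η γ, 𝒢.r η = 𝒢.r γ → F η γ = H γ η := fun η γ h => by
    simp only [hH]
    by_cases hη : η ∈ K
    · rw [hχ1 hη, hF'' _ _ h]; simp
    · rw [hF'' _ _ h, hFK _ _ h hη, mul_zero]
  have heq : (fun γ => ∫ η, F η γ ∂(lam.meas (𝒢.r γ))) =
      fun γ => ∫ η, H γ η ∂(lam.meas (𝒢.r γ)) := by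
    funext γ
    exact integral_congr_ae ((lam.ae_r (𝒢.r_r γ)).mono fun η hη => hHF η γ hη)
  rw [heq]
  obtain ⟨ψ, hψ1, -, hψc, hψ01⟩ := exists_continuous_one_zero_of_isCompact
    hχc.isCompact isClosed_empty (disjoint_empty (tsupport χ))
  have hIc : Continuous fun γ => ∫ η, ψ η ∂(lam.meas (𝒢.r γ)) := by
    let ψ' : C_c(G, ℂ) := ⟨⟨fun x => (ψ x : ℂ), by fun_prop⟩, hψc.comp_left Complex.ofReal_zero⟩
    have h1 : Continuous fun γ => ∫ η, ψ' η ∂(lam.meas (𝒢.r γ)) :=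
      (lam.continuousOn ψ').comp_continuous 𝒢.continuous_r 𝒢.r_r
    refine (Complex.continuous_re.comp h1).congr fun γ => ?_
    have : ∫ η, ψ' η ∂(lam.meas (𝒢.r γ)) = ((∫ η, ψ η ∂(lam.meas (𝒢.r γ)) : ℝ) : ℂ) :=
      integral_ofReal
    simp [this]
  have hHcs : ∀ γ, HasCompactSupport (H γ) := fun γ =>
    HasCompactSupport.mul_right (hχc.comp_left Complex.ofReal_zero)
  rw [continuous_iff_continuousAt]
  intro γ₀
  have hJ : Continuous fun γ => ∫ η, H γ₀ η ∂(lam.meas (𝒢.r γ)) :=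
    (lam.continuousOn ⟨⟨H γ₀, hHc.comp (by fun_prop : Continuous fun η => (γ₀, η))⟩,
      hHcs γ₀⟩).comp_continuous 𝒢.continuous_r 𝒢.r_r
  have hU : TendstoUniformlyOn H (H γ₀) (𝓝 γ₀) (tsupport χ) := by
    have h := (ContinuousMap.curry ⟨Function.uncurry H, hHc⟩).continuous.tendsto γ₀
    exact ContinuousMap.tendsto_iff_forall_isCompact_tendstoUniformlyOn.1 h _ hχc.isCompact
  suffices hD : Tendsto (fun γ => ∫ η, (H γ η - H γ₀ η) ∂(lam.meas (𝒢.r γ))) (𝓝 γ₀) (𝓝 0) by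
    have h := hD.add (hJ.tendsto γ₀)
    rw [zero_add] at h
    refine h.congr fun γ => ?_
    have := lam.isFiniteMeasureOnCompacts (𝒢.r_r γ)
    rw [integral_sub, sub_add_cancel]
    · exact (hHc.comp (by fun_prop : Continuous fun η => (γ, η))).integrable_of_hasCompactSupport
        (hHcs γ)
    · exact (hHc.comp (by fun_prop : Continuous fun η => (γ₀, η))).integrable_of_hasCompactSupport
        (hHcs γ₀)
  rw [Metric.tendsto_nhds]
  intro ε hε
  set B : ℝ := ∫ η, ψ η ∂(lam.meas (𝒢.r γ₀)) with hB
  have hB0 : 0 ≤ B := integral_nonneg fun η => (hψ01 η).1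
  have hIB : ∀ᶠ γ in 𝓝 γ₀, ∫ η, ψ η ∂(lam.meas (𝒢.r γ)) < B + 1 :=
    (hIc.tendsto γ₀).eventually_lt_const (lt_add_one B)
  have hδ : 0 < ε / (B + 1) := by positivity
  filter_upwards [hIB, Metric.tendstoUniformlyOn_iff.1 hU _ hδ] with γ hγ1 hγ2
  have := lam.isFiniteMeasureOnCompacts (𝒢.r_r γ)
  rw [dist_zero_right]
  calc ‖∫ η, (H γ η - H γ₀ η) ∂(lam.meas (𝒢.r γ))‖
      ≤ ∫ η, ε / (B + 1) * ψ η ∂(lam.meas (𝒢.r γ)) := by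
        refine norm_integral_le_of_norm_le
          ((ψ.continuous.integrable_of_hasCompactSupport hψc).const_mul _)
          (ae_of_all _ fun η => ?_)
        by_cases hη : η ∈ tsupport χ
        · rw [hψ1 hη, Pi.one_apply, mul_one, norm_sub_rev, ← dist_eq_norm]
          exact (hγ2 η hη).le
        · have : χ η = 0 := image_eq_zero_of_notMem_tsupport hη
          simp only [hH, this, Complex.ofReal_zero, zero_mul, sub_self, norm_zero]
          exact mul_nonneg hδ.le (hψ01 η).1
    _ = ε / (B + 1) * ∫ η, ψ η ∂(lam.meas (𝒢.r γ)) := integral_const_mul _ _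
    _ < ε / (B + 1) * (B + 1) := mul_lt_mul_of_pos_left hγ1 hδ
    _ = ε := div_mul_cancel₀ _ (by positivity)

/-- The convolution
`(f * g)(γ) = ∫ f(η) g(η⁻¹γ) σ(η, η⁻¹γ) dλ^{r(γ)}(η)` on `C_c(G, σ)`. -/
def conv (lam : HaarSystem 𝒢) (σ : Cocycle 𝒢) (f g : C_c(G, ℂ)) : C_c(G, ℂ) where
  toFun γ := ∫ η, f η * g (𝒢.mul (𝒢.inv η) γ) * (σ.toFun η (𝒢.mul (𝒢.inv η) γ) : ℂ)
    ∂(lam.meas (𝒢.r γ))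
  continuous_toFun := by
    have hm : ContinuousOn (fun p : G × G => 𝒢.mul (𝒢.inv p.1) p.2)
        {p : G × G | 𝒢.r p.1 = 𝒢.r p.2} :=
      𝒢.continuousOn_mul.comp (f := fun p : G × G => (𝒢.inv p.1, p.2))
        ((𝒢.continuous_inv.comp continuous_fst).prodMk continuous_snd).continuousOn
        fun p hp => (𝒢.s_inv _).trans hp
    refine continuous_fibreIntegral lam
      (fun η γ => f η * g (𝒢.mul (𝒢.inv η) γ) * (σ.toFun η (𝒢.mul (𝒢.inv η) γ) : ℂ))
      (tsupport f) f.hasCompactSupport.isCompact ?_ ?_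
    · refine (((map_continuous f).comp continuous_fst).continuousOn.mul
        ((map_continuous g).comp_continuousOn hm)).mul ?_
      refine continuous_subtype_val.comp_continuousOn
        (σ.continuousOn.comp (f := fun p : G × G => (p.1, 𝒢.mul (𝒢.inv p.1) p.2))
          (continuous_fst.continuousOn.prodMk hm) ?_)
      intro p hp
      change 𝒢.s p.1 = 𝒢.r _
      rw [𝒢.r_mul _ _ ((𝒢.s_inv _).trans hp), 𝒢.r_inv]
    · intro η γ _ hη
      rw [image_eq_zero_of_notMem_tsupport hη, zero_mul, zero_mul]
  hasCompactSupport' := by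
    have hK : IsCompact ((fun p : G × G => 𝒢.mul p.1 p.2) ''
        ((tsupport f ×ˢ tsupport g) ∩ {p | 𝒢.s p.1 = 𝒢.r p.2})) :=
      ((f.hasCompactSupport.isCompact.prod g.hasCompactSupport.isCompact).inter_right
        (isClosed_eq (𝒢.continuous_s.comp continuous_fst)
          (𝒢.continuous_r.comp continuous_snd))).image_of_continuousOn
        (𝒢.continuousOn_mul.mono inter_subset_right)
    refine HasCompactSupport.intro hK fun γ hγ => ?_
    refine integral_eq_zero_of_ae ((lam.ae_r (𝒢.r_r γ)).mono fun η hη => ?_)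
    by_contra h
    have h1 : f η ≠ 0 := fun h0 => h (by simp [h0])
    have h2 : g (𝒢.mul (𝒢.inv η) γ) ≠ 0 := fun h0 => h (by simp [h0])
    have hc : 𝒢.s (𝒢.inv η) = 𝒢.r γ := (𝒢.s_inv η).trans hη
    refine hγ ⟨(η, 𝒢.mul (𝒢.inv η) γ), ⟨⟨subset_tsupport _ h1, subset_tsupport _ h2⟩, ?_⟩, ?_⟩
    · exact ((𝒢.r_mul _ _ hc).trans (𝒢.r_inv η)).symm
    · have := 𝒢.inv_mul_cancel _ _ hc
      rwa [𝒢.inv_inv] at this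

/-- The involution `f^*(γ) = conj (f(γ⁻¹)) conj (σ(γ, γ⁻¹))` on `C_c(G, σ)`. -/
def invol (σ : Cocycle 𝒢) (f : C_c(G, ℂ)) : C_c(G, ℂ) where
  toFun γ := conj (f (𝒢.inv γ)) * conj (σ.toFun γ (𝒢.inv γ) : ℂ)
  continuous_toFun := by
    have h : Continuous fun γ => σ.toFun γ (𝒢.inv γ) :=
      σ.continuousOn.comp_continuous (continuous_id.prodMk 𝒢.continuous_inv)
        fun γ => (𝒢.r_inv γ).symm
    exact (Complex.continuous_conj.comp ((map_continuous f).comp 𝒢.continuous_inv)).mul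
      (Complex.continuous_conj.comp (continuous_subtype_val.comp h))
  hasCompactSupport' :=
    ((f.hasCompactSupport.comp_homeomorph 𝒢.invHomeo).comp_left (g := conj)
      (map_zero _)).mul_right

end Algebra

section Regular

/-- Schur's test: a kernel with bounded row and column integrals defines a bounded operator. -/
lemma exists_operator_of_kernel {X : Type*} [MeasurableSpace X] (ν : Measure X) [SigmaFinite ν]
    (k : X → X → ℂ) (hk : AEStronglyMeasurable (Function.uncurry k) (ν.prod ν)) (C : ℝ≥0)
    (h1 : ∀ᵐ x ∂ν, ∫⁻ y, ‖k x y‖ₑ ∂ν ≤ C) (h2 : ∀ᵐ y ∂ν, ∫⁻ x, ‖k x y‖ₑ ∂ν ≤ C) :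
    ∃ T : Lp ℂ 2 ν →L[ℂ] Lp ℂ 2 ν, ‖T‖ ≤ C ∧
      ∀ ξ ζ : Lp ℂ 2 ν, ⟪ζ, T ξ⟫_ℂ = ∫ x, ∫ y, k x y * ξ y * conj (ζ x) ∂ν ∂ν := by
  have hmeas : ∀ ξ ζ : Lp ℂ 2 ν, AEStronglyMeasurable
      (fun p : X × X => k p.1 p.2 * ξ p.2 * conj (ζ p.1)) (ν.prod ν) := fun ξ ζ =>
    (hk.mul (Lp.aestronglyMeasurable ξ).comp_snd).mul
      (Complex.continuous_conj.comp_aestronglyMeasurable (Lp.aestronglyMeasurable ζ).comp_fst)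
  have hsq : ∀ ξ : Lp ℂ 2 ν, ∫⁻ x, ‖ξ x‖ₑ ^ 2 ∂ν = ‖ξ‖ₑ ^ 2 := fun ξ => by
    rw [Lp.enorm_def, eLpNorm_eq_lintegral_rpow_enorm_toReal two_ne_zero ENNReal.ofNat_ne_top]
    rw [← ENNReal.rpow_natCast, ← ENNReal.rpow_mul]
    norm_num
  have hbd : ∀ ξ ζ : Lp ℂ 2 ν,
      ∫⁻ p, ‖k p.1 p.2 * ξ p.2 * conj (ζ p.1)‖ₑ ∂(ν.prod ν) ≤ C * ‖ξ‖ₑ * ‖ζ‖ₑ := fun ξ ζ => by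
    have hkm : AEMeasurable (fun p : X × X => ‖k p.1 p.2‖ₑ) (ν.prod ν) := hk.enorm
    have hξm : AEMeasurable (fun p : X × X => ‖ξ p.2‖ₑ) (ν.prod ν) :=
      (Lp.aestronglyMeasurable ξ).comp_snd.enorm
    have hζm : AEMeasurable (fun p : X × X => ‖ζ p.1‖ₑ) (ν.prod ν) :=
      (Lp.aestronglyMeasurable ζ).comp_fst.enorm
    have hA : ∫⁻ p, (‖k p.1 p.2‖ₑ ^ (1 / 2 : ℝ) * ‖ξ p.2‖ₑ) ^ (2 : ℝ) ∂(ν.prod ν)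
        ≤ C * ‖ξ‖ₑ ^ 2 := by
      have e : ∀ p : X × X, (‖k p.1 p.2‖ₑ ^ (1 / 2 : ℝ) * ‖ξ p.2‖ₑ) ^ (2 : ℝ) =
          ‖k p.1 p.2‖ₑ * ‖ξ p.2‖ₑ ^ 2 := fun p => by
        rw [ENNReal.mul_rpow_of_nonneg _ _ zero_le_two, ← ENNReal.rpow_mul]; simp
      simp only [e]
      rw [lintegral_prod_symm (fun p : X × X => ‖k p.1 p.2‖ₑ * ‖ξ p.2‖ₑ ^ 2)
        (hkm.mul (hξm.pow_const 2))]
      calc ∫⁻ y, ∫⁻ x, ‖k x y‖ₑ * ‖ξ y‖ₑ ^ 2 ∂ν ∂ν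
          = ∫⁻ y, (∫⁻ x, ‖k x y‖ₑ ∂ν) * ‖ξ y‖ₑ ^ 2 ∂ν := by
            refine lintegral_congr fun y => ?_
            rw [lintegral_mul_const']
            exact ENNReal.pow_ne_top enorm_ne_top
        _ ≤ ∫⁻ y, C * ‖ξ y‖ₑ ^ 2 ∂ν :=
            lintegral_mono_ae (h2.mono fun y hy => mul_le_mul_left hy _)
        _ = C * ‖ξ‖ₑ ^ 2 := by rw [lintegral_const_mul' _ _ ENNReal.coe_ne_top, hsq]
    have hB : ∫⁻ p, (‖k p.1 p.2‖ₑ ^ (1 / 2 : ℝ) * ‖ζ p.1‖ₑ) ^ (2 : ℝ) ∂(ν.prod ν)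
        ≤ C * ‖ζ‖ₑ ^ 2 := by
      have e : ∀ p : X × X, (‖k p.1 p.2‖ₑ ^ (1 / 2 : ℝ) * ‖ζ p.1‖ₑ) ^ (2 : ℝ) =
          ‖k p.1 p.2‖ₑ * ‖ζ p.1‖ₑ ^ 2 := fun p => by
        rw [ENNReal.mul_rpow_of_nonneg _ _ zero_le_two, ← ENNReal.rpow_mul]; simp
      simp only [e]
      rw [lintegral_prod (fun p : X × X => ‖k p.1 p.2‖ₑ * ‖ζ p.1‖ₑ ^ 2)
        (hkm.mul (hζm.pow_const 2))]
      calc ∫⁻ x, ∫⁻ y, ‖k x y‖ₑ * ‖ζ x‖ₑ ^ 2 ∂ν ∂ν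
          = ∫⁻ x, (∫⁻ y, ‖k x y‖ₑ ∂ν) * ‖ζ x‖ₑ ^ 2 ∂ν := by
            refine lintegral_congr fun x => ?_
            rw [lintegral_mul_const']
            exact ENNReal.pow_ne_top enorm_ne_top
        _ ≤ ∫⁻ x, C * ‖ζ x‖ₑ ^ 2 ∂ν :=
            lintegral_mono_ae (h1.mono fun y hy => mul_le_mul_left hy _)
        _ = C * ‖ζ‖ₑ ^ 2 := by rw [lintegral_const_mul' _ _ ENNReal.coe_ne_top, hsq]
    calc ∫⁻ p, ‖k p.1 p.2 * ξ p.2 * conj (ζ p.1)‖ₑ ∂(ν.prod ν)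
        = ∫⁻ p, ((fun p : X × X => ‖k p.1 p.2‖ₑ ^ (1 / 2 : ℝ) * ‖ξ p.2‖ₑ) *
            fun p : X × X => ‖k p.1 p.2‖ₑ ^ (1 / 2 : ℝ) * ‖ζ p.1‖ₑ) p ∂(ν.prod ν) := by
          refine lintegral_congr fun p => ?_
          have : ‖k p.1 p.2‖ₑ = ‖k p.1 p.2‖ₑ ^ (1 / 2 : ℝ) * ‖k p.1 p.2‖ₑ ^ (1 / 2 : ℝ) := by
            rw [← ENNReal.rpow_add_of_nonneg _ _ (by norm_num) (by norm_num)]; norm_num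
          have hcj : ‖conj (ζ p.1)‖ₑ = ‖ζ p.1‖ₑ := by
            rw [← ofReal_norm, ← ofReal_norm, RCLike.norm_conj]
          rw [enorm_mul, enorm_mul, hcj, Pi.mul_apply]
          conv_lhs => rw [this]
          ring
      _ ≤ _ := ENNReal.lintegral_mul_le_Lp_mul_Lq _ Real.HolderConjugate.two_two
          ((hkm.pow_const _).mul hξm) ((hkm.pow_const _).mul hζm)
      _ ≤ (C * ‖ξ‖ₑ ^ 2) ^ (1 / 2 : ℝ) * (C * ‖ζ‖ₑ ^ 2) ^ (1 / 2 : ℝ) := by gcongr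
      _ = C * ‖ξ‖ₑ * ‖ζ‖ₑ := by
          have e : ∀ a : ℝ≥0∞, (a ^ 2) ^ (1 / 2 : ℝ) = a := fun a => by
            rw [← ENNReal.rpow_natCast, ← ENNReal.rpow_mul]; norm_num
          rw [← ENNReal.mul_rpow_of_nonneg _ _ (by norm_num),
            show (C * ‖ξ‖ₑ ^ 2 * (C * ‖ζ‖ₑ ^ 2) : ℝ≥0∞) = (C * ‖ξ‖ₑ * ‖ζ‖ₑ) ^ 2 by ring, e]
  have hfin : ∀ ξ ζ : Lp ℂ 2 ν, (C * ‖ξ‖ₑ * ‖ζ‖ₑ : ℝ≥0∞) < ∞ := fun ξ ζ =>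
    ENNReal.mul_lt_top (ENNReal.mul_lt_top ENNReal.coe_lt_top enorm_lt_top) enorm_lt_top
  have hint : ∀ ξ ζ : Lp ℂ 2 ν, Integrable
      (fun p : X × X => k p.1 p.2 * ξ p.2 * conj (ζ p.1)) (ν.prod ν) := fun ξ ζ =>
    ⟨hmeas ξ ζ, (hbd ξ ζ).trans_lt (hfin ξ ζ)⟩
  let b : Lp ℂ 2 ν → Lp ℂ 2 ν → ℂ := fun ζ ξ =>
    ∫ p, k p.1 p.2 * ξ p.2 * conj (ζ p.1) ∂(ν.prod ν)
  have hb : ∀ ζ ξ, ‖b ζ ξ‖ ≤ C * ‖ζ‖ * ‖ξ‖ := fun ζ ξ => by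
    have h := (enorm_integral_le_lintegral_enorm _).trans (hbd ξ ζ)
    have h' := ENNReal.toReal_mono (hfin ξ ζ).ne h
    simp only [ENNReal.toReal_mul, toReal_enorm, ENNReal.coe_toReal] at h'
    exact h'.trans (le_of_eq (by ring))
  have hadd : ∀ ξ ξ' : Lp ℂ 2 ν, ∀ᵐ x ∂ν, (ξ + ξ') x = ξ x + ξ' x := fun ξ ξ' =>
    Lp.coeFn_add ξ ξ'
  have hsmul : ∀ (c : ℂ) (ξ : Lp ℂ 2 ν), ∀ᵐ x ∂ν, (c • ξ) x = c * ξ x := fun c ξ =>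
    Lp.coeFn_smul c ξ
  let B₀ : Lp ℂ 2 ν →ₛₗ[starRingEnd ℂ] Lp ℂ 2 ν →ₗ[ℂ] ℂ :=
    LinearMap.mk₂'ₛₗ (starRingEnd ℂ) (RingHom.id ℂ) b
      (fun ζ ζ' ξ => by
        simp only [b]
        rw [← integral_add (hint _ _) (hint _ _)]
        refine integral_congr_ae ((Measure.quasiMeasurePreserving_fst.ae (hadd ζ ζ')).mono
          fun p hp => ?_)
        simp only [hp, map_add]; ring)
      (fun c ζ ξ => by
        simp only [b]
        rw [smul_eq_mul, ← integral_const_mul]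
        refine integral_congr_ae ((Measure.quasiMeasurePreserving_fst.ae (hsmul c ζ)).mono
          fun p hp => ?_)
        simp only [hp, map_mul]; ring)
      (fun ζ ξ ξ' => by
        simp only [b]
        rw [← integral_add (hint _ _) (hint _ _)]
        refine integral_congr_ae ((Measure.quasiMeasurePreserving_snd.ae (hadd ξ ξ')).mono
          fun p hp => ?_)
        simp only [hp]; ring)
      (fun c ζ ξ => by
        simp only [b]
        rw [smul_eq_mul, RingHom.id_apply, ← integral_const_mul]
        refine integral_congr_ae ((Measure.quasiMeasurePreserving_snd.ae (hsmul c ξ)).mono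
          fun p hp => ?_)
        simp only [hp]; ring)
  let B : Lp ℂ 2 ν →L⋆[ℂ] Lp ℂ 2 ν →L[ℂ] ℂ := B₀.mkContinuous₂ C hb
  have hT : ∀ ξ ζ : Lp ℂ 2 ν,
      ⟪ζ, ContinuousLinearMap.adjoint (InnerProductSpace.continuousLinearMapOfBilin B) ξ⟫_ℂ
        = b ζ ξ := fun ξ ζ => by
    rw [ContinuousLinearMap.adjoint_inner_right,
      InnerProductSpace.continuousLinearMapOfBilin_apply]
    rfl
  refine ⟨ContinuousLinearMap.adjoint (InnerProductSpace.continuousLinearMapOfBilin B), ?_, ?_⟩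
  · refine ContinuousLinearMap.opNorm_le_bound _ C.coe_nonneg fun ξ => ?_
    set η := ContinuousLinearMap.adjoint (InnerProductSpace.continuousLinearMapOfBilin B) ξ
    by_cases h0 : ‖η‖ = 0
    · rw [h0]; positivity
    · have h := hb η ξ
      rw [← hT ξ η, inner_self_eq_norm_sq_to_K, norm_pow] at h
      simp only [Complex.coe_algebraMap, Complex.norm_real, norm_norm] at h
      have h3 : 0 < ‖η‖ := lt_of_le_of_ne (norm_nonneg _) (Ne.symm h0)
      nlinarith
  · intro ξ ζ
    rw [hT ξ ζ]
    exact integral_prod _ (hint ξ ζ)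

variable {G : Type u} [TopologicalSpace G] [LocallyCompactSpace G] [SecondCountableTopology G]
  [T2Space G] [MeasurableSpace G] [BorelSpace G] {𝒢 : TopGroupoid G}

/-- For a unit `u`, the image `λ_u` of `λ^u` under inversion. -/
def HaarSystem.src (lam : HaarSystem 𝒢) (x : G) : Measure G := (lam.meas x).map 𝒢.inv

lemma HaarSystem.exists_bound (lam : HaarSystem 𝒢) (f : C_c(G, ℂ)) :
    ∃ C : ℝ≥0, ∀ x ∈ 𝒢.units, ∫⁻ γ, ‖f γ‖ₑ ∂(lam.meas x) ≤ C := by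
  let F : C_c(G, ℂ) := ⟨⟨fun γ => (‖f γ‖ : ℂ), by have := map_continuous f; fun_prop⟩,
    f.hasCompactSupport.comp_left (g := fun z : ℂ => (‖z‖ : ℂ)) (by simp)⟩
  have hK : IsCompact (𝒢.r '' tsupport f) := f.hasCompactSupport.isCompact.image 𝒢.continuous_r
  obtain ⟨C, hC⟩ := hK.exists_bound_of_continuousOn
    ((lam.continuousOn F).mono (by rintro _ ⟨γ, -, rfl⟩; exact 𝒢.r_r γ))
  refine ⟨C.toNNReal, fun x hx => ?_⟩
  have := lam.isFiniteMeasureOnCompacts hx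
  by_cases h : x ∈ 𝒢.r '' tsupport f
  · have h1 := hC x h
    have h2 : ∫ γ, F γ ∂(lam.meas x) = ((∫ γ, ‖f γ‖ ∂(lam.meas x) : ℝ) : ℂ) := integral_ofReal
    rw [h2, Complex.norm_real, Real.norm_of_nonneg (integral_nonneg fun _ => norm_nonneg _)] at h1
    rw [← ofReal_integral_norm_eq_lintegral_enorm (integrable_cc f _)]
    exact ENNReal.ofReal_le_ofReal h1
  · have : ∫⁻ γ, ‖f γ‖ₑ ∂(lam.meas x) = 0 := by
      refine lintegral_eq_zero_of_ae_eq_zero ((lam.ae_r hx).mono fun γ hγ => ?_)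
      have : f γ = 0 := by
        by_contra h0
        exact h ⟨γ, subset_tsupport _ h0, hγ⟩
      simp [this]
    rw [this]
    exact zero_le

lemma HaarSystem.lintegral_translate (lam : HaarSystem 𝒢) (f : C_c(G, ℂ)) (γ : G) :
    ∫⁻ η, ‖f (𝒢.mul γ η)‖ₑ ∂(lam.meas (𝒢.s γ)) = ∫⁻ η, ‖f η‖ₑ ∂(lam.meas (𝒢.r γ)) := by
  let F : C_c(G, ℂ) := ⟨⟨fun γ => (‖f γ‖ : ℂ), by have := map_continuous f; fun_prop⟩,
    f.hasCompactSupport.comp_left (g := fun z : ℂ => (‖z‖ : ℂ)) (by simp)⟩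
  have := lam.isFiniteMeasureOnCompacts (𝒢.r_s γ)
  have := lam.isFiniteMeasureOnCompacts (𝒢.r_r γ)
  have hi := 𝒢.integrable_translate γ f (lam.meas (𝒢.s γ))
    ((lam.ae_r (𝒢.r_s γ)).mono fun y hy => hy.symm)
  rw [← ofReal_integral_norm_eq_lintegral_enorm hi,
    ← ofReal_integral_norm_eq_lintegral_enorm (integrable_cc f _)]
  have h := lam.invariant γ F
  have h1 : ∫ η, F (𝒢.mul γ η) ∂(lam.meas (𝒢.s γ)) =
      ((∫ η, ‖f (𝒢.mul γ η)‖ ∂(lam.meas (𝒢.s γ)) : ℝ) : ℂ) := integral_ofReal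
  have h2 : ∫ η, F η ∂(lam.meas (𝒢.r γ)) =
      ((∫ η, ‖f η‖ ∂(lam.meas (𝒢.r γ)) : ℝ) : ℂ) := integral_ofReal
  rw [h1, h2] at h
  rw [Complex.ofReal_injective h]

/-- Existence and uniform boundedness of the left regular representations. -/
theorem exists_leftRegular (lam : HaarSystem 𝒢) (σ : Cocycle 𝒢) (f : C_c(G, ℂ)) :
    ∃ C : ℝ≥0, ∀ x ∈ 𝒢.units, ∃ T : Lp ℂ 2 (lam.src x) →L[ℂ] Lp ℂ 2 (lam.src x), ‖T‖ ≤ C ∧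
      ∀ ξ ζ : Lp ℂ 2 (lam.src x), ⟪ζ, T ξ⟫_ℂ =
        ∫ γ, ∫ η, f (𝒢.mul γ η) * ξ (𝒢.inv η) * conj (ζ γ) *
          (σ.toFun (𝒢.mul γ η) (𝒢.inv η) : ℂ) ∂(lam.meas x) ∂(lam.src x) := by
  let f' : C_c(G, ℂ) := ⟨⟨fun γ => f (𝒢.inv γ), (map_continuous f).comp 𝒢.continuous_inv⟩,
    f.hasCompactSupport.comp_homeomorph 𝒢.invHomeo⟩
  obtain ⟨C₁, hC₁⟩ := lam.exists_bound f
  obtain ⟨C₂, hC₂⟩ := lam.exists_bound f'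
  refine ⟨max C₁ C₂, fun x hx => ?_⟩
  have := lam.isFiniteMeasureOnCompacts hx
  let e : G ≃ᵐ G := 𝒢.invHomeo.toMeasurableEquiv
  have he : lam.src x = (lam.meas x).map e := rfl
  have hsf : SigmaFinite (lam.src x) := by
    rw [he]; exact e.sigmaFinite_map
  have hs : ∀ᵐ γ ∂(lam.src x), 𝒢.s γ = x := by
    rw [he, e.measurableEmbedding.ae_map_iff]
    exact (lam.ae_r hx).mono fun γ hγ => (𝒢.s_inv γ).trans hγ
  have hsA : ∀ᵐ γ ∂(lam.src x), γ ∈ {γ | 𝒢.s γ = x} := hs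
  set A : Set G := {γ | 𝒢.s γ = x} with hA
  have hAc : IsClosed A := isClosed_eq 𝒢.continuous_s continuous_const
  let k : G → G → ℂ := fun γ ζ =>
    f (𝒢.mul γ (𝒢.inv ζ)) * (σ.toFun (𝒢.mul γ (𝒢.inv ζ)) ζ : ℂ)
  have hkn : ∀ γ ζ, ‖k γ ζ‖ₑ = ‖f (𝒢.mul γ (𝒢.inv ζ))‖ₑ := fun γ ζ => by
    rw [← ofReal_norm, ← ofReal_norm, norm_mul, Circle.norm_coe, mul_one]
  have hm : ContinuousOn (fun p : G × G => 𝒢.mul p.1 (𝒢.inv p.2)) (A ×ˢ A) :=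
    𝒢.continuousOn_mul.comp (f := fun p : G × G => (p.1, 𝒢.inv p.2))
      (continuous_fst.prodMk (𝒢.continuous_inv.comp continuous_snd)).continuousOn
      fun p hp => hp.1.trans (hp.2.symm.trans (𝒢.r_inv _).symm)
  have hkc : ContinuousOn (Function.uncurry k) (A ×ˢ A) := by
    refine ((map_continuous f).comp_continuousOn hm).mul
      (continuous_subtype_val.comp_continuousOn
        (σ.continuousOn.comp (f := fun p : G × G => (𝒢.mul p.1 (𝒢.inv p.2), p.2))
          (hm.prodMk continuous_snd.continuousOn) fun p hp => ?_))
    change 𝒢.s _ = 𝒢.r _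
    rw [𝒢.s_mul _ _ (hp.1.trans (hp.2.symm.trans (𝒢.r_inv _).symm)), 𝒢.s_inv]
  have hk : AEStronglyMeasurable (Function.uncurry k) ((lam.src x).prod (lam.src x)) := by
    have : ((lam.src x).prod (lam.src x)).restrict (A ×ˢ A) =
        (lam.src x).prod (lam.src x) := by
      rw [← Measure.prod_restrict, Measure.restrict_eq_self_of_ae_mem hsA]
    rw [← this]
    exact hkc.aestronglyMeasurable (hAc.prod hAc).measurableSet
  obtain ⟨T, hT1, hT2⟩ := exists_operator_of_kernel (lam.src x) k hk (max C₁ C₂)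
    (hs.mono fun γ hγ => by
      simp only [hkn]
      rw [he, lintegral_map_equiv]
      have h := lam.lintegral_translate f γ
      rw [hγ] at h
      calc ∫⁻ η, ‖f (𝒢.mul γ (𝒢.inv (e η)))‖ₑ ∂(lam.meas x)
          = ∫⁻ η, ‖f (𝒢.mul γ η)‖ₑ ∂(lam.meas x) :=
            lintegral_congr fun η => by
              rw [show 𝒢.inv (e η) = η from 𝒢.inv_inv η]
        _ ≤ C₁ := h.le.trans (hC₁ _ (𝒢.r_r γ))
        _ ≤ _ := by exact_mod_cast le_max_left _ _)
    (hs.mono fun ζ hζ => by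
      simp only [hkn]
      rw [he, lintegral_map_equiv]
      have h := lam.lintegral_translate f' ζ
      rw [hζ] at h
      calc ∫⁻ η, ‖f (𝒢.mul (e η) (𝒢.inv ζ))‖ₑ ∂(lam.meas x)
          = ∫⁻ η, ‖f' (𝒢.mul ζ η)‖ₑ ∂(lam.meas x) :=
            lintegral_congr_ae ((lam.ae_r hx).mono fun η hη => by
              change ‖f (𝒢.mul (𝒢.inv η) (𝒢.inv ζ))‖ₑ = ‖f (𝒢.inv (𝒢.mul ζ η))‖ₑ
              rw [𝒢.inv_mul _ _ (hζ.trans hη.symm)])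
        _ ≤ C₂ := h.le.trans (hC₂ _ (𝒢.r_r ζ))
        _ ≤ _ := by exact_mod_cast le_max_right _ _)
  refine ⟨T, hT1, fun ξ ζ => ?_⟩
  rw [hT2]
  refine integral_congr_ae (ae_of_all _ fun γ => ?_)
  change ∫ y, k γ y * ξ y * conj (ζ γ) ∂((lam.meas x).map e) = _
  rw [integral_map_equiv]
  refine integral_congr_ae (ae_of_all _ fun η => ?_)
  change f (𝒢.mul γ (𝒢.inv (𝒢.inv η))) * (σ.toFun (𝒢.mul γ (𝒢.inv (𝒢.inv η))) (𝒢.inv η) : ℂ) *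
    ξ (𝒢.inv η) * conj (ζ γ) = _
  rw [𝒢.inv_inv]
  ring

/-- The left regular representation `Π^u` at a unit `u`: `Π^u(f)` is the operator on `L²(G, λ_u)`
characterized by
`⟪Π^u(f) ξ, ζ⟫ = ∫ ∫ f(γη) ξ(η⁻¹) conj (ζ(γ)) σ(γη, η⁻¹) dλ^u(η) dλ_u(γ)`
(inner product linear in the first variable; Mathlib's is linear in the second). -/
def leftRegular (lam : HaarSystem 𝒢) (σ : Cocycle 𝒢) (x : 𝒢.units) (f : C_c(G, ℂ)) :
    Lp ℂ 2 (lam.src x) →L[ℂ] Lp ℂ 2 (lam.src x) :=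
  ((exists_leftRegular lam σ f).choose_spec x x.2).choose

lemma inner_leftRegular (lam : HaarSystem 𝒢) (σ : Cocycle 𝒢) (x : 𝒢.units) (f : C_c(G, ℂ))
    (ξ ζ : Lp ℂ 2 (lam.src x)) :
    ⟪ζ, leftRegular lam σ x f ξ⟫_ℂ =
      ∫ γ, ∫ η, f (𝒢.mul γ η) * ξ (𝒢.inv η) * conj (ζ γ) *
        (σ.toFun (𝒢.mul γ η) (𝒢.inv η) : ℂ) ∂(lam.meas x) ∂(lam.src x) :=
  ((exists_leftRegular lam σ f).choose_spec x x.2).choose_spec.2 ξ ζ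

/-- The family `(Π^u(f))_u`, an element of the `ℓ^∞`-product over the units `u` of the algebras
`B(L²(G, λ_u))`. Its norm is `sup_u ‖Π^u(f)‖`. -/
def regularFamily (lam : HaarSystem 𝒢) (σ : Cocycle 𝒢) (f : C_c(G, ℂ)) :
    lp (fun x : 𝒢.units => Lp ℂ 2 (lam.src x) →L[ℂ] Lp ℂ 2 (lam.src x)) ∞ :=
  ⟨fun x => leftRegular lam σ x f, memℓp_infty ⟨(exists_leftRegular lam σ f).choose, by
    rintro _ ⟨x, rfl⟩
    exact ((exists_leftRegular lam σ f).choose_spec x x.2).choose_spec.1⟩⟩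

end Regular

/-- The closed `*`-subalgebra of a `C*`-algebra generated by a set. -/
def closedStarAlgebra {B : Type*} [NonUnitalCStarAlgebra B] (S : Set B) :
    NonUnitalStarSubalgebra ℂ B :=
  (NonUnitalStarAlgebra.adjoin ℂ S).topologicalClosure

lemma subset_closedStarAlgebra {B : Type*} [NonUnitalCStarAlgebra B] (S : Set B) {a : B}
    (ha : a ∈ S) : a ∈ closedStarAlgebra S :=
  NonUnitalStarSubalgebra.le_topologicalClosure _ (NonUnitalStarAlgebra.subset_adjoin ℂ S ha)

instance {B : Type*} [NonUnitalCStarAlgebra B] (S : Set B) :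
    NonUnitalCStarAlgebra (closedStarAlgebra S) :=
  NonUnitalStarSubalgebra.nonUnitalCStarAlgebra (closedStarAlgebra S)
    (h_closed := NonUnitalStarSubalgebra.isClosed_topologicalClosure _)

section CStarAlgebras

variable {G : Type u} [TopologicalSpace G] [LocallyCompactSpace G] [SecondCountableTopology G]
  [T2Space G] [MeasurableSpace G] [BorelSpace G] {𝒢 : TopGroupoid G}

/-- A Hilbert-space representation of the `*`-algebra `C_c(G, σ)`: a `*`-homomorphism into `B(H)`
that is continuous for the inductive limit topology on `C_c(G)` and the weak operator topology.
A linear map out of `C_c(G)` is continuous for the (locally convex) inductive limit topology iff,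
for every compact `K`, its restriction to the functions supported in `K` is continuous for the
sup norm. As `C_c(G, σ)` is separable, each `‖ρ(f)‖` is a supremum over separable subrepresentations,
so the universe of `H` makes no difference to the `C*`-norm. -/
structure Rep (lam : HaarSystem 𝒢) (σ : Cocycle 𝒢) : Type (u + 1) where
  H : Type u
  [normed : NormedAddCommGroup H]
  [inner : InnerProductSpace ℂ H]
  [complete : CompleteSpace H]
  toFun : C_c(G, ℂ) →ₗ[ℂ] (H →L[ℂ] H)
  map_conv : ∀ f g, toFun (conv lam σ f g) = toFun f * toFun g
  map_invol : ∀ f, toFun (invol σ f) = star (toFun f)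
  continuous : ∀ K : Set G, IsCompact K → ∀ ξ η : H, ∀ ε > 0, ∃ δ > 0, ∀ f : C_c(G, ℂ),
    tsupport f ⊆ K → (∀ γ, ‖f γ‖ ≤ δ) → ‖⟪η, toFun f ξ⟫_ℂ‖ ≤ ε

attribute [instance] Rep.normed Rep.inner Rep.complete

/-- The `ℓ^∞`-product of the algebras `B(H_ρ)` over all representations `ρ` of `C_c(G, σ)`. -/
abbrev RepProd (lam : HaarSystem 𝒢) (σ : Cocycle 𝒢) : Type (u + 1) :=
  lp (fun ρ : Rep lam σ => ρ.H →L[ℂ] ρ.H) ∞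

/-- The image of `C_c(G, σ)` in the `ℓ^∞`-product under `f ↦ (ρ(f))_ρ`. The norm of `(ρ(f))_ρ` is
`sup_ρ ‖ρ(f)‖`, which is finite for every `f`. -/
def universalImage (lam : HaarSystem 𝒢) (σ : Cocycle 𝒢) : Set (RepProd lam σ) :=
  {a | ∃ f : C_c(G, ℂ), ∀ ρ : Rep lam σ, a ρ = ρ.toFun f}

/-- The twisted groupoid `C*`-algebra `C*(G, σ)`: the completion of `C_c(G, σ)` in the norm
`‖f‖ = sup {‖ρ(f)‖ : ρ ∈ Rep(C_c(G, σ))}`, realized as the closure of the image of `C_c(G, σ)` in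
the `ℓ^∞`-product of the `B(H_ρ)` (that image is a `*`-subalgebra, so it is the same to take the
closed `*`-subalgebra it generates). -/
def FullAlg (lam : HaarSystem 𝒢) (σ : Cocycle 𝒢) : Type (u + 1) :=
  closedStarAlgebra (universalImage lam σ)

instance (lam : HaarSystem 𝒢) (σ : Cocycle 𝒢) : NonUnitalCStarAlgebra (FullAlg lam σ) :=
  inferInstanceAs (NonUnitalCStarAlgebra (closedStarAlgebra (universalImage lam σ)))

/-- `a ∈ C*(G, σ)` is the canonical image of `f ∈ C_c(G, σ)`. -/
def FullAlg.IsImage {lam : HaarSystem 𝒢} {σ : Cocycle 𝒢} (f : C_c(G, ℂ)) (a : FullAlg lam σ) :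
    Prop :=
  ∀ ρ : Rep lam σ, a.1 ρ = ρ.toFun f

/-- The reduced twisted groupoid `C*`-algebra `C*_r(G, σ)`: the completion of `C_c(G, σ)` in the
norm `‖f‖_r = sup_u ‖Π^u(f)‖`, realized as the closure of the image of `C_c(G, σ)` under
`f ↦ (Π^u(f))_u` in the `ℓ^∞`-product of the `B(L²(G, λ_u))` (again the image is a `*`-subalgebra).
-/
def ReducedAlg (lam : HaarSystem 𝒢) (σ : Cocycle 𝒢) : Type u :=
  closedStarAlgebra (Set.range (regularFamily lam σ))

instance (lam : HaarSystem 𝒢) (σ : Cocycle 𝒢) : NonUnitalCStarAlgebra (ReducedAlg lam σ) :=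
  inferInstanceAs (NonUnitalCStarAlgebra (closedStarAlgebra (Set.range (regularFamily lam σ))))

/-- The canonical map `C_c(G, σ) → C*_r(G, σ)`. -/
def ReducedAlg.of (lam : HaarSystem 𝒢) (σ : Cocycle 𝒢) (f : C_c(G, ℂ)) : ReducedAlg lam σ :=
  ⟨regularFamily lam σ f, subset_closedStarAlgebra _ ⟨f, rfl⟩⟩

/-- `q` is the canonical quotient map `C*(G, σ) → C*_r(G, σ)`, i.e. the `*`-homomorphism that is
the identity on `C_c(G, σ)`. By density of `C_c(G, σ)` there is at most one such `q`. -/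
def IsReductionMap {lam : HaarSystem 𝒢} {σ : Cocycle 𝒢}
    (q : FullAlg lam σ →⋆ₙₐ[ℂ] ReducedAlg lam σ) : Prop :=
  ∀ (f : C_c(G, ℂ)) (a : FullAlg lam σ), a.IsImage f → q a = ReducedAlg.of lam σ f

/-- `U` is the map `Υ_n : C*(G^ω) → C*(G, ω^n)`, i.e. the `*`-homomorphism that is given on
`C_c(G^ω)` by `Υ_n(F)(γ) = ∫ F(t, γ) tⁿ dt`. By density of `C_c(G^ω)` there is at most one. -/
def IsUpsilon {lam : HaarSystem 𝒢} {ω : Cocycle 𝒢} (n : ℤ)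
    (U : FullAlg (lam.extension ω) 1 →⋆ₙₐ[ℂ] FullAlg lam (ω ^ n)) : Prop :=
  ∀ (F : C_c(Circle × G, ℂ)) (a : FullAlg (lam.extension ω) 1),
    a.IsImage F → (U a).IsImage (upsilonFun n F)

end CStarAlgebras

/-- The `C*`-algebraic (`c₀`-)direct sum of a family of `C*`-algebras: the families `(a_i)` with
`‖a_i‖ → 0`, with the sup norm. -/
def czeroSum {ι : Type*} (A : ι → Type*) [∀ i, NonUnitalCStarAlgebra (A i)] :
    NonUnitalStarSubalgebra ℂ (lp A ∞) where
  carrier := {a | Tendsto (fun i => ‖a i‖) cofinite (𝓝 0)}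
  zero_mem' := by
    refine tendsto_const_nhds.congr fun i => ?_
    exact norm_zero.symm
  add_mem' := by
    intro a b (ha : Tendsto _ _ _) (hb : Tendsto _ _ _)
    refine squeeze_zero (fun i => norm_nonneg _) (fun i => ?_) (by simpa using ha.add hb)
    exact norm_add_le (a i) (b i)
  mul_mem' := by
    intro a b (ha : Tendsto _ _ _) (hb : Tendsto _ _ _)
    refine squeeze_zero (fun i => norm_nonneg _) (fun i => ?_) (by simpa using ha.mul hb)
    exact norm_mul_le (a i) (b i)
  smul_mem' := by
    intro c a (ha : Tendsto _ _ _)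
    refine squeeze_zero (fun i => norm_nonneg _) (fun i => ?_) (by simpa using ha.const_mul ‖c‖)
    exact norm_smul_le c (a i)
  star_mem' := by
    intro a (ha : Tendsto _ _ _)
    refine ha.congr fun i => ?_
    exact (norm_star (a i)).symm

end TwistedGroupoid

end

open TwistedGroupoid

open MeasureTheory Topology Filter Set
open scoped ENNReal NNReal CompactlySupported ComplexConjugate InnerProductSpace

set_option linter.unusedSectionVars false

noncomputable section

namespace TwistedGroupoid

/-! ### Closures of `*`-subalgebras and extension of maps by density -/

section ClosedStarAlgebra

/-! The circle is central in the extension, so everything decomposes into Fourier modes in the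
circle variable. At a unit `(1, u)` the left regular representation of `G^ω` acts on `L²(𝕋 × G)`,
and the kernel of the operator given by `F` depends on the circle coordinates `t`, `s` only through
`t * s⁻¹` (`regKernel_extension`). It is thus a convolution in that variable, and the characters
diagonalize it: the functions `t⁻ⁿ ξ(γ)` form an invariant subspace on which `F` acts as the
`ω^n`-twisted regular representation of `Υ_n(F)` (`leftRegular_modeEmbedding`). Compression to this
subspace defines `Ω_n`. It is a contraction that sends the image of `F` to the image of `Υ_n(F)`,
and it is multiplicative because `Υ_n` turns convolution on `G^ω` into `ω^n`-twisted convolution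
(`upsilonFun_conv`).

The `Ω_n` are jointly injective because the modes together are total in `L²(𝕋 × G)`
(`eq_zero_of_inner_fourierIsometry`). The norms of `Ω_n(a)` tend to zero by a Riemann-Lebesgue
argument: for fixed `F` the functions `Υ_n(F)` live on one compact set and tend to zero uniformly,
and Schur's test bounds the reduced norm by the sup norm with a constant that does not depend on the
cocycle (`exists_norm_leftRegular_le`). Orthogonality of characters shows that `t⁻ⁿ f(γ)` is sent to
`f` in the summand `n` and to zero in all others. An injective `*`-homomorphism of `C*`-algebras is
isometric and so has closed range; a closed range that contains each summand is the whole `c₀`-sum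
(`exists_starAlgEquiv_czeroSum`).

The canonical maps come from the universal norm being a supremum over representations. The regular
representations are among them, which gives the reduction maps; representations of `C_c(G, ω^n)`
pull back along `Υ_n`, which gives the maps between full algebras. Uniqueness is density of `C_c`.
-/

/-- A set closed under the operations of a `*`-algebra. -/
structure IsStarSubalgebra {B : Type*} [NonUnitalCStarAlgebra B] (S : Set B) : Prop where
  zero : (0 : B) ∈ S
  add : ∀ a ∈ S, ∀ b ∈ S, a + b ∈ S
  mul : ∀ a ∈ S, ∀ b ∈ S, a * b ∈ S
  smul : ∀ (c : ℂ), ∀ a ∈ S, c • a ∈ S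
  star : ∀ a ∈ S, Star.star a ∈ S

variable {B C : Type*} [NonUnitalCStarAlgebra B] [NonUnitalCStarAlgebra C]

/-- Adjoining adds nothing to a set that is already a `*`-subalgebra, so only the topological
closure remains. -/
lemma coe_closedStarAlgebra {S : Set B} (hS : IsStarSubalgebra S) :
    (closedStarAlgebra S : Set B) = closure S := by
  let A : NonUnitalStarSubalgebra ℂ B :=
    { carrier := S
      zero_mem' := hS.zero
      add_mem' := fun {a b} ha hb => hS.add a ha b hb
      mul_mem' := fun {a b} ha hb => hS.mul a ha b hb
      smul_mem' := fun c a ha => hS.smul c a ha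
      star_mem' := fun {a} ha => hS.star a ha }
  have : NonUnitalStarAlgebra.adjoin ℂ S = A :=
    le_antisymm (NonUnitalStarAlgebra.adjoin_le (S := A) le_rfl)
      (NonUnitalStarAlgebra.subset_adjoin ℂ S)
  change closure (NonUnitalStarAlgebra.adjoin ℂ S : Set B) = closure S
  rw [this]
  rfl

/-- `closedStarAlgebra S` as a `C*`-algebra in its own right. -/
def ClosedAlg (S : Set B) : Type _ := closedStarAlgebra S

instance (S : Set B) : NonUnitalCStarAlgebra (ClosedAlg S) :=
  inferInstanceAs (NonUnitalCStarAlgebra (closedStarAlgebra S))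

/-- The inclusion of `ClosedAlg S`. -/
def ClosedAlg.incl (S : Set B) : ClosedAlg S →L[ℂ] B :=
  LinearMap.mkContinuous
    { toFun := fun a => a.1
      map_add' := fun _ _ => rfl
      map_smul' := fun _ _ => rfl } 1 fun a => (one_mul ‖a‖).symm ▸ le_rfl

lemma ClosedAlg.induction {S : Set B} (hS : IsStarSubalgebra S)
    {p : ClosedAlg S → Prop} (hp : IsClosed {a | p a})
    (h : ∀ a : ClosedAlg S, a.1 ∈ S → p a) (a : ClosedAlg S) : p a := by
  have hd : Dense {a : closedStarAlgebra S | a.1 ∈ S} := by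
    intro a
    rw [closure_subtype]
    have ha : a.1 ∈ closure S := by
      rw [← coe_closedStarAlgebra hS]; exact a.2
    convert! ha using 2
    ext b
    constructor
    · rintro ⟨c, hc, rfl⟩; exact hc
    · exact fun hb => ⟨⟨b, subset_closedStarAlgebra S hb⟩, hb, rfl⟩
  have : closure {a : ClosedAlg S | a.1 ∈ S} ⊆ {a | p a} :=
    closure_minimal (fun b hb => h b hb) hp
  exact this (hd a)

/-- A continuous linear map that is a `*`-homomorphism on a `*`-subalgebra `S` and maps `S` into
`T` restricts to a `*`-homomorphism between the closures. -/
lemma exists_starHom_closedAlg {S : Set B} {T : Set C} (hS : IsStarSubalgebra S)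
    (hT : IsStarSubalgebra T) (φ : B →L[ℂ] C) (hmul : ∀ a ∈ S, ∀ b ∈ S, φ (a * b) = φ a * φ b)
    (hstar : ∀ a ∈ S, φ (star a) = star (φ a)) (hST : ∀ a ∈ S, φ a ∈ T) :
    ∃ Φ : ClosedAlg S →⋆ₙₐ[ℂ] ClosedAlg T, ∀ a, (Φ a).1 = φ a.1 := by
  have hmem : ∀ a : ClosedAlg S, φ a.1 ∈ closedStarAlgebra T := by
    intro a
    rw [← SetLike.mem_coe, coe_closedStarAlgebra hT]
    refine map_mem_closure φ.continuous (s := S) ?_ hST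
    rw [← coe_closedStarAlgebra hS]
    exact a.2
  have hc : Continuous fun a : ClosedAlg S => a.1 := (ClosedAlg.incl S).continuous
  -- Multiplicativity passes to the closure one variable at a time: the first factor while the
  -- second stays in `S`, then the second.
  have hmul1 : ∀ b ∈ S, ∀ a : ClosedAlg S, φ (a.1 * b) = φ a.1 * φ b := fun b hb =>
    ClosedAlg.induction hS
      (isClosed_eq (by fun_prop) (by fun_prop)) fun a ha => hmul _ ha b hb
  have hmul2 : ∀ a b : ClosedAlg S, φ (a.1 * b.1) = φ a.1 * φ b.1 := fun a =>
    ClosedAlg.induction hS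
      (isClosed_eq (by fun_prop) (by fun_prop)) fun b hb => hmul1 _ hb a
  have hstar' : ∀ a : ClosedAlg S, φ (star a.1) = star (φ a.1) :=
    ClosedAlg.induction hS (isClosed_eq (by fun_prop) (by fun_prop)) fun a ha => hstar _ ha
  exact ⟨{ toFun := fun a => ⟨φ a.1, hmem a⟩
           map_smul' := fun c a => Subtype.ext (map_smul φ c a.1)
           map_zero' := Subtype.ext (map_zero φ)
           map_add' := fun a b => Subtype.ext (map_add φ a.1 b.1)
           map_mul' := fun a b => Subtype.ext (hmul2 a b)
           map_star' := fun a => Subtype.ext (hstar' a) }, fun _ => rfl⟩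

lemma starHom_continuous (Φ : B →⋆ₙₐ[ℂ] C) : Continuous Φ :=
  AddMonoidHomClass.continuous_of_bound Φ 1 fun a => by
    rw [one_mul]; exact NonUnitalStarAlgHom.norm_apply_le Φ a

end ClosedStarAlgebra

/-! ### Maps into and out of `ℓ^∞`-products -/

section LpLift

/-- A family of contractions, as a map into the `ℓ^∞`-product. -/
def lpLift {B ι : Type*} [NormedAddCommGroup B] [NormedSpace ℂ B] {A : ι → Type*}
    [∀ i, NormedAddCommGroup (A i)] [∀ i, NormedSpace ℂ (A i)] (T : ∀ i, B →ₗ[ℂ] A i)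
    (hT : ∀ i b, ‖T i b‖ ≤ ‖b‖) : B →L[ℂ] lp A ∞ :=
  LinearMap.mkContinuous
    { toFun := fun b => ⟨fun i => T i b, memℓp_infty ⟨‖b‖, by
        rintro _ ⟨i, rfl⟩; exact hT i b⟩⟩
      map_add' := fun a b => lp.ext (funext fun i => map_add (T i) a b)
      map_smul' := fun c a => lp.ext (funext fun i => map_smul (T i) c a) } 1
    fun b => by
      rw [one_mul]
      exact lp.norm_le_of_forall_le (norm_nonneg b) fun i => hT i b

/-- The coordinate projections of an `ℓ^∞`-product. -/
def lpEval {ι : Type*} (A : ι → Type*) [∀ i, NormedAddCommGroup (A i)]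
    [∀ i, NormedSpace ℂ (A i)] (i : ι) : lp A ∞ →ₗ[ℂ] A i where
  toFun a := a i
  map_add' _ _ := rfl
  map_smul' _ _ := rfl

lemma norm_lpEval_le {ι : Type*} {A : ι → Type*} [∀ i, NormedAddCommGroup (A i)]
    [∀ i, NormedSpace ℂ (A i)] (i : ι) (a : lp A ∞) : ‖lpEval A i a‖ ≤ ‖a‖ :=
  lp.norm_apply_le_norm ENNReal.top_ne_zero a i

lemma continuous_lpEval {ι : Type*} {A : ι → Type*} [∀ i, NormedAddCommGroup (A i)]
    [∀ i, NormedSpace ℂ (A i)] (i : ι) : Continuous fun a : lp A ∞ => a i :=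
  ((lpEval A i).mkContinuous 1 fun a => by
    rw [one_mul]; exact norm_lpEval_le i a).continuous

end LpLift

/-! ### The `c₀`-sum inside the `ℓ^∞`-product -/

section Direct

variable {ι : Type*} {A : ι → Type*} [∀ i, NonUnitalCStarAlgebra (A i)]

/-- Finite truncations approximate: a `c₀`-family has only finitely many coordinates of norm at
least `ε / 2`, and the sum of these lies in `S`. -/
lemma czeroSum_subset_of_closed {S : Set (lp A ∞)} (hS : IsClosed S) (h0 : 0 ∈ S)
    (hadd : ∀ a ∈ S, ∀ b ∈ S, a + b ∈ S) [DecidableEq ι]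
    (hsingle : ∀ i (b : A i), lp.single ∞ i b ∈ S) (a : lp A ∞) (ha : a ∈ czeroSum A) :
    a ∈ S := by
  rw [← hS.closure_eq, Metric.mem_closure_iff]
  intro ε hε
  have ha' : Tendsto (fun i => ‖a i‖) cofinite (𝓝 0) := ha
  have hfin : {i | ¬ ‖a i‖ < ε / 2}.Finite :=
    eventually_cofinite.1 (ha'.eventually_lt_const (half_pos hε))
  refine ⟨∑ i ∈ hfin.toFinset, lp.single ∞ i (a i), ?_, ?_⟩
  · exact Finset.sum_induction _ (· ∈ S) (fun a b ha hb => hadd a ha b hb) h0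
      fun i _ => hsingle i _
  · rw [dist_eq_norm]
    -- The supremum of the remaining coordinates is only `≤` the cutoff, so the cutoff is `ε / 2` to
    -- obtain a strict inequality.
    refine lt_of_le_of_lt (lp.norm_le_of_forall_le (half_pos hε).le fun i => ?_) (half_lt_self hε)
    rw [lp.coeFn_sub, Pi.sub_apply, lp.coeFn_sum, Finset.sum_apply]
    by_cases hi : i ∈ hfin.toFinset
    · rw [Finset.sum_eq_single_of_mem i hi fun j _ hj => lp.single_apply_ne ∞ j _ hj.symm,
        lp.single_apply_self, sub_self, norm_zero]
      exact (half_pos hε).le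
    · rw [Finset.sum_eq_zero fun j hj => lp.single_apply_ne ∞ j _
        (by rintro rfl; exact hi hj), sub_zero]
      rw [hfin.mem_toFinset, mem_ofPred_eq, not_not] at hi
      exact hi.le

lemma isClosed_czeroSum : IsClosed {a : lp A ∞ | a ∈ czeroSum A} := by
  refine isClosed_of_closure_subset fun a ha => ?_
  rw [Metric.mem_closure_iff] at ha
  change Tendsto (fun i => ‖a i‖) cofinite (𝓝 0)
  rw [Metric.tendsto_nhds]
  intro ε hε
  obtain ⟨b, hb, hab⟩ := ha (ε / 2) (half_pos hε)
  have hb' : Tendsto (fun i => ‖b i‖) cofinite (𝓝 0) := hb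
  filter_upwards [hb'.eventually_lt_const (half_pos hε)] with i hi
  rw [dist_zero_right, norm_norm]
  have h1 : ‖(a - b) i‖ ≤ ‖a - b‖ := lp.norm_apply_le_norm ENNReal.top_ne_zero _ i
  rw [dist_eq_norm] at hab
  have h2 : a i = (a - b) i + b i := by simp
  rw [h2]
  linarith [norm_add_le ((a - b) i) (b i)]

end Direct

/-! ### Calculus of integral operators with Schur kernels -/

section Kernel

variable {X : Type*} [MeasurableSpace X]

/-- A measurable kernel whose row and column integrals are bounded by `C`. -/
structure IsSchurKernel (ν : Measure X) (k : X → X → ℂ) (C : ℝ≥0) : Prop where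
  aestronglyMeasurable : AEStronglyMeasurable (Function.uncurry k) (ν.prod ν)
  row : ∀ᵐ x ∂ν, ∫⁻ y, ‖k x y‖ₑ ∂ν ≤ C
  col : ∀ᵐ y ∂ν, ∫⁻ x, ‖k x y‖ₑ ∂ν ≤ C

/-- `T` is the integral operator with kernel `k`. -/
def HasKernel {ν : Measure X} (T : Lp ℂ 2 ν →L[ℂ] Lp ℂ 2 ν) (k : X → X → ℂ) : Prop :=
  ∀ ξ ζ : Lp ℂ 2 ν, ⟪ζ, T ξ⟫_ℂ = ∫ x, ∫ y, k x y * ξ y * conj (ζ x) ∂ν ∂ν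

variable {ν : Measure X} [SigmaFinite ν] {k k' : X → X → ℂ} {C C' : ℝ≥0}

lemma IsSchurKernel.swap (hk : IsSchurKernel ν k C) :
    IsSchurKernel ν (fun x y => conj (k y x)) C where
  aestronglyMeasurable :=
    Complex.continuous_conj.comp_aestronglyMeasurable hk.aestronglyMeasurable.prod_swap
  row := hk.col.mono fun x hx => by simpa only [RCLike.enorm_conj] using hx
  col := hk.row.mono fun x hx => by simpa only [RCLike.enorm_conj] using hx

/-- By Tonelli, integrating over the first variable first leaves at most `C` times the `L¹` norm of
`g`, by the column bound. -/
lemma IsSchurKernel.integrable_mul_snd (hk : IsSchurKernel ν k C) {g : X → ℂ}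
    (hg : Integrable g ν) : Integrable (fun p : X × X => k p.1 p.2 * g p.2) (ν.prod ν) := by
  refine ⟨hk.aestronglyMeasurable.mul hg.aestronglyMeasurable.comp_snd, ?_⟩
  have hkm : AEMeasurable (fun p : X × X => ‖k p.1 p.2‖ₑ) (ν.prod ν) :=
    hk.aestronglyMeasurable.enorm
  have hgm : AEMeasurable (fun p : X × X => ‖g p.2‖ₑ) (ν.prod ν) :=
    hg.aestronglyMeasurable.comp_snd.enorm
  rw [HasFiniteIntegral]
  simp only [enorm_mul]
  rw [lintegral_prod_symm (fun p : X × X => ‖k p.1 p.2‖ₑ * ‖g p.2‖ₑ) (hkm.mul hgm)]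
  calc ∫⁻ y, ∫⁻ x, ‖k x y‖ₑ * ‖g y‖ₑ ∂ν ∂ν
      = ∫⁻ y, (∫⁻ x, ‖k x y‖ₑ ∂ν) * ‖g y‖ₑ ∂ν :=
        lintegral_congr fun y => lintegral_mul_const' _ _ enorm_ne_top
    _ ≤ ∫⁻ y, C * ‖g y‖ₑ ∂ν := lintegral_mono_ae (hk.col.mono fun y hy => mul_le_mul_left hy _)
    _ = C * ∫⁻ y, ‖g y‖ₑ ∂ν := lintegral_const_mul' _ _ ENNReal.coe_ne_top
    _ < ∞ := ENNReal.mul_lt_top ENNReal.coe_lt_top hg.2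

lemma IsSchurKernel.integrable_mul_fst (hk : IsSchurKernel ν k C) {g : X → ℂ}
    (hg : Integrable g ν) : Integrable (fun p : X × X => k p.1 p.2 * g p.1) (ν.prod ν) := by
  have hk1 : IsSchurKernel ν (fun x y => k y x) C :=
    ⟨hk.aestronglyMeasurable.prod_swap, hk.col, hk.row⟩
  exact (hk1.integrable_mul_snd hg).swap

omit [SigmaFinite ν] in
lemma integrable_sq (ξ : Lp ℂ 2 ν) : Integrable (fun x => ((‖ξ x‖ ^ 2 : ℝ) : ℂ)) ν :=
  ((memLp_two_iff_integrable_sq_norm (Lp.aestronglyMeasurable ξ)).1 (Lp.memLp ξ)).ofReal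

/-- The bound `‖ξ‖ ‖ζ‖ ≤ ‖ξ‖² + ‖ζ‖²` reduces this to the two preceding one-variable statements,
applied to the `L¹` functions `‖ξ‖²` and `‖ζ‖²`. -/
lemma IsSchurKernel.integrable_form (hk : IsSchurKernel ν k C) (ξ ζ : Lp ℂ 2 ν) :
    Integrable (fun p : X × X => k p.1 p.2 * ξ p.2 * conj (ζ p.1)) (ν.prod ν) := by
  refine ((hk.integrable_mul_snd (integrable_sq ξ)).norm.add
    (hk.integrable_mul_fst (integrable_sq ζ)).norm).mono'
    ((hk.aestronglyMeasurable.mul (Lp.aestronglyMeasurable ξ).comp_snd).mul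
      (Complex.continuous_conj.comp_aestronglyMeasurable (Lp.aestronglyMeasurable ζ).comp_fst))
    (ae_of_all _ fun p => ?_)
  simp only [norm_mul, RCLike.norm_conj, Pi.add_apply, Complex.norm_real, norm_pow, norm_norm]
  rw [mul_assoc, ← mul_add]
  refine mul_le_mul_of_nonneg_left ?_ (norm_nonneg _)
  nlinarith [sq_nonneg (‖ξ p.2‖ - ‖ζ p.1‖), sq_nonneg (‖ξ p.2‖ + ‖ζ p.1‖)]

lemma IsSchurKernel.integrable_row (hk : IsSchurKernel ν k C) : ∀ᵐ x ∂ν, Integrable (k x) ν := by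
  filter_upwards [hk.row, hk.aestronglyMeasurable.prodMk_left] with x h1 h2
  exact ⟨h2, h1.trans_lt ENNReal.coe_lt_top⟩

lemma IsSchurKernel.integrable_mul (hk : IsSchurKernel ν k C) (ξ : Lp ℂ 2 ν) :
    ∀ᵐ x ∂ν, Integrable (fun y => k x y * ξ y) ν := by
  filter_upwards [hk.integrable_row, (hk.integrable_mul_snd (integrable_sq ξ)).prod_right_ae]
    with x h1 h2
  -- Domination by `‖ξ‖ ≤ 1 + ‖ξ‖²`: the row itself is integrable, and so is the row times `‖ξ‖²`.
  refine (h1.norm.add h2.norm).mono' (h1.aestronglyMeasurable.mul (Lp.aestronglyMeasurable ξ))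
    (ae_of_all _ fun y => ?_)
  simp only [norm_mul, Pi.add_apply, Complex.norm_real, norm_pow, norm_norm]
  nlinarith [norm_nonneg (k x y), sq_nonneg (‖ξ y‖ - 1),
    mul_nonneg (norm_nonneg (k x y)) (sq_nonneg (‖ξ y‖ - 1)),
    mul_nonneg (norm_nonneg (k x y)) (sq_nonneg (‖ξ y‖)) ]

/-- Passes from the weak description by matrix coefficients to a pointwise formula: pairing with
indicators of sets of finite measure shows that both sides have the same integrals over such sets.
-/
lemma HasKernel.apply_ae {T : Lp ℂ 2 ν →L[ℂ] Lp ℂ 2 ν} (hT : HasKernel T k)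
    (hk : IsSchurKernel ν k C) (ξ : Lp ℂ 2 ν) : T ξ =ᵐ[ν] fun x => ∫ y, k x y * ξ y ∂ν := by
  have hind : ∀ s (hs : MeasurableSet s) (hμ : ν s < ∞),
      indicatorConstLp 2 hs hμ.ne (1 : ℂ) =ᵐ[ν] s.indicator fun _ => 1 := fun s hs hμ =>
    indicatorConstLp_coeFn
  have hform : ∀ s (hs : MeasurableSet s) (hμ : ν s < ∞),
      (fun x => ∫ y, k x y * ξ y * conj ((indicatorConstLp 2 hs hμ.ne (1 : ℂ) : Lp ℂ 2 ν) x) ∂ν)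
        =ᵐ[ν] s.indicator fun x => ∫ y, k x y * ξ y ∂ν := fun s hs hμ =>
    (hind s hs hμ).mono fun x hx => by
      simp only [hx]
      by_cases hxs : x ∈ s <;> simp [hxs]
  refine ae_eq_of_forall_setIntegral_eq_of_sigmaFinite ?_ ?_ ?_
  · intro s hs hμ
    exact integrableOn_Lp_of_measure_ne_top (T ξ) one_le_two hμ.ne
  · intro s hs hμ
    rw [← integrable_indicator_iff hs]
    exact (hk.integrable_form ξ (indicatorConstLp 2 hs hμ.ne 1)).integral_prod_left.congr
      (hform s hs hμ)
  · intro s hs hμ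
    have := hT ξ (indicatorConstLp 2 hs hμ.ne 1)
    rw [L2.inner_indicatorConstLp_one] at this
    rw [this, integral_congr_ae (hform s hs hμ), integral_indicator hs]

omit [SigmaFinite ν] in
lemma HasKernel.congr {T S : Lp ℂ 2 ν →L[ℂ] Lp ℂ 2 ν} (hT : HasKernel T k) (hS : HasKernel S k')
    (h : ∀ᵐ x ∂ν, ∀ᵐ y ∂ν, k x y = k' x y) : T = S := by
  refine ContinuousLinearMap.ext fun ξ => ext_inner_left ℂ fun ζ => ?_
  rw [hT, hS]
  refine integral_congr_ae (h.mono fun x hx => integral_congr_ae (hx.mono fun y hy => ?_))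
  simp only [hy]

/-- Schur's test produces some operator with kernel `k` and norm at most `C`; since the kernel
determines the operator, it is `T`. -/
lemma HasKernel.norm_le {T : Lp ℂ 2 ν →L[ℂ] Lp ℂ 2 ν} (hT : HasKernel T k)
    (hk : IsSchurKernel ν k C) : ‖T‖ ≤ C := by
  obtain ⟨S, hS, hSk⟩ := exists_operator_of_kernel ν k hk.1 C hk.2 hk.3
  rwa [hT.congr hSk (ae_of_all _ fun x => ae_of_all _ fun y => rfl)]

lemma HasKernel.add {T S : Lp ℂ 2 ν →L[ℂ] Lp ℂ 2 ν} (hT : HasKernel T k)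
    (hk : IsSchurKernel ν k C) (hS : HasKernel S k') (hk' : IsSchurKernel ν k' C') :
    HasKernel (T + S) fun x y => k x y + k' x y := by
  intro ξ ζ
  rw [add_apply, inner_add_right, hT, hS,
    ← integral_add (hk.integrable_form ξ ζ).integral_prod_left
      (hk'.integrable_form ξ ζ).integral_prod_left]
  refine integral_congr_ae ?_
  filter_upwards [(hk.integrable_form ξ ζ).prod_right_ae, (hk'.integrable_form ξ ζ).prod_right_ae]
    with x h1 h2
  rw [← integral_add h1 h2]
  simp only [add_mul]

omit [SigmaFinite ν] in
lemma HasKernel.smul {T : Lp ℂ 2 ν →L[ℂ] Lp ℂ 2 ν} (hT : HasKernel T k) (c : ℂ) :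
    HasKernel (c • T) fun x y => c * k x y := by
  intro ξ ζ
  rw [smul_apply, inner_smul_right, hT]
  simp only [mul_assoc, integral_const_mul]

lemma HasKernel.star {T : Lp ℂ 2 ν →L[ℂ] Lp ℂ 2 ν} (hT : HasKernel T k)
    (hk : IsSchurKernel ν k C) : HasKernel (star T) fun x y => conj (k y x) := by
  intro ξ ζ
  rw [ContinuousLinearMap.star_eq_adjoint, ContinuousLinearMap.adjoint_inner_right,
    ← inner_conj_symm, hT, integral_integral_swap (hk.integrable_form ζ ξ), ← integral_conj]
  refine integral_congr_ae (ae_of_all _ fun x => ?_)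
  simp only
  rw [← integral_conj]
  refine integral_congr_ae (ae_of_all _ fun y => ?_)
  simp only [map_mul, Complex.conj_conj]
  ring

/-- The content is Fubini for `k(x, y) k'(y, z) ξ(z)` in `(y, z)`, for almost every `x`. As before,
`‖ξ‖ ≤ 1 + ‖ξ‖²` splits the integrability into two parts, `hI1` and `hI2`. -/
lemma HasKernel.mul {T S : Lp ℂ 2 ν →L[ℂ] Lp ℂ 2 ν} (hT : HasKernel T k)
    (hk : IsSchurKernel ν k C) (hS : HasKernel S k') (hk' : IsSchurKernel ν k' C') :
    HasKernel (T * S) fun x z => ∫ y, k x y * k' y z ∂ν := by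
  intro ξ ζ
  rw [mul_apply_eq_comp, hT]
  have hsq := hk'.integrable_mul_snd (integrable_sq ξ)
  -- This function of `y` is in `L¹`, so multiplying it by `k(x, y)` keeps it integrable for almost
  -- every `x`; that is the outer integral needed for `hI2`.
  have hsq' : Integrable (fun y => ((∫ z, ‖k' y z * ((‖ξ z‖ ^ 2 : ℝ) : ℂ)‖ ∂ν : ℝ) : ℂ)) ν :=
    hsq.integral_norm_prod_left.ofReal
  refine integral_congr_ae ?_
  filter_upwards [hk.integrable_row, (hk.integrable_mul_snd hsq').prod_right_ae] with x h1 h2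
  have hI1 : Integrable (fun p : X × X => k x p.1 * k' p.1 p.2) (ν.prod ν) := by
    have := hk'.integrable_mul_fst h1
    simpa only [mul_comm] using this
  have hI2 : Integrable (fun p : X × X => k x p.1 * (k' p.1 p.2 * ((‖ξ p.2‖ ^ 2 : ℝ) : ℂ)))
      (ν.prod ν) := by
    have hm : AEStronglyMeasurable
        (fun p : X × X => k x p.1 * (k' p.1 p.2 * ((‖ξ p.2‖ ^ 2 : ℝ) : ℂ))) (ν.prod ν) :=
      h1.aestronglyMeasurable.comp_fst.mul hsq.aestronglyMeasurable
    refine (integrable_prod_iff hm).2 ⟨?_, ?_⟩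
    · exact hsq.prod_right_ae.mono fun y hy => hy.const_mul (k x y)
    · refine h2.norm.congr (ae_of_all _ fun y => ?_)
      simp only [norm_mul, integral_const_mul, Complex.norm_real, norm_norm, norm_pow]
      rw [Real.norm_of_nonneg (integral_nonneg fun z => by positivity)]
  have hI : Integrable (fun p : X × X => k x p.1 * k' p.1 p.2 * ξ p.2) (ν.prod ν) := by
    refine (hI1.norm.add hI2.norm).mono' (hI1.aestronglyMeasurable.mul
      (Lp.aestronglyMeasurable ξ).comp_snd) (ae_of_all _ fun p => ?_)
    simp only [norm_mul, Pi.add_apply, Complex.norm_real, norm_pow, norm_norm]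
    have h0 := mul_nonneg (norm_nonneg (k x p.1)) (norm_nonneg (k' p.1 p.2))
    nlinarith [mul_nonneg h0 (sq_nonneg (‖ξ p.2‖ - 1)), mul_nonneg h0 (sq_nonneg (‖ξ p.2‖))]
  have e1 : ∫ y, k x y * (S ξ) y * conj (ζ x) ∂ν = (∫ y, ∫ z, k x y * k' y z * ξ z ∂ν ∂ν) * conj (ζ x) := by
    rw [← integral_mul_const]
    refine integral_congr_ae ((hS.apply_ae hk' ξ).mono fun y hy => ?_)
    simp only [hy]
    rw [← integral_const_mul]
    simp only [mul_assoc]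
  rw [e1, integral_integral_swap hI, ← integral_mul_const]
  simp only [integral_mul_const]

end Kernel

/-! ### Regular representations as kernel operators, and the reduction map -/

section RegularKernel

variable {G : Type u} [TopologicalSpace G]

/-- The kernel `f(γζ⁻¹) σ(γζ⁻¹, ζ)` of the left regular representations. -/
def regKernel {𝒢 : TopGroupoid G} (σ : Cocycle 𝒢) (f : C_c(G, ℂ)) (γ ζ : G) : ℂ :=
  f (𝒢.mul γ (𝒢.inv ζ)) * (σ.toFun (𝒢.mul γ (𝒢.inv ζ)) ζ : ℂ)

lemma enorm_regKernel {𝒢 : TopGroupoid G} (σ : Cocycle 𝒢) (f : C_c(G, ℂ)) (γ ζ : G) :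
    ‖regKernel σ f γ ζ‖ₑ = ‖f (𝒢.mul γ (𝒢.inv ζ))‖ₑ := by
  rw [← ofReal_norm, ← ofReal_norm, regKernel, norm_mul, Circle.norm_coe, mul_one]

variable [LocallyCompactSpace G] [SecondCountableTopology G]
  [T2Space G] [MeasurableSpace G] [BorelSpace G] {𝒢 : TopGroupoid G}

lemma HaarSystem.src_eq_map (lam : HaarSystem 𝒢) (x : G) :
    lam.src x = (lam.meas x).map 𝒢.invHomeo.toMeasurableEquiv := rfl

lemma HaarSystem.integral_src (lam : HaarSystem 𝒢) (x : G) (g : G → ℂ) :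
    ∫ γ, g γ ∂(lam.src x) = ∫ η, g (𝒢.inv η) ∂(lam.meas x) := by
  rw [src_eq_map, integral_map_equiv]; rfl

lemma HaarSystem.lintegral_src (lam : HaarSystem 𝒢) (x : G) (g : G → ℝ≥0∞) :
    ∫⁻ γ, g γ ∂(lam.src x) = ∫⁻ η, g (𝒢.inv η) ∂(lam.meas x) := by
  rw [src_eq_map, lintegral_map_equiv]; rfl

lemma HaarSystem.sigmaFinite_src (lam : HaarSystem 𝒢) {x : G} (hx : x ∈ 𝒢.units) :
    SigmaFinite (lam.src x) := by
  have := lam.isFiniteMeasureOnCompacts hx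
  rw [src_eq_map]
  exact 𝒢.invHomeo.toMeasurableEquiv.sigmaFinite_map

instance (lam : HaarSystem 𝒢) (x : 𝒢.units) : SigmaFinite (lam.src x) := lam.sigmaFinite_src x.2

lemma HaarSystem.ae_s (lam : HaarSystem 𝒢) {x : G} (hx : x ∈ 𝒢.units) :
    ∀ᵐ γ ∂(lam.src x), 𝒢.s γ = x := by
  rw [src_eq_map, (MeasurableEquiv.measurableEmbedding _).ae_map_iff]
  exact (lam.ae_r hx).mono fun γ hγ => (𝒢.s_inv γ).trans hγ

lemma aestronglyMeasurable_regKernel (lam : HaarSystem 𝒢) (σ : Cocycle 𝒢) (f : C_c(G, ℂ)) {x : G}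
    (hx : x ∈ 𝒢.units) : AEStronglyMeasurable (Function.uncurry (regKernel σ f))
      ((lam.src x).prod (lam.src x)) := by
  have := lam.sigmaFinite_src hx
  have hsA : ∀ᵐ γ ∂(lam.src x), γ ∈ {γ | 𝒢.s γ = x} := lam.ae_s hx
  set A : Set G := {γ | 𝒢.s γ = x} with hA
  have hAc : IsClosed A := isClosed_eq 𝒢.continuous_s continuous_const
  have hm : ContinuousOn (fun p : G × G => 𝒢.mul p.1 (𝒢.inv p.2)) (A ×ˢ A) :=
    𝒢.continuousOn_mul.comp (f := fun p : G × G => (p.1, 𝒢.inv p.2))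
      (continuous_fst.prodMk (𝒢.continuous_inv.comp continuous_snd)).continuousOn
      fun p hp => hp.1.trans (hp.2.symm.trans (𝒢.r_inv _).symm)
  have hkc : ContinuousOn (Function.uncurry (regKernel σ f)) (A ×ˢ A) := by
    refine ((map_continuous f).comp_continuousOn hm).mul
      (continuous_subtype_val.comp_continuousOn
        (σ.continuousOn.comp (f := fun p : G × G => (𝒢.mul p.1 (𝒢.inv p.2), p.2))
          (hm.prodMk continuous_snd.continuousOn) fun p hp => ?_))
    change 𝒢.s _ = 𝒢.r _
    rw [𝒢.s_mul _ _ (hp.1.trans (hp.2.symm.trans (𝒢.r_inv _).symm)), 𝒢.s_inv]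
  have : ((lam.src x).prod (lam.src x)).restrict (A ×ˢ A) =
      (lam.src x).prod (lam.src x) := by
    rw [← Measure.prod_restrict, Measure.restrict_eq_self_of_ae_mem hsA]
  rw [← this]
  exact hkc.aestronglyMeasurable (hAc.prod hAc).measurableSet

/-- Kernels of functions supported in `K` satisfy Schur bounds proportional to the sup norm. -/
lemma exists_isSchurKernel_of_subset (lam : HaarSystem 𝒢) {K : Set G} (hK : IsCompact K) :
    ∃ C : ℝ≥0, ∀ (σ : Cocycle 𝒢) (f : C_c(G, ℂ)) (δ : ℝ≥0), tsupport f ⊆ K →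
      (∀ γ, ‖f γ‖ ≤ δ) → ∀ x ∈ 𝒢.units, IsSchurKernel (lam.src x) (regKernel σ f) (δ * C) := by
  -- The cutoff is one on `K` and on its inverse, because row integrals involve `f(γη)` while column
  -- integrals involve `f((ζη)⁻¹)`. After left translation both are bounded by the fibre integrals
  -- of `χ`, which see neither `f` nor the cocycle.
  obtain ⟨χ, hχ1, -, hχc, hχ01⟩ := exists_continuous_one_zero_of_isCompact
    (hK.union (hK.image 𝒢.continuous_inv)) isClosed_empty (disjoint_empty _)
  let χ' : C_c(G, ℂ) := ⟨⟨fun x => (χ x : ℂ), Complex.continuous_ofReal.comp (map_continuous χ)⟩, hχc.comp_left Complex.ofReal_zero⟩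
  obtain ⟨C, hC⟩ := lam.exists_bound χ'
  refine ⟨C, fun σ f δ hf hδ x hx => ?_⟩
  have hle : ∀ γ γ', γ' = γ ∨ γ' = 𝒢.inv γ → ‖f γ‖ₑ ≤ δ * ‖χ' γ'‖ₑ := by
    intro γ γ' h
    by_cases h0 : f γ = 0
    · rw [h0, enorm_zero]; exact zero_le
    · have hγ : γ ∈ K := hf (subset_tsupport _ h0)
      have h1 : χ γ' = 1 := hχ1 (h.elim (fun h => .inl (h ▸ hγ)) fun h => .inr ⟨γ, hγ, h.symm⟩)
      have h2 : χ' γ' = 1 := by change ((χ γ' : ℝ) : ℂ) = 1; rw [h1]; simp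
      rw [h2, enorm_one, mul_one]
      exact_mod_cast hδ γ
  have hint : ∀ γ, 𝒢.s γ = x → ∫⁻ η, δ * ‖χ' (𝒢.mul γ η)‖ₑ ∂(lam.meas x) ≤ (δ * C : ℝ≥0) := by
    intro γ hγ
    have h := lam.lintegral_translate χ' γ
    rw [hγ] at h
    rw [lintegral_const_mul' _ _ ENNReal.coe_ne_top, h, ENNReal.coe_mul]
    gcongr
    exact hC _ (𝒢.r_r γ)
  refine ⟨aestronglyMeasurable_regKernel lam σ f hx, (lam.ae_s hx).mono fun γ hγ => ?_,
    (lam.ae_s hx).mono fun ζ hζ => ?_⟩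
  · simp only [enorm_regKernel, lam.lintegral_src, 𝒢.inv_inv]
    exact (lintegral_mono fun η => hle _ _ (.inl rfl)).trans (hint γ hγ)
  · simp only [enorm_regKernel, lam.lintegral_src]
    refine (lintegral_mono_ae ((lam.ae_r hx).mono fun η hη => hle _ _ (.inr ?_))).trans (hint ζ hζ)
    rw [← 𝒢.inv_mul _ _ (hζ.trans hη.symm), 𝒢.inv_inv]

lemma exists_isSchurKernel (lam : HaarSystem 𝒢) (σ : Cocycle 𝒢) (f : C_c(G, ℂ)) :
    ∃ C : ℝ≥0, ∀ x ∈ 𝒢.units, IsSchurKernel (lam.src x) (regKernel σ f) C := by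
  obtain ⟨C, hC⟩ := exists_isSchurKernel_of_subset lam f.hasCompactSupport.isCompact
  obtain ⟨B, hB⟩ := f.hasCompactSupport.exists_bound_of_continuous f.continuous
  exact ⟨_, hC σ f B.toNNReal le_rfl fun γ => (hB γ).trans (Real.le_coe_toNNReal B)⟩

lemma hasKernel_leftRegular (lam : HaarSystem 𝒢) (σ : Cocycle 𝒢) (x : 𝒢.units) (f : C_c(G, ℂ)) :
    HasKernel (leftRegular lam σ x f) (regKernel σ f) := by
  intro ξ ζ
  rw [inner_leftRegular]
  refine integral_congr_ae (ae_of_all _ fun γ => ?_)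
  simp only [lam.integral_src, regKernel, 𝒢.inv_inv]
  refine integral_congr_ae (ae_of_all _ fun η => ?_)
  simp only
  ring

/-- Invariance is given for `C_c(G)` only, whereas factors built from products and cocycles are
continuous only on a range fibre. The fibre is closed, so Tietze extends `h` to all of `G`, and `f`
supplies the compact support. -/
lemma HaarSystem.integral_translate (lam : HaarSystem 𝒢) (γ : G) (f : C_c(G, ℂ)) {h : G → ℂ}
    (hh : ContinuousOn h {α | 𝒢.r α = 𝒢.r γ}) :
    ∫ η, f (𝒢.mul γ η) * h (𝒢.mul γ η) ∂(lam.meas (𝒢.s γ)) =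
      ∫ α, f α * h α ∂(lam.meas (𝒢.r γ)) := by
  have hS : IsClosed {α | 𝒢.r α = 𝒢.r γ} := isClosed_eq 𝒢.continuous_r continuous_const
  obtain ⟨h', hh'⟩ := ContinuousMap.exists_restrict_eq hS ⟨_, hh.domRestrict⟩
  have hh'' : ∀ α, 𝒢.r α = 𝒢.r γ → h' α = h α := fun α hα =>
    congrArg (fun f => f ⟨α, hα⟩) hh'
  have key := lam.invariant γ ⟨⟨fun α => f α * h' α,
    (map_continuous f).mul (map_continuous h')⟩, f.hasCompactSupport.mul_right⟩
  refine Eq.trans ?_ (key.trans ?_)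
  · refine integral_congr_ae ((lam.ae_r (𝒢.r_s γ)).mono fun η hη => ?_)
    change _ = f _ * h' _
    rw [hh'' _ (𝒢.r_mul _ _ hη.symm)]
  · refine integral_congr_ae ((lam.ae_r (𝒢.r_r γ)).mono fun η hη => ?_)
    change f _ * h' _ = _
    rw [hh'' _ hη]

/-- Substitute `α = γη` in the convolution integral at `δ = γζ⁻¹`; the two cocycle factors then
match by the cocycle identity. -/
lemma regKernel_conv (lam : HaarSystem 𝒢) (σ : Cocycle 𝒢) (f g : C_c(G, ℂ)) {x γ ζ : G}
    (hγ : 𝒢.s γ = x) (hζ : 𝒢.s ζ = x) :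
    regKernel σ (conv lam σ f g) γ ζ =
      ∫ y, regKernel σ f γ y * regKernel σ g y ζ ∂(lam.src x) := by
  have hγζ : 𝒢.s γ = 𝒢.r (𝒢.inv ζ) := by rw [𝒢.r_inv, hγ, hζ]
  set δ := 𝒢.mul γ (𝒢.inv ζ) with hδ
  have hrδ : 𝒢.r δ = 𝒢.r γ := 𝒢.r_mul _ _ hγζ
  have hx : x ∈ 𝒢.units := by rw [← hγ]; exact 𝒢.r_s γ
  have hm : ContinuousOn (fun α => 𝒢.mul (𝒢.inv α) δ) {α | 𝒢.r α = 𝒢.r γ} :=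
    𝒢.continuousOn_mul.comp (f := fun α => (𝒢.inv α, δ))
      (𝒢.continuous_inv.prodMk continuous_const).continuousOn
      fun α hα => (𝒢.s_inv α).trans (hα.trans hrδ.symm)
  have hh : ContinuousOn (fun α => g (𝒢.mul (𝒢.inv α) δ) *
      (σ.toFun α (𝒢.mul (𝒢.inv α) δ) : ℂ) * (σ.toFun δ ζ : ℂ)) {α | 𝒢.r α = 𝒢.r γ} := by
    refine (((map_continuous g).comp_continuousOn hm).mul (continuous_subtype_val.comp_continuousOn
      (σ.continuousOn.comp (f := fun α => (α, 𝒢.mul (𝒢.inv α) δ))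
        (continuous_id.continuousOn.prodMk hm) fun α hα => ?_))).mul continuousOn_const
    change 𝒢.s α = 𝒢.r _
    rw [𝒢.r_mul _ _ ((𝒢.s_inv α).trans (hα.trans hrδ.symm)), 𝒢.r_inv]
  have key := lam.integral_translate γ f hh
  rw [hγ] at key
  rw [lam.integral_src]
  change (∫ η, f η * g (𝒢.mul (𝒢.inv η) δ) * (σ.toFun η (𝒢.mul (𝒢.inv η) δ) : ℂ)
    ∂(lam.meas (𝒢.r δ))) * (σ.toFun δ ζ : ℂ) = _
  rw [hrδ, ← integral_mul_const]
  simp only [mul_assoc] at key ⊢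
  rw [← key]
  refine integral_congr_ae ((lam.ae_r hx).mono fun η hη => ?_)
  have h1 : 𝒢.s γ = 𝒢.r η := hγ.trans hη.symm
  have h2 : 𝒢.s (𝒢.inv η) = 𝒢.r (𝒢.inv ζ) := by rw [𝒢.s_inv, hη, 𝒢.r_inv, hζ]
  have h3 : 𝒢.s (𝒢.mul γ η) = 𝒢.r (𝒢.inv η) := by rw [𝒢.s_mul _ _ h1, 𝒢.r_inv]
  have e1 : 𝒢.mul (𝒢.inv (𝒢.mul γ η)) δ = 𝒢.mul (𝒢.inv η) (𝒢.inv ζ) := by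
    rw [𝒢.inv_mul _ _ h1, 𝒢.mul_assoc _ _ _ (by rw [𝒢.s_inv, 𝒢.r_inv, h1])
      (by rw [𝒢.s_inv, hrδ]), hδ, 𝒢.inv_mul_cancel _ _ hγζ]
  have e2 : 𝒢.mul (𝒢.mul γ η) (𝒢.mul (𝒢.inv η) (𝒢.inv ζ)) = δ := by
    rw [← 𝒢.mul_assoc _ _ _ h3 h2, 𝒢.mul_inv_cancel _ _ h1]
  have e3 : 𝒢.mul (𝒢.mul (𝒢.inv η) (𝒢.inv ζ)) ζ = 𝒢.inv η := by
    have := 𝒢.mul_inv_cancel _ _ h2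
    rwa [𝒢.inv_inv] at this
  -- The triple `(γη, η⁻¹ζ⁻¹, ζ)` has partial products `δ` and `η⁻¹`, so the identity relates
  -- exactly the factors on the two sides.
  have c := σ.cocycle (𝒢.mul γ η) (𝒢.mul (𝒢.inv η) (𝒢.inv ζ)) ζ
    (by rw [h3, 𝒢.r_mul _ _ h2]) (by rw [𝒢.s_mul _ _ h2, 𝒢.s_inv])
  rw [e2, e3] at c
  have c' := congrArg (fun z : Circle => (z : ℂ)) c
  simp only [Circle.coe_mul] at c'
  simp only [regKernel, 𝒢.inv_inv, e1]
  rw [c']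
  ring

lemma regKernel_invol (σ : Cocycle 𝒢) (f : C_c(G, ℂ)) {x γ ζ : G}
    (hγ : 𝒢.s γ = x) (hζ : 𝒢.s ζ = x) :
    regKernel σ (invol σ f) γ ζ = conj (regKernel σ f ζ γ) := by
  have h1 : 𝒢.s γ = 𝒢.r (𝒢.inv ζ) := by rw [𝒢.r_inv, hγ, hζ]
  have h2 : 𝒢.s ζ = 𝒢.r (𝒢.inv γ) := by rw [𝒢.r_inv, hγ, hζ]
  have e1 : 𝒢.inv (𝒢.mul γ (𝒢.inv ζ)) = 𝒢.mul ζ (𝒢.inv γ) := by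
    rw [𝒢.inv_mul _ _ h1, 𝒢.inv_inv]
  have e2 : 𝒢.mul (𝒢.mul ζ (𝒢.inv γ)) γ = ζ := by
    have := 𝒢.mul_inv_cancel _ _ h2
    rwa [𝒢.inv_inv] at this
  -- With `δ = γζ⁻¹`, the triple `(δ, δ⁻¹, γ)` and normalization give `σ(δ, δ⁻¹) = σ(δ⁻¹, γ) σ(δ,
  -- ζ)`; conjugating, the factor `σ(δ, ζ)` cancels.
  have c := σ.cocycle (𝒢.mul γ (𝒢.inv ζ)) (𝒢.mul ζ (𝒢.inv γ)) γ
    (by rw [𝒢.s_mul _ _ h1, 𝒢.s_inv, 𝒢.r_mul _ _ h2]) (by rw [𝒢.s_mul _ _ h2, 𝒢.s_inv])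
  have e3 : 𝒢.mul (𝒢.mul γ (𝒢.inv ζ)) (𝒢.mul ζ (𝒢.inv γ)) = 𝒢.r γ := by
    rw [← e1, ← 𝒢.r_eq, 𝒢.r_mul _ _ h1]
  rw [e2, e3, σ.map_r, mul_one] at c
  change conj (f _) * conj (σ.toFun _ _ : ℂ) * (σ.toFun _ _ : ℂ) = conj (f _ * (σ.toFun _ _ : ℂ))
  have hz : ∀ z : Circle, conj (z : ℂ) * z = 1 := fun z => by
    rw [← Circle.coe_inv_eq_conj, ← Circle.coe_mul, inv_mul_cancel, Circle.coe_one]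
  rw [e1, c, map_mul, Circle.coe_mul, map_mul, mul_assoc, mul_assoc, hz, mul_one]

/-- Since `λ_u` is concentrated on the source fibre of `u`, kernels need comparing only there, which
is where all products involved are composable. -/
lemma leftRegular_eq_of_regKernel (lam : HaarSystem 𝒢) (σ : Cocycle 𝒢) (x : 𝒢.units)
    (f : C_c(G, ℂ)) {T : Lp ℂ 2 (lam.src x) →L[ℂ] Lp ℂ 2 (lam.src x)} {k : G → G → ℂ}
    (hT : HasKernel T k) (h : ∀ γ ζ, 𝒢.s γ = x → 𝒢.s ζ = x → regKernel σ f γ ζ = k γ ζ) :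
    leftRegular lam σ x f = T :=
  (hasKernel_leftRegular lam σ x f).congr hT ((lam.ae_s x.2).mono fun γ hγ =>
    (lam.ae_s x.2).mono fun ζ hζ => h γ ζ hγ hζ)

lemma leftRegular_conv (lam : HaarSystem 𝒢) (σ : Cocycle 𝒢) (x : 𝒢.units) (f g : C_c(G, ℂ)) :
    leftRegular lam σ x (conv lam σ f g) = leftRegular lam σ x f * leftRegular lam σ x g := by
  obtain ⟨C, hC⟩ := exists_isSchurKernel lam σ f
  obtain ⟨C', hC'⟩ := exists_isSchurKernel lam σ g
  exact leftRegular_eq_of_regKernel lam σ x _ ((hasKernel_leftRegular lam σ x f).mul (hC x x.2)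
    (hasKernel_leftRegular lam σ x g) (hC' x x.2)) fun γ ζ hγ hζ =>
      regKernel_conv lam σ f g hγ hζ

lemma leftRegular_invol (lam : HaarSystem 𝒢) (σ : Cocycle 𝒢) (x : 𝒢.units) (f : C_c(G, ℂ)) :
    leftRegular lam σ x (invol σ f) = star (leftRegular lam σ x f) := by
  obtain ⟨C, hC⟩ := exists_isSchurKernel lam σ f
  exact leftRegular_eq_of_regKernel lam σ x _ ((hasKernel_leftRegular lam σ x f).star (hC x x.2))
    fun γ ζ hγ hζ => regKernel_invol σ f hγ hζ

lemma leftRegular_add (lam : HaarSystem 𝒢) (σ : Cocycle 𝒢) (x : 𝒢.units) (f g : C_c(G, ℂ)) :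
    leftRegular lam σ x (f + g) = leftRegular lam σ x f + leftRegular lam σ x g := by
  obtain ⟨C, hC⟩ := exists_isSchurKernel lam σ f
  obtain ⟨C', hC'⟩ := exists_isSchurKernel lam σ g
  exact leftRegular_eq_of_regKernel lam σ x _ ((hasKernel_leftRegular lam σ x f).add (hC x x.2)
    (hasKernel_leftRegular lam σ x g) (hC' x x.2)) fun _ _ _ _ => add_mul _ _ _

lemma leftRegular_smul (lam : HaarSystem 𝒢) (σ : Cocycle 𝒢) (x : 𝒢.units) (c : ℂ)
    (f : C_c(G, ℂ)) : leftRegular lam σ x (c • f) = c • leftRegular lam σ x f :=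
  leftRegular_eq_of_regKernel lam σ x _ ((hasKernel_leftRegular lam σ x f).smul c)
    fun _ _ _ _ => mul_assoc _ _ _

/-- The constant depends on `K` alone. Uniformity in `σ` is essential later, when the cocycle `ω^n`
varies with `n`; for a fixed cocycle the bound gives the continuity required of a representation. -/
lemma exists_norm_leftRegular_le (lam : HaarSystem 𝒢) {K : Set G} (hK : IsCompact K) :
    ∃ C : ℝ≥0, ∀ (σ : Cocycle 𝒢) (f : C_c(G, ℂ)) (δ : ℝ), 0 ≤ δ → tsupport f ⊆ K →
      (∀ γ, ‖f γ‖ ≤ δ) → ∀ x : 𝒢.units, ‖leftRegular lam σ x f‖ ≤ δ * C := by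
  obtain ⟨C, hC⟩ := exists_isSchurKernel_of_subset lam hK
  refine ⟨C, fun σ f δ hδ hf hfδ x => ?_⟩
  lift δ to ℝ≥0 using hδ
  exact_mod_cast (hasKernel_leftRegular lam σ x f).norm_le (hC σ f δ hf hfδ x x.2)

/-- The left regular representation at `x` as a representation of `C_c(G, σ)`. -/
def regRep (lam : HaarSystem 𝒢) (σ : Cocycle 𝒢) (x : 𝒢.units) : Rep lam σ where
  H := Lp ℂ 2 (lam.src x)
  toFun :=
    { toFun := leftRegular lam σ x
      map_add' := leftRegular_add lam σ x
      map_smul' := leftRegular_smul lam σ x }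
  map_conv := leftRegular_conv lam σ x
  map_invol := leftRegular_invol lam σ x
  continuous K hK ξ η ε hε := by
    obtain ⟨C, hC⟩ := exists_norm_leftRegular_le lam hK
    have hD : 0 < C * ‖ξ‖ * ‖η‖ + 1 := by positivity
    refine ⟨ε / (C * ‖ξ‖ * ‖η‖ + 1), by positivity, fun f hf hfδ => ?_⟩
    calc ‖⟪η, leftRegular lam σ x f ξ⟫_ℂ‖ ≤ ‖η‖ * ‖leftRegular lam σ x f ξ‖ := norm_inner_le_norm _ _
      _ ≤ ‖η‖ * (ε / (C * ‖ξ‖ * ‖η‖ + 1) * C * ‖ξ‖) := by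
        gcongr
        exact ContinuousLinearMap.le_of_opNorm_le _ (hC σ f _ (by positivity) hf hfδ x) _
      _ = ε * ((C * ‖ξ‖ * ‖η‖) / (C * ‖ξ‖ * ‖η‖ + 1)) := by ring
      _ ≤ ε * 1 := by
        gcongr
        exact (div_le_one hD).2 (by linarith)
      _ = ε := mul_one ε

lemma isStarSubalgebra_universalImage (lam : HaarSystem 𝒢) (σ : Cocycle 𝒢) :
    IsStarSubalgebra (universalImage lam σ) where
  zero := ⟨0, fun ρ => (map_zero ρ.toFun).symm⟩
  add := by
    rintro a ⟨f, hf⟩ b ⟨g, hg⟩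
    exact ⟨f + g, fun ρ => by rw [map_add, ← hf, ← hg]; rfl⟩
  mul := by
    rintro a ⟨f, hf⟩ b ⟨g, hg⟩
    exact ⟨conv lam σ f g, fun ρ => by rw [ρ.map_conv, ← hf, ← hg]; rfl⟩
  smul := by
    rintro c a ⟨f, hf⟩
    exact ⟨c • f, fun ρ => by rw [map_smul, ← hf]; rfl⟩
  star := by
    rintro a ⟨f, hf⟩
    exact ⟨invol σ f, fun ρ => by rw [ρ.map_invol, ← hf]; rfl⟩

lemma regularFamily_conv (lam : HaarSystem 𝒢) (σ : Cocycle 𝒢) (f g : C_c(G, ℂ)) :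
    regularFamily lam σ (conv lam σ f g) = regularFamily lam σ f * regularFamily lam σ g :=
  lp.ext (funext fun x => leftRegular_conv lam σ x f g)

lemma regularFamily_invol (lam : HaarSystem 𝒢) (σ : Cocycle 𝒢) (f : C_c(G, ℂ)) :
    regularFamily lam σ (invol σ f) = star (regularFamily lam σ f) :=
  lp.ext (funext fun x => leftRegular_invol lam σ x f)

/-- `regularFamily` as a linear map. -/
def regularFamilyₗ (lam : HaarSystem 𝒢) (σ : Cocycle 𝒢) :
    C_c(G, ℂ) →ₗ[ℂ] lp (fun x : 𝒢.units => Lp ℂ 2 (lam.src x) →L[ℂ] Lp ℂ 2 (lam.src x)) ∞ where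
  toFun := regularFamily lam σ
  map_add' f g := lp.ext (funext fun x => leftRegular_add lam σ x f g)
  map_smul' c f := lp.ext (funext fun x => leftRegular_smul lam σ x c f)

lemma isStarSubalgebra_regularFamily (lam : HaarSystem 𝒢) (σ : Cocycle 𝒢) :
    IsStarSubalgebra (Set.range (regularFamily lam σ)) where
  zero := ⟨0, map_zero (regularFamilyₗ lam σ)⟩
  add := by
    rintro _ ⟨f, rfl⟩ _ ⟨g, rfl⟩
    exact ⟨f + g, map_add (regularFamilyₗ lam σ) f g⟩
  mul := by
    rintro _ ⟨f, rfl⟩ _ ⟨g, rfl⟩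
    exact ⟨conv lam σ f g, regularFamily_conv lam σ f g⟩
  smul := by
    rintro c _ ⟨f, rfl⟩
    exact ⟨c • f, map_smul (regularFamilyₗ lam σ) c f⟩
  star := by
    rintro _ ⟨f, rfl⟩
    exact ⟨invol σ f, regularFamily_invol lam σ f⟩

lemma FullAlg.induction {lam : HaarSystem 𝒢} {σ : Cocycle 𝒢} {p : FullAlg lam σ → Prop}
    (hp : IsClosed {a | p a}) (h : ∀ f a, FullAlg.IsImage f a → p a) (a : FullAlg lam σ) : p a :=
  ClosedAlg.induction (isStarSubalgebra_universalImage lam σ) hp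
    (fun _ ha => Exists.elim ha fun f hf => h f _ hf) a

lemma ReducedAlg.induction {lam : HaarSystem 𝒢} {σ : Cocycle 𝒢} {p : ReducedAlg lam σ → Prop}
    (hp : IsClosed {a | p a}) (h : ∀ f, p (ReducedAlg.of lam σ f)) (a : ReducedAlg lam σ) : p a :=
  ClosedAlg.induction (isStarSubalgebra_regularFamily lam σ) hp
    (fun b hb => Exists.elim hb fun f hf =>
      (Subtype.ext hf : ReducedAlg.of lam σ f = b) ▸ h f) a

/-- A `*`-homomorphism out of `C*(G, σ)` is determined on the image of `C_c(G, σ)`. -/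
lemma FullAlg.hom_ext {lam : HaarSystem 𝒢} {σ : Cocycle 𝒢} {B : Type*} [NonUnitalCStarAlgebra B]
    {Φ Ψ : FullAlg lam σ →⋆ₙₐ[ℂ] B} (h : ∀ f a, FullAlg.IsImage f a → Φ a = Ψ a) : Φ = Ψ :=
  NonUnitalStarAlgHom.ext fun a => FullAlg.induction
    (isClosed_eq (starHom_continuous Φ) (starHom_continuous Ψ)) h a

/-- The restriction of an element of the `ℓ^∞`-product over all representations to the left regular
representations. -/
def restrictRegular (lam : HaarSystem 𝒢) (σ : Cocycle 𝒢) : RepProd lam σ →L[ℂ]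
    lp (fun x : 𝒢.units => Lp ℂ 2 (lam.src x) →L[ℂ] Lp ℂ 2 (lam.src x)) ∞ :=
  lpLift (fun x =>
    { toFun := fun a => a (regRep lam σ x)
      map_add' := fun _ _ => rfl
      map_smul' := fun _ _ => rfl }) fun x a => norm_lpEval_le (regRep lam σ x) a

lemma restrictRegular_eq {lam : HaarSystem 𝒢} {σ : Cocycle 𝒢} {f : C_c(G, ℂ)} {a : RepProd lam σ}
    (h : ∀ ρ : Rep lam σ, a ρ = ρ.toFun f) : restrictRegular lam σ a = regularFamily lam σ f :=
  lp.ext (funext fun x => h (regRep lam σ x))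

lemma restrictRegular_mul (lam : HaarSystem 𝒢) (σ : Cocycle 𝒢) (a b : RepProd lam σ) :
    restrictRegular lam σ (a * b) = restrictRegular lam σ a * restrictRegular lam σ b :=
  lp.ext (funext fun _ => rfl)

lemma restrictRegular_star (lam : HaarSystem 𝒢) (σ : Cocycle 𝒢) (a : RepProd lam σ) :
    restrictRegular lam σ (star a) = star (restrictRegular lam σ a) :=
  lp.ext (funext fun _ => rfl)

/-- The regular representations occur among the factors of the universal product, so the map is the
restriction of a family to those coordinates. -/
theorem existsUnique_isReductionMap (lam : HaarSystem 𝒢) (σ : Cocycle 𝒢) :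
    ∃! q : FullAlg lam σ →⋆ₙₐ[ℂ] ReducedAlg lam σ, IsReductionMap q := by
  have h : ∃ q : FullAlg lam σ →⋆ₙₐ[ℂ] ReducedAlg lam σ, ∀ a, (q a).1 = restrictRegular lam σ a.1 :=
    exists_starHom_closedAlg (isStarSubalgebra_universalImage lam σ)
      (isStarSubalgebra_regularFamily lam σ) (restrictRegular lam σ)
      (fun a _ b _ => restrictRegular_mul lam σ a b)
      (fun a _ => restrictRegular_star lam σ a) fun a ha =>
        Exists.elim ha fun f hf => ⟨f, (restrictRegular_eq hf).symm⟩
  obtain ⟨q, hq⟩ := h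
  have hq' : IsReductionMap q := fun f a ha => Subtype.ext ((hq a).trans (restrictRegular_eq ha))
  exact ⟨q, hq', fun q' h' => FullAlg.hom_ext fun f a ha => (h' f a ha).trans (hq' f a ha).symm⟩

end RegularKernel

/-! ### Translation and inversion against characters of the circle -/

section CircleHaar

instance : circleHaar.IsInvInvariant := by unfold circleHaar; infer_instance

lemma coe_zpow_mul (z w : Circle) (n : ℤ) :
    (((z * w) ^ n : Circle) : ℂ) = ((z ^ n : Circle) : ℂ) * ((w ^ n : Circle) : ℂ) := by
  rw [mul_zpow, Circle.coe_mul]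

lemma continuous_coe_zpow (n : ℤ) : Continuous fun t : Circle => ((t ^ n : Circle) : ℂ) :=
  continuous_subtype_val.comp (continuous_zpow n)

/-- Translation acts on the `n`-th Fourier coefficient by a scalar. This is the source of the powers
of `ω`, of the orthogonality of characters and of the Riemann-Lebesgue estimate. -/
lemma integral_mul_left_zpow (g : Circle → ℂ) (a : Circle) (n : ℤ) :
    ∫ t, g (a * t) * ((t ^ n : Circle) : ℂ) ∂circleHaar =
      (((a ^ n)⁻¹ : Circle) : ℂ) * ∫ t, g t * ((t ^ n : Circle) : ℂ) ∂circleHaar := by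
  rw [← integral_mul_left_eq_self (fun t => g t * ((t ^ n : Circle) : ℂ)) a,
    ← integral_const_mul]
  refine integral_congr_ae (ae_of_all _ fun t => ?_)
  have h : ((a ^ n)⁻¹ : Circle) * (a ^ n : Circle) = 1 := inv_mul_cancel _
  have h' := congrArg (fun z : Circle => (z : ℂ)) h
  simp only [Circle.coe_mul, Circle.coe_one] at h'
  simp only [coe_zpow_mul]
  linear_combination (-(g (a * t) * ((t ^ n : Circle) : ℂ))) * h'

lemma integral_mul_inv_zpow (g : Circle → ℂ) (a : Circle) (n : ℤ) :
    ∫ s, g (a * s⁻¹) * (((s ^ n)⁻¹ : Circle) : ℂ) ∂circleHaar =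
      (((a ^ n)⁻¹ : Circle) : ℂ) * ∫ t, g t * ((t ^ n : Circle) : ℂ) ∂circleHaar := by
  rw [← integral_mul_left_zpow, ← integral_inv_eq_self _ circleHaar]
  simp only [inv_inv, inv_zpow]

end CircleHaar

/-! ### `Υ_n` as a `*`-homomorphism, on `C_c` and on the full algebras -/

section Upsilon

variable {G : Type u} [TopologicalSpace G] [LocallyCompactSpace G] [SecondCountableTopology G]
  [T2Space G]

lemma upsilonFun_apply (n : ℤ) (F : C_c(Circle × G, ℂ)) (γ : G) :
    upsilonFun n F γ = ∫ t, F (t, γ) * ((t ^ n : Circle) : ℂ) ∂circleHaar := rfl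

lemma integrable_slice (F : C_c(Circle × G, ℂ)) (n : ℤ) (γ : G) :
    Integrable (fun t => F (t, γ) * ((t ^ n : Circle) : ℂ)) circleHaar := by
  have h : Continuous fun t : Circle => F (t, γ) * ((t ^ n : Circle) : ℂ) :=
    ((map_continuous F).comp (by fun_prop : Continuous fun t : Circle => (t, γ))).mul
      (continuous_coe_zpow n)
  exact h.integrable_of_hasCompactSupport (HasCompactSupport.of_compactSpace _)

/-- `upsilonFun` as a linear map. -/
def upsilonₗ (G : Type u) [TopologicalSpace G] [LocallyCompactSpace G] [SecondCountableTopology G]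
    [T2Space G] (n : ℤ) : C_c(Circle × G, ℂ) →ₗ[ℂ] C_c(G, ℂ) where
  toFun := upsilonFun n
  map_add' F F' := by
    ext γ
    rw [CompactlySupportedContinuousMap.add_apply, upsilonFun_apply, upsilonFun_apply,
      upsilonFun_apply, ← integral_add (integrable_slice F n γ) (integrable_slice F' n γ)]
    simp only [CompactlySupportedContinuousMap.add_apply, add_mul]
  map_smul' c F := by
    ext γ
    rw [CompactlySupportedContinuousMap.smul_apply, upsilonFun_apply, RingHom.id_apply,
      upsilonFun_apply, smul_eq_mul, ← integral_const_mul]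
    simp only [CompactlySupportedContinuousMap.smul_apply, smul_eq_mul, mul_assoc]

lemma norm_upsilonFun_le (n : ℤ) (F : C_c(Circle × G, ℂ)) {δ : ℝ} (h : ∀ p, ‖F p‖ ≤ δ) (γ : G) :
    ‖upsilonFun n F γ‖ ≤ δ := by
  rw [upsilonFun_apply]
  refine (norm_integral_le_of_norm_le_const (ae_of_all _ fun t => ?_)).trans_eq
    (by rw [probReal_univ, mul_one] : δ * circleHaar.real univ = δ)
  rw [norm_mul, Circle.norm_coe, mul_one]
  exact h _

lemma tsupport_upsilonFun_subset (n : ℤ) (F : C_c(Circle × G, ℂ)) :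
    tsupport (upsilonFun n F) ⊆ Prod.snd '' tsupport F := by
  refine closure_minimal (fun γ hγ => ?_)
    (F.hasCompactSupport.isCompact.image continuous_snd).isClosed
  by_contra h
  refine hγ ?_
  rw [upsilonFun_apply]
  refine integral_eq_zero_of_ae (ae_of_all _ fun t => ?_)
  have : F (t, γ) = 0 := by
    by_contra h0
    exact h ⟨(t, γ), subset_tsupport _ h0, rfl⟩
  simp [this]

variable {𝒢 : TopGroupoid G}

lemma Cocycle.zpow_toFun (ω : Cocycle 𝒢) (n : ℤ) (γ η : G) :
    (ω ^ n).toFun γ η = ω.toFun γ η ^ n := rfl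

lemma upsilonFun_invol (ω : Cocycle 𝒢) (n : ℤ) (F : C_c(Circle × G, ℂ)) :
    upsilonFun n (invol (1 : Cocycle (extension 𝒢 ω)) F) = invol (ω ^ n) (upsilonFun n F) := by
  ext γ
  set c := ω.toFun γ (𝒢.inv γ) with hc
  have h1 : invol (ω ^ n) (upsilonFun n F) γ =
      conj (∫ t, F (t, 𝒢.inv γ) * ((t ^ n : Circle) : ℂ) ∂circleHaar) * conj ((c ^ n : Circle) : ℂ) :=
    rfl
  have h2 : ∀ t, invol (1 : Cocycle (extension 𝒢 ω)) F (t, γ) = conj (F (c⁻¹ * t⁻¹, 𝒢.inv γ)) := by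
    intro t
    change conj (F (t⁻¹ * c⁻¹, 𝒢.inv γ)) * conj ((1 : Circle) : ℂ) = _
    rw [Circle.coe_one, map_one, mul_one, mul_comm]
  -- Inversion in the extension sends `t` to `c⁻¹ t⁻¹` with `c = ω(γ, γ⁻¹)`; undoing the shift by
  -- `c⁻¹` produces the factor `c ^ n` of the twisted involution.
  have h3 := integral_mul_inv_zpow (fun s => F (s, 𝒢.inv γ)) c⁻¹ n
  rw [h1, upsilonFun_apply, mul_comm, ← map_mul]
  rw [inv_zpow, inv_inv] at h3
  rw [← h3, ← integral_conj]
  refine integral_congr_ae (ae_of_all _ fun t => ?_)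
  simp only [h2, map_mul, Circle.coe_inv_eq_conj, Complex.conj_conj]

variable [MeasurableSpace G] [BorelSpace G]

/-- The cocycle identity for `(η, η⁻¹, γ)` merges the factors from inversion and multiplication into
`ω(η, η⁻¹γ)⁻¹`, the value that twisted convolution uses. -/
lemma extension_inv_mul_fst (ω : Cocycle 𝒢) (s t : Circle) {η γ : G} (h : 𝒢.r η = 𝒢.r γ) :
    (extension 𝒢 ω).mul ((extension 𝒢 ω).inv (s, η)) (t, γ) =
      (s⁻¹ * (ω.toFun η (𝒢.mul (𝒢.inv η) γ))⁻¹ * t, 𝒢.mul (𝒢.inv η) γ) := by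
  refine Prod.ext ?_ rfl
  change s⁻¹ * (ω.toFun η (𝒢.inv η))⁻¹ * t * ω.toFun (𝒢.inv η) γ = _
  have c := ω.cocycle η (𝒢.inv η) γ (𝒢.r_inv η).symm ((𝒢.s_inv η).trans h)
  rw [← 𝒢.r_eq, h, ω.map_r, mul_one] at c
  rw [c]
  simp only [mul_inv]
  have : ω.toFun (𝒢.inv η) γ * (ω.toFun (𝒢.inv η) γ)⁻¹ = 1 := mul_inv_cancel _
  calc _ = s⁻¹ * (ω.toFun η (𝒢.mul (𝒢.inv η) γ))⁻¹ * t *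
        (ω.toFun (𝒢.inv η) γ * (ω.toFun (𝒢.inv η) γ)⁻¹) := by
          simp only [mul_assoc, mul_comm, mul_left_comm]
    _ = _ := by rw [this, mul_one]

/-- Exchange the integrals so that the outer variable `t` comes first. It enters only through `F'`,
shifted by `s⁻¹ ω(η, η⁻¹γ)⁻¹`, so it yields `Υ_n(F')` times `sⁿ ω(η, η⁻¹γ)ⁿ`; integrating `F`
against `sⁿ` then gives `Υ_n(F)`. -/
lemma upsilonFun_conv (lam : HaarSystem 𝒢) (ω : Cocycle 𝒢) (n : ℤ) (F F' : C_c(Circle × G, ℂ)) :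
    upsilonFun n (conv (lam.extension ω) 1 F F') =
      conv lam (ω ^ n) (upsilonFun n F) (upsilonFun n F') := by
  ext γ
  have := lam.isFiniteMeasureOnCompacts (𝒢.r_r γ)
  set μ := lam.meas (𝒢.r γ) with hμ
  have hr : ∀ᵐ η ∂μ, 𝒢.r η = 𝒢.r γ := lam.ae_r (𝒢.r_r γ)
  have hr' : ∀ᵐ y ∂(circleHaar.prod μ), 𝒢.r y.2 = 𝒢.r γ :=
    Measure.quasiMeasurePreserving_snd.ae hr
  have hr'' : ∀ᵐ p ∂(circleHaar.prod (circleHaar.prod μ)), p ∈ {p : Circle × Circle × G | 𝒢.r p.2.2 = 𝒢.r γ} :=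
    Measure.quasiMeasurePreserving_snd.ae hr'
  let E := extension 𝒢 ω
  let J : Circle → Circle × G → ℂ := fun t y =>
    (((t ^ n : Circle) : ℂ) * F y) * F' (E.mul (E.inv y) (t, γ))
  have hJ : Integrable (Function.uncurry J) (circleHaar.prod (circleHaar.prod μ)) := by
    have h1 : Integrable (fun t : Circle => ((t ^ n : Circle) : ℂ)) circleHaar :=
      (continuous_coe_zpow n).integrable_of_hasCompactSupport (HasCompactSupport.of_compactSpace _)
    have h2 := h1.mul_prod (integrable_cc F (circleHaar.prod μ))
    obtain ⟨B, hB⟩ := F'.hasCompactSupport.exists_bound_of_continuous F'.continuous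
    refine h2.mul_bdd (c := B) ?_ (ae_of_all _ fun p => hB _)
    -- The product in the argument of `F'` is continuous only where it is composable, but that set
    -- is closed and of full measure, which suffices for measurability.
    have hcl : IsClosed {p : Circle × Circle × G | 𝒢.r p.2.2 = 𝒢.r γ} :=
      isClosed_eq (𝒢.continuous_r.comp (by fun_prop)) continuous_const
    rw [← Measure.restrict_eq_self_of_ae_mem hr'']
    refine ContinuousOn.aestronglyMeasurable ?_ hcl.measurableSet
    refine (map_continuous F').comp_continuousOn ?_
    refine E.continuousOn_mul.comp (f := fun p : Circle × Circle × G => (E.inv p.2, (p.1, γ)))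
      ((E.continuous_inv.comp continuous_snd).prodMk
        (continuous_fst.prodMk continuous_const)).continuousOn ?_
    intro p hp
    refine (E.s_inv p.2).trans (Prod.ext rfl hp)
  have e1 : upsilonFun n (conv (lam.extension ω) 1 F F') γ =
      ∫ t, ∫ y, J t y ∂(circleHaar.prod μ) ∂circleHaar := by
    rw [upsilonFun_apply]
    refine integral_congr_ae (ae_of_all _ fun t => ?_)
    change (∫ y, F y * F' (E.mul (E.inv y) (t, γ)) * ((1 : Circle) : ℂ) ∂(circleHaar.prod μ)) * _ = _
    rw [← integral_mul_const]
    refine integral_congr_ae (ae_of_all _ fun y => ?_)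
    simp only [J, Circle.coe_one]
    ring
  have e2 : (fun y => ∫ t, J t y ∂circleHaar) =ᵐ[circleHaar.prod μ] fun y =>
      F y * ((y.1 ^ n : Circle) : ℂ) * (((ω.toFun y.2 (𝒢.mul (𝒢.inv y.2) γ)) ^ n : Circle) : ℂ) *
        upsilonFun n F' (𝒢.mul (𝒢.inv y.2) γ) := by
    filter_upwards [hr'] with y hy
    have h := integral_mul_left_zpow (fun t => F' (t, 𝒢.mul (𝒢.inv y.2) γ))
      (y.1⁻¹ * (ω.toFun y.2 (𝒢.mul (𝒢.inv y.2) γ))⁻¹) n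
    rw [← mul_inv, inv_zpow, inv_inv, coe_zpow_mul, ← upsilonFun_apply] at h
    rw [mul_assoc (F y), mul_assoc (F y), ← h, ← integral_const_mul]
    refine integral_congr_ae (ae_of_all _ fun t => ?_)
    have : E.mul (E.inv y) (t, γ) = _ := extension_inv_mul_fst ω y.1 t hy
    simp only [J, this, mul_inv]
    ring
  have e3 := hJ.integral_prod_right.congr e2
  rw [e1, integral_integral_swap hJ, integral_congr_ae e2, integral_prod_symm _ e3]
  change _ = ∫ η, upsilonFun n F η * upsilonFun n F' (𝒢.mul (𝒢.inv η) γ) *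
    (((ω.toFun η (𝒢.mul (𝒢.inv η) γ)) ^ n : Circle) : ℂ) ∂μ
  refine integral_congr_ae (ae_of_all _ fun η => ?_)
  simp only
  rw [integral_mul_const, integral_mul_const, ← upsilonFun_apply]
  ring

/-- The pull-back of a representation of `C_c(G, ω^n)` along `Υ_n`. -/
def Rep.pullback {lam : HaarSystem 𝒢} {ω : Cocycle 𝒢} {n : ℤ} (ρ : Rep lam (ω ^ n)) :
    Rep (lam.extension ω) 1 where
  H := ρ.H
  toFun := ρ.toFun ∘ₗ upsilonₗ G n
  map_conv F F' := by
    change ρ.toFun (upsilonFun n _) = ρ.toFun (upsilonFun n F) * ρ.toFun (upsilonFun n F')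
    rw [upsilonFun_conv, ρ.map_conv]
  map_invol F := by
    change ρ.toFun (upsilonFun n _) = star (ρ.toFun (upsilonFun n F))
    rw [upsilonFun_invol, ρ.map_invol]
  continuous K hK ξ η ε hε := by
    obtain ⟨δ, hδ, h⟩ := ρ.continuous (Prod.snd '' K) (hK.image continuous_snd) ξ η ε hε
    exact ⟨δ, hδ, fun F hF hFδ => h (upsilonFun n F)
      ((tsupport_upsilonFun_subset n F).trans (image_mono hF)) (norm_upsilonFun_le n F hFδ)⟩

/-- The pull-back along `Υ_n` on the products over all representations. -/
def pullbackProd (lam : HaarSystem 𝒢) (ω : Cocycle 𝒢) (n : ℤ) :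
    RepProd (lam.extension ω) 1 →L[ℂ] RepProd lam (ω ^ n) :=
  lpLift (fun ρ =>
    { toFun := fun a => a (Rep.pullback ρ)
      map_add' := fun _ _ => rfl
      map_smul' := fun _ _ => rfl }) fun ρ a => norm_lpEval_le (Rep.pullback ρ) a

lemma pullbackProd_mul (lam : HaarSystem 𝒢) (ω : Cocycle 𝒢) (n : ℤ)
    (a b : RepProd (lam.extension ω) 1) :
    pullbackProd lam ω n (a * b) = pullbackProd lam ω n a * pullbackProd lam ω n b :=
  lp.ext (funext fun _ => rfl)

lemma pullbackProd_star (lam : HaarSystem 𝒢) (ω : Cocycle 𝒢) (n : ℤ)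
    (a : RepProd (lam.extension ω) 1) :
    pullbackProd lam ω n (star a) = star (pullbackProd lam ω n a) :=
  lp.ext (funext fun _ => rfl)

/-- The coordinate of the image at `ρ` is the coordinate of the original family at the pull-back of
`ρ`, so the map is contractive without any estimate. -/
theorem existsUnique_isUpsilon (lam : HaarSystem 𝒢) (ω : Cocycle 𝒢) (n : ℤ) :
    ∃! U : FullAlg (lam.extension ω) 1 →⋆ₙₐ[ℂ] FullAlg lam (ω ^ n), IsUpsilon n U := by
  have h : ∃ U : FullAlg (lam.extension ω) 1 →⋆ₙₐ[ℂ] FullAlg lam (ω ^ n),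
      ∀ a, (U a).1 = pullbackProd lam ω n a.1 :=
    exists_starHom_closedAlg (isStarSubalgebra_universalImage _ _)
      (isStarSubalgebra_universalImage _ _) (pullbackProd lam ω n)
      (fun a _ b _ => pullbackProd_mul lam ω n a b)
      (fun a _ => pullbackProd_star lam ω n a) fun a ha =>
        Exists.elim ha fun F hF => ⟨upsilonFun n F, fun ρ => hF (Rep.pullback ρ)⟩
  obtain ⟨U, hU⟩ := h
  have hU' : IsUpsilon n U := fun F a ha ρ => by
    rw [hU]; exact ha (Rep.pullback ρ)
  exact ⟨U, hU', fun U' h' => FullAlg.hom_ext fun F a ha => Subtype.ext (lp.ext (funext fun ρ =>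
    (h' F a ha ρ).trans (hU' F a ha ρ).symm))⟩

end Upsilon

/-! ### Recognizing a `c₀`-direct sum -/

section DirectSum

variable {ι : Type*} {A : Type*} [NonUnitalCStarAlgebra A] {B : ι → Type*}
  [∀ i, NonUnitalCStarAlgebra (B i)]

/-- The `*`-homomorphism into the `ℓ^∞`-product given by a family of `*`-homomorphisms. -/
def starHomProd (Ω : ∀ i, A →⋆ₙₐ[ℂ] B i) : A →⋆ₙₐ[ℂ] lp B ∞ where
  toFun a := ⟨fun i => Ω i a, memℓp_infty ⟨‖a‖, by
    rintro _ ⟨i, rfl⟩; exact NonUnitalStarAlgHom.norm_apply_le (Ω i) a⟩⟩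
  map_smul' c a := lp.ext (funext fun i => map_smul (Ω i) c a)
  map_zero' := lp.ext (funext fun i => map_zero (Ω i))
  map_add' a b := lp.ext (funext fun i => map_add (Ω i) a b)
  map_mul' a b := lp.ext (funext fun i => map_mul (Ω i) a b)
  map_star' a := lp.ext (funext fun i => map_star (Ω i) a)

lemma starHomProd_apply (Ω : ∀ i, A →⋆ₙₐ[ℂ] B i) (a : A) (i : ι) :
    starHomProd Ω a i = Ω i a := rfl

/-- A jointly injective family of `*`-homomorphisms that vanishes at infinity on a dense set and
whose joint range contains dense parts of the summands gives an isomorphism onto the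
`c₀`-direct sum. -/
theorem exists_starAlgEquiv_czeroSum (Ω : ∀ i, A →⋆ₙₐ[ℂ] B i)
    (hinj : ∀ a, (∀ i, Ω i a = 0) → a = 0) {D : Set A} (hD : Dense D)
    (hc : ∀ a ∈ D, Tendsto (fun i => ‖Ω i a‖) cofinite (𝓝 0)) {E : ∀ i, Set (B i)}
    (hE : ∀ i, Dense (E i)) (hs : ∀ i, ∀ b ∈ E i, ∃ a, Ω i a = b ∧ ∀ j, j ≠ i → Ω j a = 0) :
    ∃ Φ : A ≃⋆ₐ[ℂ] czeroSum B, ∀ a i, (Φ a).1 i = Ω i a := by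
  classical
  let Ψ := starHomProd Ω
  have hΨ : Function.Injective Ψ := by
    refine (injective_iff_map_eq_zero Ψ).2 fun a ha => hinj a fun i => ?_
    rw [← starHomProd_apply]
    change (Ψ a) i = 0
    rw [ha]; rfl
  -- An injective `*`-homomorphism is isometric. Hence the range is closed, and it is enough to
  -- produce dense parts of the summands.
  have hiso : Isometry Ψ := NonUnitalStarAlgHom.isometry Ψ hΨ
  have hmem : ∀ a, Ψ a ∈ czeroSum B := by
    have hcl : IsClosed {a | Ψ a ∈ czeroSum B} := isClosed_czeroSum.preimage hiso.continuous
    intro a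
    exact hcl.closure_subset_iff.2 (fun a ha => hc a ha) (hD a)
  have hcr : IsClosed (range Ψ) := hiso.isClosedEmbedding.isClosed_range
  have hsingle : ∀ i (b : B i), lp.single ∞ i b ∈ range Ψ := by
    intro i b
    have hcl : IsClosed {b : B i | lp.single ∞ i b ∈ range Ψ} :=
      hcr.preimage (lp.isometry_single i).continuous
    refine hcl.closure_subset_iff.2 (fun b hb => ?_) (hE i b)
    obtain ⟨a, ha, ha'⟩ := hs i b hb
    refine ⟨a, lp.ext (funext fun j => ?_)⟩
    rw [starHomProd_apply]
    by_cases hj : j = i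
    · subst hj
      rw [ha, lp.single_apply_self]
    · rw [ha' j hj, lp.single_apply_ne ∞ i b hj]
  have hsurj : ∀ b ∈ czeroSum B, b ∈ range Ψ := czeroSum_subset_of_closed hcr ⟨0, map_zero Ψ⟩
    (by rintro _ ⟨a, rfl⟩ _ ⟨b, rfl⟩; exact ⟨a + b, map_add Ψ a b⟩) hsingle
  refine ⟨StarAlgEquiv.ofBijective (NonUnitalStarAlgHom.codRestrict Ψ (czeroSum B) hmem)
    ⟨fun a b h => hΨ (congrArg Subtype.val h), fun b => ?_⟩, fun a i => rfl⟩
  obtain ⟨a, ha⟩ := hsurj b b.2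
  exact ⟨a, Subtype.ext ha⟩

end DirectSum

/-! ### Fourier analysis on the circle -/

section Circle

/-- An `L²` function on the circle whose Fourier coefficients vanish is zero. -/
lemma ae_eq_zero_of_fourier {g : Circle → ℂ} (hg : MemLp g 2 circleHaar)
    (h : ∀ n : ℤ, ∫ t, ((t ^ n : Circle) : ℂ) * conj (g t) ∂circleHaar = 0) :
    g =ᵐ[circleHaar] 0 := by
  have : Fact (0 < (1 : ℝ)) := ⟨one_pos⟩
  -- Only the uniform density of trigonometric polynomials is transported along `e`; the `L²` space
  -- is that of `circleHaar` throughout, so the two Haar measures need not be compared.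
  let e : AddCircle (1 : ℝ) ≃ₜ Circle := AddCircle.homeomorphCircle one_ne_zero
  let P : C(AddCircle (1 : ℝ), ℂ) →L[ℂ] C(Circle, ℂ) :=
    { (ContinuousMap.compRightAlgHom ℂ ℂ (e.symm : C(Circle, AddCircle (1 : ℝ)))).toLinearMap with
      cont := ContinuousMap.continuous_precomp (e.symm : C(Circle, AddCircle (1 : ℝ))) }
  let Q : C(Circle, ℂ) →L[ℂ] Lp ℂ 2 circleHaar := ContinuousMap.toLp 2 circleHaar ℂ
  let L : C(AddCircle (1 : ℝ), ℂ) →L[ℂ] ℂ := (innerSL ℂ (hg.toLp g)) ∘L Q ∘L P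
  have hL : ∀ n : ℤ, L (fourier n) = 0 := by
    intro n
    change ⟪hg.toLp g, Q (P (fourier n))⟫_ℂ = 0
    rw [L2.inner_def, ← h n]
    refine integral_congr_ae ?_
    filter_upwards [hg.coeFn_toLp, ContinuousMap.coeFn_toLp circleHaar (P (fourier n))
      (p := 2) (𝕜 := ℂ)] with t h1 h2
    have h3 : (Q (P (fourier n))) t = ((t ^ n : Circle) : ℂ) := by
      refine h2.trans ?_
      change ((AddCircle.toCircle (n • e.symm t) : Circle) : ℂ) = _
      rw [AddCircle.toCircle_zsmul, ← AddCircle.homeomorphCircle_apply one_ne_zero]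
      change (((e (e.symm t)) ^ n : Circle) : ℂ) = _
      rw [e.apply_symm_apply]
    rw [h3, h1]
    rfl
  have hL0 : ∀ ψ, L ψ = 0 := by
    intro ψ
    have hle : (Submodule.span ℂ (range (fourier (T := 1)))).topologicalClosure ≤ L.ker :=
      Submodule.topologicalClosure_minimal _
        (Submodule.span_le.2 (by rintro _ ⟨n, rfl⟩; exact hL n)) L.isClosed_ker
    rw [span_fourier_closure_eq_top] at hle
    exact hle Submodule.mem_top
  have hQ : ∀ φ, ⟪hg.toLp g, Q φ⟫_ℂ = 0 := by
    intro φ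
    have : P (φ.comp ⟨e, e.continuous⟩) = φ := by
      ext t
      exact congrArg φ (e.apply_symm_apply t)
    rw [← this]
    exact hL0 _
  -- Pairing with `g` vanishes on characters, hence on continuous functions, hence by this density
  -- on all of `L²`.
  have hd : DenseRange Q := ContinuousMap.toLp_denseRange ℂ circleHaar ℂ ENNReal.ofNat_ne_top
  have hz : ∀ ξ, ⟪hg.toLp g, ξ⟫_ℂ = 0 := fun ξ =>
    hd.induction_on (p := fun ξ => ⟪hg.toLp g, ξ⟫_ℂ = 0) ξ
      (isClosed_eq (by fun_prop) continuous_const) hQ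
  have h0 : hg.toLp g = 0 := inner_self_eq_zero.1 (hz _)
  filter_upwards [hg.coeFn_toLp, Lp.coeFn_zero ℂ 2 circleHaar] with t h1 h2
  rw [← h1, h0, h2]

/-- `n`-th root of `-1` on the circle. -/
def rootNegOne (n : ℤ) : Circle := Circle.exp (Real.pi * (n : ℝ)⁻¹)

lemma rootNegOne_zpow {n : ℤ} (hn : n ≠ 0) : ((rootNegOne n ^ n : Circle) : ℂ) = -1 := by
  have hn' : (n : ℝ) ≠ 0 := Int.cast_ne_zero.2 hn
  rw [rootNegOne, ← Circle.exp_intCast_mul]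
  have : (n : ℝ) * (Real.pi * (n : ℝ)⁻¹) = Real.pi := by field_simp
  rw [this, Circle.coe_exp, Complex.exp_pi_mul_I]

lemma tendsto_rootNegOne : Tendsto rootNegOne cofinite (𝓝 1) := by
  have h1 : Tendsto (fun n : ℤ => Real.pi * (n : ℝ)⁻¹) cofinite (𝓝 0) := by
    have := (Filter.tendsto_inv₀_cobounded (α := ℝ)).comp
      (by simpa only [Metric.cobounded_eq_cocompact] using Int.tendsto_coe_cofinite)
    simpa using this.const_mul Real.pi
  have h2 := (Circle.exp.continuous.tendsto 0).comp h1
  rw [Circle.exp_zero] at h2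
  exact h2

/-- Translating by an `n`-th root of `-1` shows that the integral equals its own negative. -/
lemma integral_zpow_eq_zero {n : ℤ} (hn : n ≠ 0) : ∫ t, ((t ^ n : Circle) : ℂ) ∂circleHaar = 0 := by
  have h := integral_mul_left_zpow (fun _ => 1) (rootNegOne n) n
  have h1 : (((rootNegOne n ^ n)⁻¹ : Circle) : ℂ) = -1 := by
    rw [Circle.coe_inv, rootNegOne_zpow hn]; norm_num
  simp only [one_mul, h1] at h
  linear_combination h / 2

end Circle

/-! ### Uniform Riemann-Lebesgue lemma and functions in a single mode -/

section RiemannLebesgue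

variable {G : Type u} [TopologicalSpace G] [LocallyCompactSpace G] [SecondCountableTopology G]
  [T2Space G]

/-- The functions `Υ_n(F)` tend to zero uniformly. -/
lemma eventually_norm_upsilonFun_le (F : C_c(Circle × G, ℂ)) {ε : ℝ} (hε : 0 < ε) :
    ∀ᶠ n in cofinite, ∀ γ, ‖upsilonFun n F γ‖ ≤ ε := by
  have hK : IsCompact ((univ : Set Circle) ×ˢ (Prod.snd '' tsupport F)) :=
    isCompact_univ.prod (F.hasCompactSupport.isCompact.image continuous_snd)
  -- Rotation by `w` near `1` moves `F` little, uniformly on a compact set that contains the whole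
  -- circle over each relevant `γ`.
  have hev : ∀ᶠ w : Circle in 𝓝 1, ∀ p ∈ (univ : Set Circle) ×ˢ (Prod.snd '' tsupport F),
      ‖F p - F (w * p.1, p.2)‖ < ε := by
    refine hK.eventually_forall_of_forall_eventually fun p _ => ?_
    have hcont : Continuous fun q : Circle × Circle × G => ‖F q.2 - F (q.1 * q.2.1, q.2.2)‖ :=
      (((map_continuous F).comp continuous_snd).sub ((map_continuous F).comp
        (by fun_prop : Continuous fun q : Circle × Circle × G => (q.1 * q.2.1, q.2.2)))).norm
    refine (hcont.tendsto (1, p)).eventually_lt_const ?_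
    simpa using hε
  filter_upwards [tendsto_rootNegOne.eventually hev, eventually_cofinite_ne 0] with n hn hn0 γ
  by_cases hγ : γ ∈ Prod.snd '' tsupport F
  · have h := integral_mul_left_zpow (fun t => F (t, γ)) (rootNegOne n) n
    have h1 : (((rootNegOne n ^ n)⁻¹ : Circle) : ℂ) = -1 := by
      rw [Circle.coe_inv, rootNegOne_zpow hn0]; norm_num
    rw [h1, ← upsilonFun_apply] at h
    have hint : Integrable (fun t => F (rootNegOne n * t, γ) * ((t ^ n : Circle) : ℂ))
        circleHaar := by
      have hc : Continuous fun t : Circle => F (rootNegOne n * t, γ) * ((t ^ n : Circle) : ℂ) :=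
        ((map_continuous F).comp
          (by fun_prop : Continuous fun t : Circle => (rootNegOne n * t, γ))).mul
          (continuous_coe_zpow n)
      exact hc.integrable_of_hasCompactSupport (HasCompactSupport.of_compactSpace _)
    -- Rotating by an `n`-th root `w` of `-1` flips the sign of the coefficient, so twice the
    -- coefficient is that of `F(t, γ) - F(wt, γ)`; these roots tend to `1`.
    have h2 : 2 * upsilonFun n F γ =
        ∫ t, (F (t, γ) - F (rootNegOne n * t, γ)) * ((t ^ n : Circle) : ℂ) ∂circleHaar := by
      simp only [sub_mul]
      rw [integral_sub (integrable_slice F n γ) hint, h, ← upsilonFun_apply]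
      ring
    have h3 : ‖2 * upsilonFun n F γ‖ ≤ ε := by
      rw [h2]
      refine (norm_integral_le_of_norm_le_const (ae_of_all _ fun t => ?_)).trans_eq
        (by rw [probReal_univ, mul_one] : ε * circleHaar.real univ = ε)
      rw [norm_mul, Circle.norm_coe, mul_one]
      exact (hn (t, γ) ⟨mem_univ _, hγ⟩).le
    rw [norm_mul, Complex.norm_ofNat] at h3
    linarith [norm_nonneg (upsilonFun n F γ)]
  · have : upsilonFun n F γ = 0 :=
      image_eq_zero_of_notMem_tsupport fun h => hγ (tsupport_upsilonFun_subset n F h)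
    rw [this, norm_zero]
    exact hε.le

/-- The function `t⁻ⁿ f(γ)` on `𝕋 × G`. -/
def monomialExt (n : ℤ) (f : C_c(G, ℂ)) : C_c(Circle × G, ℂ) where
  toFun p := (((p.1 ^ n)⁻¹ : Circle) : ℂ) * f p.2
  continuous_toFun := by
    have h : Continuous fun p : Circle × G => (p.1 ^ n)⁻¹ :=
      ((continuous_zpow n).comp continuous_fst).inv
    exact (continuous_subtype_val.comp h).mul ((map_continuous f).comp continuous_snd)
  hasCompactSupport' := by
    refine HasCompactSupport.intro (isCompact_univ.prod f.hasCompactSupport.isCompact)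
      (fun p hp => ?_)
    have : f p.2 = 0 := image_eq_zero_of_notMem_tsupport fun h => hp ⟨mem_univ _, h⟩
    rw [this, mul_zero]

lemma upsilonFun_monomialExt (n m : ℤ) (f : C_c(G, ℂ)) (γ : G) :
    upsilonFun m (monomialExt n f) γ =
      f γ * ∫ t, ((t ^ (m - n) : Circle) : ℂ) ∂circleHaar := by
  rw [upsilonFun_apply, ← integral_const_mul]
  refine integral_congr_ae (ae_of_all _ fun t => ?_)
  change (((t ^ n)⁻¹ : Circle) : ℂ) * f γ * ((t ^ m : Circle) : ℂ) = _
  simp only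
  rw [sub_eq_neg_add, zpow_add, zpow_neg, Circle.coe_mul]
  ring

lemma upsilonFun_monomialExt_self (n : ℤ) (f : C_c(G, ℂ)) :
    upsilonFun n (monomialExt n f) = f := by
  ext γ
  rw [upsilonFun_monomialExt]
  simp

lemma upsilonFun_monomialExt_ne {n m : ℤ} (h : m ≠ n) (f : C_c(G, ℂ)) :
    upsilonFun m (monomialExt n f) = 0 := by
  ext γ
  rw [upsilonFun_monomialExt, integral_zpow_eq_zero (sub_ne_zero.2 h), mul_zero]
  rfl

end RiemannLebesgue

/-! ### Fourier modes in `L²(𝕋 × G)` -/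

section FourierIsometry

variable {G : Type u} [MeasurableSpace G] {μ : Measure G} [SFinite μ] {ρ : Measure (Circle × G)}

/-- The measure `ρ` stays a variable with an equation: the source measure of the extension is a
product only up to a proved equality, and rewriting it would change the `Lp` space. -/
lemma measurePreserving_snd_of_eq (hρ : ρ = circleHaar.prod μ) :
    MeasurePreserving Prod.snd ρ μ := by
  subst hρ; exact measurePreserving_snd

lemma memLp_fourier (hρ : ρ = circleHaar.prod μ) (n : ℤ) (ξ : Lp ℂ 2 μ) :
    MemLp (fun p : Circle × G => (((p.1 ^ n)⁻¹ : Circle) : ℂ) * ξ p.2) 2 ρ := by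
  have h1 := (Lp.memLp ξ).comp_measurePreserving (measurePreserving_snd_of_eq hρ)
  have h2 : Continuous fun t : Circle => (((t ^ n)⁻¹ : Circle) : ℂ) :=
    continuous_subtype_val.comp (continuous_zpow n).inv
  refine h1.of_le ((h2.measurable.comp measurable_fst).aestronglyMeasurable.mul h1.1)
    (ae_of_all _ fun p => ?_)
  rw [norm_mul, Circle.norm_coe, one_mul]
  rfl

/-- The isometry `ξ ↦ ((t, γ) ↦ t⁻ⁿ ξ(γ))` of `L²(μ)` into `L²(τ × μ)`. -/
def fourierIsometry (hρ : ρ = circleHaar.prod μ) (n : ℤ) : Lp ℂ 2 μ →ₗᵢ[ℂ] Lp ℂ 2 ρ where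
  toFun ξ := (memLp_fourier hρ n ξ).toLp
  map_add' ξ ζ := by
    rw [← MemLp.toLp_add]
    refine (MemLp.toLp_eq_toLp_iff _ _).2 ?_
    filter_upwards [(measurePreserving_snd_of_eq hρ).quasiMeasurePreserving.ae
      (Lp.coeFn_add ξ ζ)] with p hp
    rw [hp, Pi.add_apply, Pi.add_apply, mul_add]
  map_smul' c ξ := by
    rw [RingHom.id_apply, ← MemLp.toLp_const_smul]
    refine (MemLp.toLp_eq_toLp_iff _ _).2 ?_
    filter_upwards [(measurePreserving_snd_of_eq hρ).quasiMeasurePreserving.ae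
      (Lp.coeFn_smul c ξ)] with p hp
    rw [hp, Pi.smul_apply, Pi.smul_apply, smul_eq_mul, smul_eq_mul]
    ring
  norm_map' ξ := by
    change ‖(memLp_fourier hρ n ξ).toLp‖ = ‖ξ‖
    rw [Lp.norm_toLp, Lp.norm_def]
    congr 1
    rw [← eLpNorm_comp_measurePreserving (Lp.aestronglyMeasurable ξ)
      (measurePreserving_snd_of_eq hρ)]
    refine eLpNorm_congr_norm_ae (ae_of_all _ fun p => ?_)
    rw [norm_mul, Circle.norm_coe, one_mul]
    rfl

lemma coeFn_fourierIsometry (hρ : ρ = circleHaar.prod μ) (n : ℤ) (ξ : Lp ℂ 2 μ) :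
    fourierIsometry hρ n ξ =ᵐ[ρ] fun p => (((p.1 ^ n)⁻¹ : Circle) : ℂ) * ξ p.2 :=
  (memLp_fourier hρ n ξ).coeFn_toLp

/-- The ranges of the isometries `fourierIsometry hρ n` are total. -/
lemma eq_zero_of_inner_fourierIsometry [SigmaFinite μ] (hρ : ρ = circleHaar.prod μ) (ζ : Lp ℂ 2 ρ)
    (h : ∀ n ξ, ⟪ζ, fourierIsometry hρ n ξ⟫_ℂ = 0) : ζ = 0 := by
  have hint : ∀ {g : Circle × G → ℂ}, Integrable g ρ → Integrable g (circleHaar.prod μ) :=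
    fun hg => hρ ▸ hg
  have hintegral : ∀ g : Circle × G → ℂ, ∫ p, g p ∂ρ = ∫ p, g p ∂(circleHaar.prod μ) :=
    fun g => by rw [hρ]
  have hsm : AEStronglyMeasurable ζ (circleHaar.prod μ) := hρ ▸ Lp.aestronglyMeasurable ζ
  have hL2 : Integrable (fun p => ‖ζ p‖ ^ 2) (circleHaar.prod μ) := by
    rw [← hρ]
    exact (memLp_two_iff_integrable_sq_norm (Lp.aestronglyMeasurable ζ)).1 (Lp.memLp ζ)
  have hslice : ∀ᵐ γ ∂μ, MemLp (fun t => ζ (t, γ)) 2 circleHaar := by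
    filter_upwards [hL2.prod_left_ae, hsm.prod_swap.prodMk_left] with γ h1 h2
    exact (memLp_two_iff_integrable_sq_norm h2).2 h1
  have hcoef : ∀ n : ℤ, (fun γ => ∫ t, (((t ^ n)⁻¹ : Circle) : ℂ) * conj (ζ (t, γ)) ∂circleHaar)
      =ᵐ[μ] 0 := by
    intro n
    have key : ∀ s (hs : MeasurableSet s) (hμ : μ s < ∞),
        Integrable (fun p : Circle × G => s.indicator (fun _ => (1 : ℂ)) p.2 *
          ((((p.1 ^ n)⁻¹ : Circle) : ℂ) * conj (ζ p))) (circleHaar.prod μ) ∧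
        ∫ p : Circle × G, s.indicator (fun _ => (1 : ℂ)) p.2 *
          ((((p.1 ^ n)⁻¹ : Circle) : ℂ) * conj (ζ p)) ∂(circleHaar.prod μ) = 0 := by
      intro s hs hμ
      have hae : (fun p => ⟪ζ p, fourierIsometry hρ n (indicatorConstLp 2 hs hμ.ne (1 : ℂ)) p⟫_ℂ)
          =ᵐ[ρ] fun p : Circle × G => s.indicator (fun _ => (1 : ℂ)) p.2 *
            ((((p.1 ^ n)⁻¹ : Circle) : ℂ) * conj (ζ p)) := by
        filter_upwards [coeFn_fourierIsometry hρ n (indicatorConstLp 2 hs hμ.ne (1 : ℂ)),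
          (measurePreserving_snd_of_eq hρ).quasiMeasurePreserving.ae
            (indicatorConstLp_coeFn (p := 2) (hs := hs) (hμs := hμ.ne) (c := (1 : ℂ)))] with p h1 h2
        rw [h1, h2, RCLike.inner_apply]
        ring
      have h1 := (L2.integrable_inner (𝕜 := ℂ) ζ
        (fourierIsometry hρ n (indicatorConstLp 2 hs hμ.ne (1 : ℂ)))).congr hae
      have h2 := h n (indicatorConstLp 2 hs hμ.ne (1 : ℂ))
      rw [L2.inner_def, integral_congr_ae hae] at h2
      exact ⟨hint h1, (hintegral _).symm.trans h2⟩
    have hslices : ∀ s : Set G, (fun γ => ∫ t, s.indicator (fun _ => (1 : ℂ)) γ *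
          ((((t ^ n)⁻¹ : Circle) : ℂ) * conj (ζ (t, γ))) ∂circleHaar) =
        s.indicator fun γ => ∫ t, (((t ^ n)⁻¹ : Circle) : ℂ) * conj (ζ (t, γ)) ∂circleHaar := by
      intro s
      funext γ
      by_cases hγ : γ ∈ s <;> simp [hγ]
    -- Testing `ζ` against the modes of indicators of sets of finite measure says that the `n`-th
    -- coefficient of the slices of `ζ` integrates to zero over each such set.
    refine ae_eq_zero_of_forall_setIntegral_eq_of_sigmaFinite ?_ ?_
    · intro s hs hμ
      rw [← integrable_indicator_iff hs, ← hslices]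
      exact (key s hs hμ).1.integral_prod_right
    · intro s hs hμ
      rw [← integral_indicator hs, ← hslices, ← (key s hs hμ).2,
        integral_prod_symm _ (key s hs hμ).1]
  have hzero : ∀ᵐ γ ∂μ, (fun t => ζ (t, γ)) =ᵐ[circleHaar] 0 := by
    -- There are countably many `n`, so one null set of `γ` serves for all Fourier coefficients.
    filter_upwards [hslice, ae_all_iff.2 hcoef] with γ h1 h2
    refine ae_eq_zero_of_fourier h1 fun n => ?_
    have := h2 (-n)
    simpa only [zpow_neg, inv_inv, Pi.zero_apply] using this
  have hfin : ζ =ᵐ[circleHaar.prod μ] 0 := by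
    have h0 : ∫⁻ p, ‖ζ p‖ₑ ∂(circleHaar.prod μ) = 0 := by
      rw [lintegral_prod_symm _ hsm.enorm]
      refine lintegral_eq_zero_of_ae_eq_zero (hzero.mono fun γ hγ => ?_)
      refine lintegral_eq_zero_of_ae_eq_zero (hγ.mono fun t ht => ?_)
      simp only [Pi.zero_apply] at ht ⊢
      rw [ht, enorm_zero]
    filter_upwards [(lintegral_eq_zero_iff' hsm.enorm).1 h0] with p hp
    simpa using hp
  rw [← hρ] at hfin
  exact (Lp.eq_zero_iff_ae_eq_zero).2 hfin

end FourierIsometry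

/-! ### Modes intertwine the regular representations -/

section Intertwining

variable {G : Type u} [TopologicalSpace G] [LocallyCompactSpace G] [SecondCountableTopology G]
  [T2Space G] [MeasurableSpace G] [BorelSpace G] {𝒢 : TopGroupoid G}

/-- The unit `(1, u)` of the extension. -/
def unitLift (ω : Cocycle 𝒢) (u : 𝒢.units) : (extension 𝒢 ω).units :=
  ⟨(1, u), Prod.ext rfl u.2⟩

lemma unitLift_surjective (ω : Cocycle 𝒢) : Function.Surjective (unitLift ω) := fun x =>
  ⟨⟨x.1.2, (Prod.ext_iff.1 x.2).2⟩, Subtype.ext (Prod.ext (Prod.ext_iff.1 x.2).1 rfl)⟩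

/-- Inversion in the extension is a skew product over inversion in `G`, and on each circle it is `t
↦ t⁻¹ ω(γ, γ⁻¹)⁻¹`, which preserves Haar measure. The swaps put the base in the first factor. -/
lemma src_extension (lam : HaarSystem 𝒢) (ω : Cocycle 𝒢) (u : 𝒢.units) :
    (lam.extension ω).src (unitLift ω u) = circleHaar.prod (lam.src u) := by
  have := lam.isFiniteMeasureOnCompacts u.2
  have hc : Continuous fun γ => ω.toFun γ (𝒢.inv γ) :=
    ω.continuousOn.comp_continuous (continuous_id.prodMk 𝒢.continuous_inv)
      fun γ => (𝒢.r_inv γ).symm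
  have h1 : MeasurePreserving 𝒢.inv (lam.meas u) (lam.src u) :=
    ⟨𝒢.continuous_inv.measurable, rfl⟩
  have h2 : MeasurePreserving (fun p : G × Circle =>
      (𝒢.inv p.1, p.2⁻¹ * (ω.toFun p.1 (𝒢.inv p.1))⁻¹))
      ((lam.meas u).prod circleHaar) ((lam.src u).prod circleHaar) := by
    refine h1.skew_product (g := fun γ t => t⁻¹ * (ω.toFun γ (𝒢.inv γ))⁻¹) ?_
      (ae_of_all _ fun γ => ?_)
    · exact (continuous_snd.inv.mul (hc.comp continuous_fst).inv).measurable
    · exact ((measurePreserving_mul_right circleHaar (ω.toFun γ (𝒢.inv γ))⁻¹).comp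
        (Measure.measurePreserving_inv circleHaar)).map_eq
  exact ((Measure.measurePreserving_swap.comp h2).comp Measure.measurePreserving_swap).map_eq

/-- The embedding of `L²(G, λ_u)` into `L²(G^ω, (τ × λ)_u)` on the functions `t⁻ⁿ ξ(γ)`. -/
def modeEmbedding (lam : HaarSystem 𝒢) (ω : Cocycle 𝒢) (n : ℤ) (u : 𝒢.units) :
    Lp ℂ 2 (lam.src u) →ₗᵢ[ℂ] Lp ℂ 2 ((lam.extension ω).src (unitLift ω u)) :=
  fourierIsometry (src_extension lam ω u) n

/-- The cocycle identity for `(γ, η⁻¹, η)` collects all twisting into one factor. What remains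
depends on `t` and `s` through `t * s⁻¹` only. -/
lemma regKernel_extension (ω : Cocycle 𝒢) (F : C_c(Circle × G, ℂ)) (t s : Circle) {γ η : G}
    (h : 𝒢.s γ = 𝒢.s η) :
    regKernel (1 : Cocycle (extension 𝒢 ω)) F (t, γ) (s, η) =
      F (t * (ω.toFun (𝒢.mul γ (𝒢.inv η)) η)⁻¹ * s⁻¹, 𝒢.mul γ (𝒢.inv η)) := by
  have e : t * (s⁻¹ * (ω.toFun η (𝒢.inv η))⁻¹) * ω.toFun γ (𝒢.inv η) =
      t * (ω.toFun (𝒢.mul γ (𝒢.inv η)) η)⁻¹ * s⁻¹ := by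
    have c := ω.cocycle γ (𝒢.inv η) η (h.trans (𝒢.r_inv η).symm) (𝒢.s_inv η)
    rw [← 𝒢.s_eq, ← h, ω.map_s, mul_one, ω.map_inv] at c
    have c' : (ω.toFun η (𝒢.inv η))⁻¹ * ω.toFun γ (𝒢.inv η) =
        (ω.toFun (𝒢.mul γ (𝒢.inv η)) η)⁻¹ := by
      rw [← c, mul_inv, mul_comm, ← mul_assoc, mul_inv_cancel, one_mul]
    rw [← c']
    simp only [mul_comm, mul_left_comm]
  change F (t * (s⁻¹ * (ω.toFun η (𝒢.inv η))⁻¹) * ω.toFun γ (𝒢.inv η), 𝒢.mul γ (𝒢.inv η)) *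
    ((1 : Circle) : ℂ) = _
  rw [e, Circle.coe_one, mul_one]

/-- Integrating the kernel against `s⁻ⁿ` over the circle is a convolution with a character: it
returns `t⁻ⁿ` times `Υ_n(F)(γη⁻¹) ω(γη⁻¹, η)ⁿ`, the regular kernel for `ω^n`. -/
lemma leftRegular_modeEmbedding (lam : HaarSystem 𝒢) (ω : Cocycle 𝒢) (n : ℤ) (u : 𝒢.units)
    (F : C_c(Circle × G, ℂ)) (ξ : Lp ℂ 2 (lam.src u)) :
    leftRegular (lam.extension ω) 1 (unitLift ω u) F (modeEmbedding lam ω n u ξ) =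
      modeEmbedding lam ω n u (leftRegular lam (ω ^ n) u (upsilonFun n F) ξ) := by
  have hρ := src_extension lam ω u
  obtain ⟨C, hC⟩ := exists_isSchurKernel (lam.extension ω) 1 F
  obtain ⟨C', hC'⟩ := exists_isSchurKernel lam (ω ^ n) (upsilonFun n F)
  have hV := coeFn_fourierIsometry hρ n ξ
  refine Lp.ext ?_
  refine ((hasKernel_leftRegular (lam.extension ω) 1 (unitLift ω u) F).apply_ae
    (hC _ (unitLift ω u).2) _).trans (EventuallyEq.trans ?_ (coeFn_fourierIsometry hρ n _).symm)
  have hs : ∀ᵐ γ ∂(lam.src u), 𝒢.s γ = u := lam.ae_s u.2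
  have hsnd := (measurePreserving_snd_of_eq hρ).quasiMeasurePreserving
  filter_upwards [(hC _ (unitLift ω u).2).integrable_mul (modeEmbedding lam ω n u ξ),
    hsnd.ae hs, hsnd.ae ((hasKernel_leftRegular lam (ω ^ n) u (upsilonFun n F)).apply_ae
      (hC' _ u.2) ξ)] with p h1 h2 h3
  have hVp : (fun q => regKernel (1 : Cocycle (extension 𝒢 ω)) F p q *
      modeEmbedding lam ω n u ξ q) =ᵐ[(lam.extension ω).src (unitLift ω u)]
      fun q => regKernel (1 : Cocycle (extension 𝒢 ω)) F p q *
        ((((q.1 ^ n)⁻¹ : Circle) : ℂ) * ξ q.2) :=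
    hV.mono fun q hq => congrArg (_ * ·) hq
  have h1' := h1.congr hVp
  rw [hρ] at h1'
  rw [h3, integral_congr_ae hVp, hρ, integral_prod_symm _ h1', ← integral_const_mul]
  refine integral_congr_ae (hs.mono fun η hη => ?_)
  have hL := integral_mul_inv_zpow (fun t => F (t, 𝒢.mul p.2 (𝒢.inv η)))
    (p.1 * (ω.toFun (𝒢.mul p.2 (𝒢.inv η)) η)⁻¹) n
  rw [mul_zpow, mul_inv, inv_zpow, inv_inv, Circle.coe_mul, ← upsilonFun_apply] at hL
  have e : ∀ s : Circle, regKernel (1 : Cocycle (extension 𝒢 ω)) F p (s, η) *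
      ((((s ^ n)⁻¹ : Circle) : ℂ) * ξ η) =
      F (p.1 * (ω.toFun (𝒢.mul p.2 (𝒢.inv η)) η)⁻¹ * s⁻¹, 𝒢.mul p.2 (𝒢.inv η)) *
        (((s ^ n)⁻¹ : Circle) : ℂ) * ξ η := fun s => by
    rw [← regKernel_extension ω F p.1 s (h2.trans hη.symm), mul_assoc]
  simp only [e]
  rw [integral_mul_const, hL, regKernel, Cocycle.zpow_toFun]
  ring

end Intertwining

/-! ### The maps `Ω_n`: construction, joint injectivity and decay -/

section Omega

variable {G : Type u} [TopologicalSpace G] [LocallyCompactSpace G] [SecondCountableTopology G]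
  [T2Space G] [MeasurableSpace G] [BorelSpace G] {𝒢 : TopGroupoid G}

/-- The `ℓ^∞`-product of the algebras of operators on the spaces `L²(G, λ_u)`. -/
abbrev RegProd (lam : HaarSystem 𝒢) : Type u :=
  lp (fun x : 𝒢.units => Lp ℂ 2 (lam.src x) →L[ℂ] Lp ℂ 2 (lam.src x)) ∞

/-- The compression of an operator to the range of an isometry. -/
def compress {H K : Type*} [NormedAddCommGroup H] [InnerProductSpace ℂ H] [CompleteSpace H]
    [NormedAddCommGroup K] [InnerProductSpace ℂ K] [CompleteSpace K] (V : H →ₗᵢ[ℂ] K) :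
    (K →L[ℂ] K) →ₗ[ℂ] (H →L[ℂ] H) where
  toFun T := (ContinuousLinearMap.adjoint V.toContinuousLinearMap) ∘L T ∘L V.toContinuousLinearMap
  map_add' S T := by
    rw [ContinuousLinearMap.add_comp, ContinuousLinearMap.comp_add]
  map_smul' c T := by
    rw [ContinuousLinearMap.smul_comp, ContinuousLinearMap.comp_smul, RingHom.id_apply]

lemma norm_compress_le {H K : Type*} [NormedAddCommGroup H] [InnerProductSpace ℂ H]
    [CompleteSpace H] [NormedAddCommGroup K] [InnerProductSpace ℂ K] [CompleteSpace K]
    (V : H →ₗᵢ[ℂ] K) (T : K →L[ℂ] K) : ‖compress V T‖ ≤ ‖T‖ := by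
  have hV : ‖V.toContinuousLinearMap‖ ≤ 1 := V.norm_toContinuousLinearMap_le
  calc ‖compress V T‖ ≤ ‖ContinuousLinearMap.adjoint V.toContinuousLinearMap‖ *
        (‖T‖ * ‖V.toContinuousLinearMap‖) :=
        (ContinuousLinearMap.opNorm_comp_le _ _).trans
          (mul_le_mul_of_nonneg_left (ContinuousLinearMap.opNorm_comp_le _ _) (norm_nonneg _))
    _ ≤ 1 * (‖T‖ * 1) := by
        rw [LinearIsometryEquiv.norm_map]
        gcongr
    _ = ‖T‖ := by ring

/-- If `TV = VS`, then `V*TV = V*VS = S`, as `V` is an isometry. -/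
lemma compress_eq_of_intertwines {H K : Type*} [NormedAddCommGroup H] [InnerProductSpace ℂ H]
    [CompleteSpace H] [NormedAddCommGroup K] [InnerProductSpace ℂ K] [CompleteSpace K]
    {V : H →ₗᵢ[ℂ] K} {T : K →L[ℂ] K} {S : H →L[ℂ] H} (h : ∀ ξ, T (V ξ) = V (S ξ)) :
    compress V T = S := by
  refine ContinuousLinearMap.ext fun ξ => ext_inner_left ℂ fun ζ => ?_
  change ⟪ζ, ContinuousLinearMap.adjoint V.toContinuousLinearMap (T (V ξ))⟫_ℂ = _
  rw [ContinuousLinearMap.adjoint_inner_right, h]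
  exact V.inner_map_map ζ (S ξ)

/-- The compression to the `n`-th Fourier modes. -/
def modeCompress (lam : HaarSystem 𝒢) (ω : Cocycle 𝒢) (n : ℤ) :
    RegProd (lam.extension ω) →L[ℂ] RegProd lam :=
  lpLift (fun u => (compress (modeEmbedding lam ω n u)).comp
      (lpEval (fun x : (extension 𝒢 ω).units => Lp ℂ 2 ((lam.extension ω).src x) →L[ℂ]
        Lp ℂ 2 ((lam.extension ω).src x)) (unitLift ω u)))
    fun u a => (norm_compress_le _ _).trans (norm_lpEval_le (unitLift ω u) a)

lemma modeCompress_regularFamily (lam : HaarSystem 𝒢) (ω : Cocycle 𝒢) (n : ℤ)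
    (F : C_c(Circle × G, ℂ)) : modeCompress lam ω n (regularFamily (lam.extension ω) 1 F) =
      regularFamily lam (ω ^ n) (upsilonFun n F) :=
  lp.ext (funext fun u => compress_eq_of_intertwines (leftRegular_modeEmbedding lam ω n u F))

/-- Compressions are not multiplicative in general. On the image of `C_c(G^ω)` this one is, because
there it is implemented by `Υ_n`. -/
lemma modeCompress_mul (lam : HaarSystem 𝒢) (ω : Cocycle 𝒢) (n : ℤ) :
    ∀ a ∈ range (regularFamily (lam.extension ω) 1),
      ∀ b ∈ range (regularFamily (lam.extension ω) 1),
        modeCompress lam ω n (a * b) = modeCompress lam ω n a * modeCompress lam ω n b := by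
  rintro _ ⟨F, rfl⟩ _ ⟨F', rfl⟩
  rw [← regularFamily_conv, modeCompress_regularFamily, modeCompress_regularFamily,
    modeCompress_regularFamily, upsilonFun_conv, regularFamily_conv]

lemma modeCompress_star (lam : HaarSystem 𝒢) (ω : Cocycle 𝒢) (n : ℤ) :
    ∀ a ∈ range (regularFamily (lam.extension ω) 1),
      modeCompress lam ω n (star a) = star (modeCompress lam ω n a) := by
  rintro _ ⟨F, rfl⟩
  rw [← regularFamily_invol, modeCompress_regularFamily, modeCompress_regularFamily,
    upsilonFun_invol, regularFamily_invol]

lemma modeCompress_mem (lam : HaarSystem 𝒢) (ω : Cocycle 𝒢) (n : ℤ) :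
    ∀ a ∈ range (regularFamily (lam.extension ω) 1),
      modeCompress lam ω n a ∈ range (regularFamily lam (ω ^ n)) := by
  rintro _ ⟨F, rfl⟩
  exact ⟨_, (modeCompress_regularFamily lam ω n F).symm⟩

set_option maxHeartbeats 2000000 in
lemma exists_starHom_modeCompress (lam : HaarSystem 𝒢) (ω : Cocycle 𝒢) (n : ℤ) :
    ∃ Ω : ReducedAlg (lam.extension ω) 1 →⋆ₙₐ[ℂ] ReducedAlg lam (ω ^ n),
      ∀ a, (Ω a).1 = modeCompress lam ω n a.1 :=
  exists_starHom_closedAlg (isStarSubalgebra_regularFamily (lam.extension ω) 1)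
    (isStarSubalgebra_regularFamily lam (ω ^ n)) (modeCompress lam ω n)
    (modeCompress_mul lam ω n) (modeCompress_star lam ω n) (modeCompress_mem lam ω n)

lemma exists_omega (lam : HaarSystem 𝒢) (ω : Cocycle 𝒢) (n : ℤ) :
    ∃ Ω : ReducedAlg (lam.extension ω) 1 →⋆ₙₐ[ℂ] ReducedAlg lam (ω ^ n),
      ∀ F, Ω (ReducedAlg.of (lam.extension ω) 1 F) =
        ReducedAlg.of lam (ω ^ n) (upsilonFun n F) := by
  obtain ⟨Ω, hΩ⟩ := exists_starHom_modeCompress lam ω n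
  exact ⟨Ω, fun F => Subtype.ext ((hΩ _).trans (modeCompress_regularFamily lam ω n F))⟩

lemma ReducedAlg.continuous_apply (lam : HaarSystem 𝒢) (σ : Cocycle 𝒢) (x : 𝒢.units)
    (ξ : Lp ℂ 2 (lam.src x)) : Continuous fun a : ReducedAlg lam σ => a.1 x ξ := by
  have h1 : Continuous fun a : ReducedAlg lam σ => a.1 :=
    (ClosedAlg.incl (range (regularFamily lam σ))).continuous
  have h2 : Continuous fun a : RegProd lam => a x := continuous_lpEval x
  exact (ContinuousLinearMap.apply ℂ _ ξ).continuous.comp (h2.comp h1)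

lemma ReducedAlg.dense_range_of (lam : HaarSystem 𝒢) (σ : Cocycle 𝒢) :
    Dense (range (ReducedAlg.of lam σ)) := fun a =>
  ReducedAlg.induction (p := fun a => a ∈ closure (range (ReducedAlg.of lam σ)))
    isClosed_closure (fun f => subset_closure ⟨f, rfl⟩) a

variable {lam : HaarSystem 𝒢} {ω : Cocycle 𝒢} {n : ℤ}
  {Ω : ReducedAlg (lam.extension ω) 1 →⋆ₙₐ[ℂ] ReducedAlg lam (ω ^ n)}

/-- Stronger than a statement about compressions: every `a` maps each mode into itself. Hence
`Ω_n(a) = 0` forces `a` to vanish on the `n`-th mode, which injectivity needs. -/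
lemma omega_intertwines (hΩ : ∀ F, Ω (ReducedAlg.of (lam.extension ω) 1 F) =
      ReducedAlg.of lam (ω ^ n) (upsilonFun n F)) (a : ReducedAlg (lam.extension ω) 1)
    (u : 𝒢.units) (ξ : Lp ℂ 2 (lam.src u)) :
    a.1 (unitLift ω u) (modeEmbedding lam ω n u ξ) = modeEmbedding lam ω n u ((Ω a).1 u ξ) := by
  refine ReducedAlg.induction (p := fun a => a.1 (unitLift ω u) (modeEmbedding lam ω n u ξ) =
    modeEmbedding lam ω n u ((Ω a).1 u ξ)) (isClosed_eq ?_ ?_) (fun F => ?_) a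
  · exact ReducedAlg.continuous_apply _ _ _ _
  · exact (modeEmbedding lam ω n u).continuous.comp
      ((ReducedAlg.continuous_apply _ _ _ _).comp (starHom_continuous Ω))
  · rw [hΩ]
    exact leftRegular_modeEmbedding lam ω n u F ξ

lemma ReducedAlg.zero_apply (lam : HaarSystem 𝒢) (σ : Cocycle 𝒢) (x : 𝒢.units) :
    (0 : ReducedAlg lam σ).1 x = 0 := rfl

lemma ReducedAlg.eq_zero {lam : HaarSystem 𝒢} {σ : Cocycle 𝒢} {a : ReducedAlg lam σ}
    (h : ∀ x, a.1 x = 0) : a = 0 :=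
  Subtype.ext (lp.ext (funext fun x => (h x).trans (ReducedAlg.zero_apply lam σ x).symm))

/-- An operator on `L²(G^ω, (τ × λ)_u)` that vanishes on all Fourier modes is zero. -/
lemma eq_zero_of_modeEmbedding {lam : HaarSystem 𝒢} {ω : Cocycle 𝒢} {u : 𝒢.units}
    {T : Lp ℂ 2 ((lam.extension ω).src (unitLift ω u)) →L[ℂ]
      Lp ℂ 2 ((lam.extension ω).src (unitLift ω u))}
    (hT : ∀ n ξ, T (modeEmbedding lam ω n u ξ) = 0) : T = 0 := by
  -- Totality of the modes is available as triviality of the orthogonal complement, so it is applied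
  -- to the range of the adjoint.
  have hadj : ∀ ζ, ContinuousLinearMap.adjoint T ζ = 0 := fun ζ =>
    eq_zero_of_inner_fourierIsometry (src_extension lam ω u) _ fun n ξ => by
      rw [ContinuousLinearMap.adjoint_inner_left]
      have := hT n ξ
      rw [modeEmbedding] at this
      rw [this, inner_zero_right]
  refine ContinuousLinearMap.ext fun η => ext_inner_left ℂ fun ζ => ?_
  rw [← ContinuousLinearMap.adjoint_inner_left, hadj, inner_zero_left]
  exact (inner_zero_right _).symm

lemma eq_zero_of_omega {Ω : ∀ n : ℤ, ReducedAlg (lam.extension ω) 1 →⋆ₙₐ[ℂ] ReducedAlg lam (ω ^ n)}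
    (hΩ : ∀ n F, Ω n (ReducedAlg.of (lam.extension ω) 1 F) =
      ReducedAlg.of lam (ω ^ n) (upsilonFun n F)) (a : ReducedAlg (lam.extension ω) 1)
    (ha : ∀ n, Ω n a = 0) : a = 0 := by
  refine ReducedAlg.eq_zero fun x => ?_
  obtain ⟨u, rfl⟩ := unitLift_surjective ω x
  refine eq_zero_of_modeEmbedding fun n ξ => ?_
  rw [omega_intertwines (hΩ n), ha, ReducedAlg.zero_apply, zero_apply,
    map_zero]

lemma ReducedAlg.norm_of_le {lam : HaarSystem 𝒢} {σ : Cocycle 𝒢} {f : C_c(G, ℂ)} {C : ℝ}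
    (hC : 0 ≤ C) (h : ∀ x, ‖leftRegular lam σ x f‖ ≤ C) : ‖ReducedAlg.of lam σ f‖ ≤ C :=
  lp.norm_le_of_forall_le hC h

/-- All `Υ_n(F)` are supported in the projection of the support of `F`, so a single Schur constant
turns their uniform decay into norm decay, whatever the cocycle `ω^n`. -/
lemma tendsto_norm_of_upsilonFun (lam : HaarSystem 𝒢) (ω : Cocycle 𝒢) (F : C_c(Circle × G, ℂ)) :
    Tendsto (fun n : ℤ => ‖ReducedAlg.of lam (ω ^ n) (upsilonFun n F)‖) cofinite (𝓝 0) := by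
  obtain ⟨C, hC⟩ := exists_norm_leftRegular_le lam
    (F.hasCompactSupport.isCompact.image continuous_snd)
  rw [Metric.tendsto_nhds]
  intro ε hε
  have hC0 : (0 : ℝ) ≤ C := C.2
  filter_upwards [eventually_norm_upsilonFun_le F (ε := ε / (C + 1)) (by positivity)] with n hn
  rw [dist_zero_right, norm_norm]
  refine lt_of_le_of_lt (ReducedAlg.norm_of_le (C := ε / (C + 1) * C) (by positivity)
    (hC (ω ^ n) _ _ (by positivity) (tsupport_upsilonFun_subset n F) hn)) ?_
  rw [div_mul_eq_mul_div, div_lt_iff₀ (by positivity)]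
  nlinarith

lemma ReducedAlg.of_zero (lam : HaarSystem 𝒢) (σ : Cocycle 𝒢) : ReducedAlg.of lam σ 0 = 0 :=
  ReducedAlg.eq_zero fun x => by
    have := leftRegular_smul lam σ x 0 0
    rw [zero_smul, zero_smul] at this
    exact this

end Omega

end TwistedGroupoid

end

open TwistedGroupoid
theorem theorem4p1 {G : Type u} [TopologicalSpace G] [LocallyCompactSpace G]
    [SecondCountableTopology G] [T2Space G] [MeasurableSpace G] [BorelSpace G]
    (𝒢 : TopGroupoid G) (lam : HaarSystem 𝒢) (ω : Cocycle 𝒢) :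
    (∃! qω : FullAlg (lam.extension ω) 1 →⋆ₙₐ[ℂ] ReducedAlg (lam.extension ω) 1,
      IsReductionMap qω) ∧
    (∀ n : ℤ, ∃! q : FullAlg lam (ω ^ n) →⋆ₙₐ[ℂ] ReducedAlg lam (ω ^ n), IsReductionMap q) ∧
    (∀ n : ℤ, ∃! U : FullAlg (lam.extension ω) 1 →⋆ₙₐ[ℂ] FullAlg lam (ω ^ n), IsUpsilon n U) ∧
    ∃ Ω : ∀ n : ℤ, ReducedAlg (lam.extension ω) 1 →⋆ₙₐ[ℂ] ReducedAlg lam (ω ^ n),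
      (∀ (n : ℤ) (qω : FullAlg (lam.extension ω) 1 →⋆ₙₐ[ℂ] ReducedAlg (lam.extension ω) 1)
        (q : FullAlg lam (ω ^ n) →⋆ₙₐ[ℂ] ReducedAlg lam (ω ^ n))
        (U : FullAlg (lam.extension ω) 1 →⋆ₙₐ[ℂ] FullAlg lam (ω ^ n)),
        IsReductionMap qω → IsReductionMap q → IsUpsilon n U → ∀ a, Ω n (qω a) = q (U a)) ∧
      (∀ (n : ℤ) (F : C_c(Circle × G, ℂ)), Ω n (ReducedAlg.of (lam.extension ω) 1 F) =
        ReducedAlg.of lam (ω ^ n) (upsilonFun n F)) ∧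
      ∃ Φ : ReducedAlg (lam.extension ω) 1 ≃⋆ₐ[ℂ]
          czeroSum (fun n : ℤ => ReducedAlg lam (ω ^ n)),
        ∀ a n, (Φ a).1 n = Ω n a := by
  choose Ω hΩ using exists_omega lam ω
  refine ⟨existsUnique_isReductionMap _ _, fun n => existsUnique_isReductionMap _ _,
    existsUnique_isUpsilon lam ω, Ω, ?_, hΩ, ?_⟩
  · intro n qω q U hqω hq hU a
    exact FullAlg.induction (p := fun a => Ω n (qω a) = q (U a))
      (isClosed_eq ((starHom_continuous (Ω n)).comp (starHom_continuous qω))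
        ((starHom_continuous q).comp (starHom_continuous U)))
      (fun F a ha => by rw [hqω F a ha, hΩ, hq _ _ (hU F a ha)]) a
  · refine exists_starAlgEquiv_czeroSum Ω (eq_zero_of_omega hΩ)
      (ReducedAlg.dense_range_of (lam.extension ω) 1) ?_
      (fun n => ReducedAlg.dense_range_of lam (ω ^ n)) ?_
    · rintro _ ⟨F, rfl⟩
      simp only [hΩ]
      exact tendsto_norm_of_upsilonFun lam ω F
    · rintro n _ ⟨f, rfl⟩
      -- The element `t⁻ⁿ f(γ)` lives purely in the `n`-th mode, hence hits the `n`-th summand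
      -- alone.
      refine ⟨ReducedAlg.of _ _ (monomialExt n f), ?_, fun m hm => ?_⟩
      · rw [hΩ, upsilonFun_monomialExt_self]
      · rw [hΩ, upsilonFun_monomialExt_ne hm, ReducedAlg.of_zero]
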